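/- Let $d\in\mathbb{N}$, $d\ge 1$, and let $\gamma,\alpha\in\mathbb{R}$ satisfy $\gamma>-\min(2,d)$ and $\alpha>1+\frac{2+\gamma}{d}$. For $q\in[1,\infty]$ and $s\in\mathbb{R}$ let $L^q_s(\mathbb{R}^d)$ be the space of Lebesgue measurable real- (or complex-) valued $f$ with $\|f\|_{L^q_s}:=\||\cdot|^s f\|_{L^q(\mathbb{R}^d)}<\infty$. Let $\tilde s\in\mathbb{R}$ satisfy $$\max\Big\{-\frac d\alpha,\frac{\gamma}{\alpha-1}\Big\}<\tilde s<\frac{2+\gamma}{\alpha-1},$$ let $q\in[1,\infty]$ satisfy $$\alpha\le q\le\infty,\qquad -\frac{\tilde s}{d}<\frac1q<\min\Big\{\frac{2}{d(\alpha-1)},\ \frac1\alpha\Big(1-\frac{\tilde s}{d}\Big),\ \frac1d\Big(\frac{2+\gamma}{\alpha-1}-\tilde s\Big)\Big\},$$ let $s\in\mathbb{R}$ satisfy $$\frac{\tilde s+\gamma}{\alpha}\le s,\qquad -\frac dq<s<\min\Big\{\frac{d+\gamma}{\alpha}-\frac dq,\ \tilde s\Big\},$$ and put $s_c:=\frac{2+\gamma}{\alpha-1}-\frac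 dq$. Notation. $e^{t\Delta}f=g_t*f$ with $g_t(x)=(4\pi t)^{-d/2}e^{-|x|^2/(4t)}$ for $t>0$, and $e^{0\Delta}f=f$. For $T>0$ put $$\|u\|_{\tilde{\mathcal K}^s(T)}:=\sup_{0\le t\le T}t^{\frac{\tilde s-s}{2}}\|u(t)\|_{L^q_s}$$ (the term at $t=0$ is $0$); $\tilde{\mathcal K}^s(T)$ is the set of measurable functions $u(t,x)$, with measurable slices $u(t)$, such that $\|u\|_{\tilde{\mathcal K}^s(T')}<\infty$ for all $T'\in(0,T)$. Consider the integral equation, for all $t\in[0,T]$ and almost every $x\in\mathbb{R}^d$, $$u(t,x)=e^{t\Delta}u_0(x)+\int_0^t e^{(t-\tau)\Delta}\big\{|\cdot|^\gamma|u(\tau)|^{\alpha-1}u(\tau)\big\}(x)\,d\tau.\tag{$*$}$$ A mild solution on $[0,T]$ with datum $u_0$ is a $u\in C([0,T];L^q_{\tilde s})\cap\tilde{\mathcal K}^s(T)$ satisfying $(*)$. Let $T_m(u_0)\in[0,\infty]$ be the supremum of all $T>0$ such that there is a unique mild solution on $[0,T]$ with datum $u_0$; a maximal solution is a function that is a mild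 solution on $[0,T]$ for every $0<T<T_m(u_0)$. The space of data $X$ is $L^q_{\tilde s}(\mathbb{R}^d)$ if $q<\infty$, and the closure of $C_0^\infty(\mathbb{R}^d)$ in $L^\infty_{\tilde s}(\mathbb{R}^d)$ if $q=\infty$. Then the Cauchy problem $\partial_tu-\Delta u=|x|^\gamma|u|^{\alpha-1}u$, $u(0)=u_0$, is locally well-posed in the following sense. There is a function $\mathcal T$ with positive values, depending only on the parameters, such that, with $T(u_0):=\mathcal T(\|u_0\|_{L^q_{\tilde s}})$: (i) (Existence) For every $u_0\in X$ there is a mild solution $u$ on $[0,T(u_0)]$ with $$\|u\|_{\tilde{\mathcal K}^s(T(u_0))}\le 2\,\|e^{t\Delta}u_0\|_{\tilde{\mathcal K}^s(T(u_0))}<\infty,$$ and $u$ extends to a maximal solution on $[0,T_m(u_0))$. (ii) (Uniqueness in $\tilde{\mathcal K}^s(T)$) Let $T>0$ and $u_0\in L^q_{\tilde s}(\mathbb{R}^d)$. If $u,v\in\tilde{\mathcal K}^s(T)$ satisfy $(*)$ with the same $u_0$, then $u(t)=v(t)$ almost everywhere, for every $t\in[0,T]$. (iii) (Continuous dependence)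 For every $R\ge0$ there are $C\ge0$ and $T>0$ such that for all $u_0,v_0\in X$ of norm at most $R$ one has $T\le\min\{T(u_0),T(v_0)\}$, and the mild solutions $u$ on $[0,T(u_0)]$ and $v$ on $[0,T(v_0)]$ with data $u_0$ and $v_0$ satisfy $$\sup_{0\le t\le T}\|u(t)-v(t)\|_{L^q_{\tilde s}}\le C\|u_0-v_0\|_{L^q_{\tilde s}},\qquad \|u-v\|_{\tilde{\mathcal K}^s(T)}\le C\|u_0-v_0\|_{L^q_{\tilde s}}.$$ (iv) (Blow-up) Let $u_0\in X$ with $T_m=T_m(u_0)<\infty$ and let $u$ be the maximal solution. Then $\lim_{t\to T_m-0}\|u(t)\|_{L^q_{\tilde s}}=\infty$, and there is a constant $C>0$ independent of $t$ such that $$\|u(t)\|_{L^q_{\tilde s}}\ge\frac{C}{(T_m-t)^{\frac{s_c-\tilde s}{2}}}\qquad\text{for all }t\in(0,T_m).$$ -/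

import Mathlib

open MeasureTheory Set Filter Topology
open scoped ENNReal NNReal ContDiff

noncomputable section

namespace HardyHenon

/-- The space `ℝ^d` with its Euclidean norm. -/
abbrev Sp (d : ℕ) : Type := EuclideanSpace ℝ (Fin d)

variable {d : ℕ} {𝕜 : Type*} [RCLike 𝕜]

/-- The number `1/q` for `q ∈ [1,∞]`, with `1/∞ = 0`. -/
def invExp (q : ℝ≥0∞) : ℝ := (q⁻¹).toReal

/-- The Fujita exponent `α_F(d,γ) = 1 + (2+γ)/d`. -/
def fujitaExp (d : ℕ) (γ : ℝ) : ℝ := 1 + (2 + γ) / d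

/-- The critical weight `s_c = (2+γ)/(α-1) - d/q`. -/
def critWeight (d : ℕ) (γ α : ℝ) (q : ℝ≥0∞) : ℝ := (2 + γ) / (α - 1) - d * invExp q

/-- The norm `‖f‖_{L^q_s} = ‖ |x|^s f ‖_{L^q}` (an essential supremum for `q = ∞`), with values in
`[0,∞]`. -/
def wNorm (q : ℝ≥0∞) (s : ℝ) (f : Sp d → 𝕜) : ℝ≥0∞ :=
  eLpNorm (fun x => ‖x‖ ^ s * ‖f x‖) q volume

/-- `f ∈ L^q_s(ℝ^d)`: `f` is Lebesgue measurable with finite norm. -/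
def MemW (q : ℝ≥0∞) (s : ℝ) (f : Sp d → 𝕜) : Prop :=
  AEStronglyMeasurable f volume ∧ wNorm q s f < ⊤

/-- `f` lies in the closure of `C_0^∞(ℝ^d)` in `L^q_s(ℝ^d)`. -/
def MemWClosure (q : ℝ≥0∞) (s : ℝ) (f : Sp d → 𝕜) : Prop :=
  MemW q s f ∧ ∀ ε : ℝ≥0∞, 0 < ε →
    ∃ φ : Sp d → 𝕜, ContDiff ℝ ∞ φ ∧ HasCompactSupport φ ∧ wNorm q s (f - φ) < ε

/-- The admissible initial data: all of `L^q_s(ℝ^d)` if `q < ∞`, and the closure of `C_0^∞(ℝ^d)` in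
`L^∞_s(ℝ^d)` if `q = ∞`. -/
def IsDatum (q : ℝ≥0∞) (s : ℝ) (f : Sp d → 𝕜) : Prop :=
  MemW q s f ∧ (q = ⊤ → MemWClosure q s f)

/-- The heat kernel `g_t(x) = (4πt)^{-d/2} e^{-|x|²/(4t)}`. -/
def heatKernel (d : ℕ) (t : ℝ) (x : Sp d) : ℝ :=
  (4 * Real.pi * t) ^ (-(d : ℝ) / 2) * Real.exp (-‖x‖ ^ 2 / (4 * t))

/-- The heat semigroup: `e^{tΔ} f = g_t * f` for `t > 0`, and `e^{0Δ} f = f`. -/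
def heat (t : ℝ) (f : Sp d → 𝕜) (x : Sp d) : 𝕜 :=
  if t = 0 then f x else ∫ y, heatKernel d t (x - y) • f y

/-- The nonlinearity `|x|^γ |f(x)|^{α-1} f(x)`. -/
def nonlin (γ α : ℝ) (f : Sp d → 𝕜) (x : Sp d) : 𝕜 :=
  (‖x‖ ^ γ * ‖f x‖ ^ (α - 1)) • f x

/-- The Kato norm `sup_{0 ≤ t ≤ T} t^{(s̃-s)/2} ‖u(t)‖_{L^q_s}`, with values in `[0,∞]`. For
`s < s̃` the term at `t = 0` vanishes, since `0 * ∞ = 0` in `[0,∞]`. -/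
def katoNorm (q : ℝ≥0∞) (s' s T : ℝ) (u : ℝ → Sp d → 𝕜) : ℝ≥0∞ :=
  ⨆ t ∈ Icc (0 : ℝ) T, ENNReal.ofReal t ^ ((s' - s) / 2) * wNorm q s (u t)

/-- The Kato space on `[0,T)`: measurable functions of `(t,x)` whose slices `u(t)` are measurable
and for which the Kato norm on `[0,T']` is finite for every `T' ∈ (0,T)`. -/
def IsKato (q : ℝ≥0∞) (s' s T : ℝ) (u : ℝ → Sp d → 𝕜) : Prop :=
  AEStronglyMeasurable (fun p : ℝ × Sp d => u p.1 p.2)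
      ((volume.restrict (Ioo 0 T)).prod volume) ∧
    (∀ t ∈ Ioo (0 : ℝ) T, AEStronglyMeasurable (u t) volume) ∧
    ∀ T' ∈ Ioo (0 : ℝ) T, katoNorm q s' s T' u < ⊤

/-- `u ∈ C([0,T]; L^q_s(ℝ^d))`. -/
def IsContW (q : ℝ≥0∞) (s T : ℝ) (u : ℝ → Sp d → 𝕜) : Prop :=
  (∀ t ∈ Icc (0 : ℝ) T, MemW q s (u t)) ∧
    ∀ t ∈ Icc (0 : ℝ) T, Tendsto (fun r => wNorm q s (u r - u t)) (𝓝[Icc 0 T] t) (𝓝 0)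

/-- The integral equation
`u(t,x) = e^{tΔ}u₀(x) + ∫_0^t e^{(t-τ)Δ} { |·|^γ |u(τ)|^{α-1} u(τ) }(x) dτ`
for all `t ∈ [0,T]` and almost every `x`, including the convergence of the time integral. -/
def SolvesIntegralEq (γ α T : ℝ) (u₀ : Sp d → 𝕜) (u : ℝ → Sp d → 𝕜) : Prop :=
  ∀ t ∈ Icc (0 : ℝ) T, ∀ᵐ x ∂(volume : Measure (Sp d)),
    IntervalIntegrable (fun τ => heat (t - τ) (nonlin γ α (u τ)) x) volume 0 t ∧
      u t x = heat t u₀ x + ∫ τ in (0 : ℝ)..t, heat (t - τ) (nonlin γ α (u τ)) x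

/-- `L^q_{s̃}`-mild solutions on `[0,T]` with initial datum `u₀` (here `s' = s̃`). -/
structure IsMildSol (γ α : ℝ) (q : ℝ≥0∞) (s' s T : ℝ) (u₀ : Sp d → 𝕜)
    (u : ℝ → Sp d → 𝕜) : Prop where
  cont : IsContW q s' T u
  kato : IsKato q s' s T u
  eqn : SolvesIntegralEq γ α T u₀ u

/-- The maximal existence time `T_m(u₀) ∈ [0,∞]`: the supremum of all `T > 0` for which there is a
unique mild solution on `[0,T]`. -/
def maxTime (γ α : ℝ) (q : ℝ≥0∞) (s' s : ℝ) (u₀ : Sp d → 𝕜) : ℝ≥0∞ :=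
  sSup {τ : ℝ≥0∞ | ∃ T : ℝ, 0 < T ∧ τ = ENNReal.ofReal T ∧
    ∃ u : ℝ → Sp d → 𝕜, IsMildSol γ α q s' s T u₀ u ∧
      ∀ v : ℝ → Sp d → 𝕜, IsMildSol γ α q s' s T u₀ v → ∀ t ∈ Icc (0 : ℝ) T, v t =ᵐ[volume] u t}

/-- `u` is a mild solution on the maximal interval `[0,T_m(u₀))`. -/
def IsMaximalSol (γ α : ℝ) (q : ℝ≥0∞) (s' s : ℝ) (u₀ : Sp d → 𝕜)
    (u : ℝ → Sp d → 𝕜) : Prop :=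
  ∀ T : ℝ, 0 < T → ENNReal.ofReal T < maxTime γ α q s' s u₀ → IsMildSol γ α q s' s T u₀ u

end HardyHenon

end

/-!
The proof is a fixed point argument in the Kato space, with the weight `t^{(s̃-s)/2}`.

* *Linear estimates.* For `1 ≤ p ≤ r`, `s₂ ≤ s₁`, `-d/r < s₂` and `s₁ < d(1 - 1/p)` the heat
  semigroup maps `L^p_{s₁}` to `L^r_{s₂}` with norm `K t^{-κ}`, `2κ = d(1/p - 1/r) + s₁ - s₂`
  (`exists_wNormE_heatE_le`). By scaling only `t = 1` matters, where the kernel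
  `|x|^{s₂} e^{-|x-y|²/4} |y|^{-s₁}` is bounded by a product term, treated by Hölder's inequality,
  plus a convolution term.
* *Duhamel estimate.* If `‖u(τ)‖_{L^q_s} ≤ M τ^{-(s̃-s)/2}`, the nonlinearity lies in
  `L^{q/α}_{αs-γ}` with norm `≲ M^α τ^{-α(s̃-s)/2}`, and integrating the linear estimates gives the
  Duhamel term the size `M^α t^δ` in `L^q_{s̃}` and `M^α t^{δ-(s̃-s)/2}` in `L^q_s`
  (`Admissible.exists_duhE_le`). The gain is `δ = (α-1)(s_c-s̃)/2 > 0` by subcriticality. The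
  norms, semigroup and Duhamel operator are first considered on `[0,∞]`-valued functions (`wNormE`,
  `heatE`, `duhE`), so that measurability is the only side condition in the estimates, and the
  convergence of all integrals follows from the finiteness of these quantities.
* *Uniqueness* (`Admissible.ae_eq_of_solves`) holds without smallness: with an additional weight
  `e^{-lt}` the difference of two solutions contracts for large `l`.
* *Existence* (`Admissible.exists_isKatoSol_of_small`): when `T^δ ‖u₀‖^{α-1}` is small, the Picard
  iterates converge with factor `1/2`. The same contraction gives the Lipschitz dependence.
* *Continuity in time* (`IsKatoSol.isContW`) follows by restarting the equation
  (`Admissible.restart`): `u(a+r) = e^{rΔ}u(a) + O(r^δ)` uniformly in `a`, and the heat semigroup is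
  strongly continuous on the space of data. For this `u(a)` has to be a datum
  (`IsKatoSol.isDatum`). For `q = ∞` that is not automatic: raising the weight `s` a little, the
  Duhamel term lies in `L^∞_σ` with some `σ > s̃`, where the heat flow takes values in the continuous
  functions with extra decay, which are limits of test functions, and the Duhamel term is the limit
  of its own heat regularizations.
* *Blow-up.* A solution that is restarted at a time `t` from `u(t)` extends the original one
  (`IsKatoSol.concat`, `IsMildSol.add_le_maxTime`). Hence `T ≤ T_m - t` whenever
  `T^δ ‖u(t)‖^{α-1} ≤ κ`, and with `T = 2(T_m - t)` this gives the lower bound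
  `‖u(t)‖ ≳ (T_m - t)^{-δ/(α-1)}`, in which `δ/(α-1) = (s_c-s̃)/2`.
-/

noncomputable section

namespace HardyHenon

variable {d : ℕ} {𝕜 : Type*} [RCLike 𝕜]

/-! ### Integral inequalities for functions with values in `[0,∞]` -/

theorem eLpNorm_const_mul_le {α : Type*} [MeasurableSpace α] {μ : Measure α} {p : ℝ≥0∞}
    {f : α → ℝ≥0∞} {c : ℝ≥0∞} (hc : c ≠ ⊤) :
    eLpNorm (fun x => c * f x) p μ ≤ c * eLpNorm f p μ := by
  lift c to ℝ≥0 using hc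
  exact eLpNorm_le_nnreal_smul_eLpNorm_of_ae_le_mul' (.of_forall fun x => le_rfl) p

/-- The pointwise Hölder step in the proof of Minkowski's integral inequality: the weight `A`
plays the role of `a ↦ ‖F a‖_p`. -/
theorem rpow_lintegral_le_of_weight {α : Type*} [MeasurableSpace α] {μ : Measure α} {r : ℝ}
    (hr : 1 ≤ r) {f A : α → ℝ≥0∞} (hf : AEMeasurable f μ) (hA : AEMeasurable A μ)
    (hAtop : ∀ᵐ a ∂μ, A a ≠ ⊤) (h0 : ∀ᵐ a ∂μ, A a = 0 → f a = 0) :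
    (∫⁻ a, f a ∂μ) ^ r ≤ (∫⁻ a, A a ∂μ) ^ (r - 1) * ∫⁻ a, f a ^ r * A a ^ (1 - r) ∂μ := by
  rcases hr.eq_or_lt with rfl | hr1
  · simp
  have hr0 : 0 < r := by linarith
  have hconj : r.HolderConjugate (r / (r - 1)) := by
    rw [Real.holderConjugate_iff]
    refine ⟨hr1, ?_⟩
    field_simp
    ring
  have key := ENNReal.lintegral_mul_le_Lp_mul_Lq μ hconj
    (f := fun a => f a * A a ^ (-((r - 1) / r))) (g := fun a => A a ^ ((r - 1) / r))
    (hf.mul (hA.pow_const _)) (hA.pow_const _)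
  have h1 : ∫⁻ a, f a ∂μ
      = ∫⁻ a, ((fun a => f a * A a ^ (-((r - 1) / r))) * fun a => A a ^ ((r - 1) / r)) a ∂μ := by
    refine lintegral_congr_ae ?_
    filter_upwards [hAtop, h0] with a ha ha0
    by_cases hz : A a = 0
    · simp [ha0 hz]
    · simp only [Pi.mul_apply]
      rw [mul_assoc, ← ENNReal.rpow_add _ _ hz ha]
      simp
  have h2 : ∀ a, (A a ^ ((r - 1) / r)) ^ (r / (r - 1)) = A a := by
    intro a
    rw [← ENNReal.rpow_mul]
    have : (r - 1) / r * (r / (r - 1)) = 1 := by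
      have : r - 1 ≠ 0 := by linarith
      field_simp
    rw [this, ENNReal.rpow_one]
  have h3 : ∀ a, (f a * A a ^ (-((r - 1) / r))) ^ r = f a ^ r * A a ^ (1 - r) := by
    intro a
    rw [ENNReal.mul_rpow_of_nonneg _ _ hr0.le, ← ENNReal.rpow_mul]
    congr 2
    field_simp
    ring
  simp only [h2, h3] at key
  rw [h1]
  calc _ ≤ ((∫⁻ a, f a ^ r * A a ^ (1 - r) ∂μ) ^ (1 / r) *
        (∫⁻ a, A a ∂μ) ^ (1 / (r / (r - 1)))) ^ r := by gcongr
    _ = _ := by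
      rw [ENNReal.mul_rpow_of_nonneg _ _ hr0.le, ← ENNReal.rpow_mul, ← ENNReal.rpow_mul, mul_comm]
      have e1 : 1 / r * r = 1 := by field_simp
      have e2 : 1 / (r / (r - 1)) * r = r - 1 := by field_simp
      rw [e1, e2, ENNReal.rpow_one]

theorem eLpNorm_lintegral_le_of_measurable {α β : Type*} [MeasurableSpace α] [MeasurableSpace β]
    {μ : Measure α} [SFinite μ] {ν : Measure β} [SFinite ν] {p : ℝ≥0∞} (hp : 1 ≤ p)
    {F : α → β → ℝ≥0∞} (hF : Measurable (Function.uncurry F)) {A : α → ℝ≥0∞}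
    (hA : Measurable A) (h : ∀ᵐ a ∂μ, eLpNorm (F a) p ν ≤ A a) :
    eLpNorm (fun b => ∫⁻ a, F a b ∂μ) p ν ≤ ∫⁻ a, A a ∂μ := by
  rcases eq_or_ne p ⊤ with rfl | hpt
  · have h1 : ∀ᵐ a ∂μ, ∀ᵐ b ∂ν, F a b ≤ A a := by
      filter_upwards [h] with a ha
      filter_upwards [ae_le_eLpNormEssSup (f := F a) (μ := ν)] with b hb
      exact hb.trans (by simpa using ha)
    have hm : MeasurableSet {z : α × β | F z.1 z.2 ≤ A z.1} :=
      measurableSet_le hF (hA.comp measurable_fst)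
    rw [Measure.ae_ae_comm hm] at h1
    rw [eLpNorm_exponent_top]
    refine eLpNormEssSup_le_of_ae_enorm_bound ?_
    filter_upwards [h1] with b hb
    exact lintegral_mono_ae hb
  by_cases hI : ∫⁻ a, A a ∂μ = ⊤
  · simp [hI]
  have hp0 : p ≠ 0 := by positivity
  set r := p.toReal with hr
  have hr1 : 1 ≤ r := by
    have := ENNReal.toReal_mono hpt hp
    simpa using this
  have hr0 : 0 < r := by linarith
  have hAtop : ∀ᵐ a ∂μ, A a ≠ ⊤ := by
    filter_upwards [ae_lt_top hA hI] with a ha using ha.ne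
  have hFa : ∀ a, Measurable (F a) := fun a => hF.of_uncurry_left
  have hFb : ∀ b, Measurable (fun a => F a b) := fun b => hF.of_uncurry_right
  have h0 : ∀ᵐ b ∂ν, ∀ᵐ a ∂μ, A a = 0 → F a b = 0 := by
    have hm : MeasurableSet {z : α × β | A z.1 = 0 → F z.1 z.2 = 0} := by
      have : {z : α × β | A z.1 = 0 → F z.1 z.2 = 0}
          = {z | A z.1 = 0}ᶜ ∪ {z | F z.1 z.2 = 0} := by
        ext z; simp [imp_iff_not_or]
      rw [this]
      exact (((hA.comp measurable_fst) (measurableSet_singleton 0)).compl).union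
        (hF (measurableSet_singleton 0))
    rw [← Measure.ae_ae_comm hm]
    filter_upwards [h] with a ha
    by_cases hz : A a = 0
    · have : eLpNorm (F a) p ν = 0 := le_antisymm (hz ▸ ha) bot_le
      rw [eLpNorm_eq_zero_iff (hFa a).aestronglyMeasurable hp0] at this
      filter_upwards [this] with b hb _ using hb
    · exact .of_forall fun b h' => absurd h' hz
  have hpow : ∀ a, eLpNorm (F a) p ν ≤ A a → ∫⁻ b, F a b ^ r ∂ν ≤ A a ^ r := by
    intro a ha
    rw [eLpNorm_eq_lintegral_rpow_enorm_toReal hp0 hpt] at ha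
    simp only [enorm_eq_self] at ha
    rw [one_div] at ha
    rwa [ENNReal.rpow_inv_le_iff hr0] at ha
  rw [eLpNorm_eq_lintegral_rpow_enorm_toReal hp0 hpt]
  simp only [enorm_eq_self]
  rw [one_div, ENNReal.rpow_inv_le_iff hr0]
  calc ∫⁻ b, (∫⁻ a, F a b ∂μ) ^ r ∂ν
      ≤ ∫⁻ b, (∫⁻ a, A a ∂μ) ^ (r - 1) * ∫⁻ a, F a b ^ r * A a ^ (1 - r) ∂μ ∂ν := by
        refine lintegral_mono_ae ?_
        filter_upwards [h0] with b hb
        exact rpow_lintegral_le_of_weight hr1 (hFb b).aemeasurable hA.aemeasurable hAtop hb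
    _ = (∫⁻ a, A a ∂μ) ^ (r - 1) * ∫⁻ a, ∫⁻ b, F a b ^ r * A a ^ (1 - r) ∂ν ∂μ := by
        have hm : Measurable (fun z : β × α => F z.2 z.1 ^ r * A z.2 ^ (1 - r)) :=
          ((hF.comp measurable_swap).pow_const r).mul ((hA.comp measurable_snd).pow_const _)
        rw [lintegral_const_mul _ hm.lintegral_prod_right']
        congr 1
        exact lintegral_lintegral_swap hm.aemeasurable
    _ ≤ (∫⁻ a, A a ∂μ) ^ (r - 1) * ∫⁻ a, A a ∂μ := by
        refine mul_le_mul_right (lintegral_mono_ae ?_) _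
        filter_upwards [h, hAtop] with a ha hat
        rw [lintegral_mul_const _ ((hFa a).pow_const r)]
        refine (mul_le_mul_left (hpow a ha) _).trans ?_
        by_cases hz : A a = 0
        · simp [hz, hr0]
        · rw [← ENNReal.rpow_add _ _ hz hat]
          simp
    _ = (∫⁻ a, A a ∂μ) ^ r := by
        by_cases hz : ∫⁻ a, A a ∂μ = 0
        · simp [hz, hr0]
        · nth_rewrite 2 [← ENNReal.rpow_one (∫⁻ a, A a ∂μ)]
          rw [← ENNReal.rpow_add _ _ hz hI]
          simp

/-- **Minkowski's integral inequality** in `L^p`, `1 ≤ p ≤ ∞`, with a measurable majorant `A` of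
the norms of the slices. -/
theorem eLpNorm_lintegral_le {α β : Type*} [MeasurableSpace α] [MeasurableSpace β]
    {μ : Measure α} [SFinite μ] {ν : Measure β} [SFinite ν] {p : ℝ≥0∞} (hp : 1 ≤ p)
    {F : α → β → ℝ≥0∞} (hF : AEMeasurable (Function.uncurry F) (μ.prod ν)) {A : α → ℝ≥0∞}
    (hA : Measurable A) (h : ∀ᵐ a ∂μ, eLpNorm (F a) p ν ≤ A a) :
    eLpNorm (fun b => ∫⁻ a, F a b ∂μ) p ν ≤ ∫⁻ a, A a ∂μ := by
  have h1 : ∀ᵐ a ∂μ, ∀ᵐ b ∂ν, F a b = hF.mk _ (a, b) := Measure.ae_ae_of_ae_prod hF.ae_eq_mk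
  have h2 : ∀ᵐ b ∂ν, ∀ᵐ a ∂μ, F a b = hF.mk _ (a, b) := by
    have : ∀ᵐ z ∂(ν.prod μ), Function.uncurry F z.swap = hF.mk _ z.swap :=
      Measure.measurePreserving_swap.quasiMeasurePreserving.ae hF.ae_eq_mk
    exact Measure.ae_ae_of_ae_prod this
  have h3 := eLpNorm_lintegral_le_of_measurable (μ := μ) (ν := ν) hp
    (F := fun a b => hF.mk _ (a, b)) hF.measurable_mk hA (by
      filter_upwards [h, h1] with a ha hab
      rwa [← eLpNorm_congr_ae hab])
  refine le_trans (le_of_eq (eLpNorm_congr_ae ?_)) h3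
  filter_upwards [h2] with b hb
  exact lintegral_congr_ae hb

/-- Hölder's inequality for conjugate exponents `p, p' ∈ [1,∞]`. -/
theorem lintegral_mul_le_eLpNorm_mul_eLpNorm {α : Type*} [MeasurableSpace α] {μ : Measure α}
    {p p' : ℝ≥0∞} (hpp : p⁻¹ + p'⁻¹ = 1) {f g : α → ℝ≥0∞} (hf : AEMeasurable f μ)
    (hg : AEMeasurable g μ) :
    ∫⁻ a, f a * g a ∂μ ≤ eLpNorm f p' μ * eLpNorm g p μ := by
  have top_one : ∀ {f g : α → ℝ≥0∞}, AEMeasurable g μ →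
      ∫⁻ a, f a * g a ∂μ ≤ eLpNorm f ⊤ μ * eLpNorm g 1 μ := by
    intro f g hg
    rw [eLpNorm_one_eq_lintegral_enorm, eLpNorm_exponent_top]
    simp only [enorm_eq_self]
    rw [← lintegral_const_mul'' _ hg]
    refine lintegral_mono_ae ?_
    filter_upwards [ae_le_eLpNormEssSup (f := f) (μ := μ)] with a ha
    exact mul_le_mul_left (by simpa using ha) _
  rcases eq_or_ne p ⊤ with rfl | hpt
  · have : p' = 1 := by simpa using hpp
    subst this
    simp_rw [mul_comm (f _)]
    rw [mul_comm]
    exact top_one hf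
  rcases eq_or_ne p' ⊤ with rfl | hpt'
  · have : p = 1 := by simpa using hpp
    subst this
    exact top_one hg
  have hp0 : p ≠ 0 := by rintro rfl; simp at hpp
  have hp0' : p' ≠ 0 := by rintro rfl; simp at hpp
  have hconj : p'.toReal.HolderConjugate p.toReal := by
    have h1 : (p'.toReal)⁻¹ + (p.toReal)⁻¹ = 1 := by
      have := congrArg ENNReal.toReal hpp
      rw [ENNReal.toReal_add (by simpa using hp0) (by simpa using hp0')] at this
      simp only [ENNReal.toReal_inv, ENNReal.toReal_one] at this
      linarith
    have h2 : 0 < p.toReal := ENNReal.toReal_pos hp0 hpt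
    have h3 : 0 < p'.toReal := ENNReal.toReal_pos hp0' hpt'
    rw [Real.holderConjugate_iff]
    refine ⟨?_, h1⟩
    have : (p'.toReal)⁻¹ < 1 := by linarith [inv_pos.2 h2]
    exact (inv_lt_one₀ h3).1 this
  have := ENNReal.lintegral_mul_le_Lp_mul_Lq μ hconj hf hg
  rw [eLpNorm_eq_lintegral_rpow_enorm_toReal hp0 hpt,
    eLpNorm_eq_lintegral_rpow_enorm_toReal hp0' hpt']
  simpa using this

/-! ### Weighted norms and the heat semigroup for functions with values in `[0,∞]` -/

/-- The weighted norm `‖ |x|^s f ‖_{L^q}` of a function with values in `[0,∞]`. -/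
def wNormE (q : ℝ≥0∞) (s : ℝ) (f : Sp d → ℝ≥0∞) : ℝ≥0∞ :=
  eLpNorm (fun x => ENNReal.ofReal (‖x‖ ^ s) * f x) q volume

/-- The heat semigroup on functions with values in `[0,∞]`, as a Lebesgue integral without any
integrability requirement. It dominates `heat`. -/
def heatE (t : ℝ) (f : Sp d → ℝ≥0∞) (x : Sp d) : ℝ≥0∞ :=
  ∫⁻ y, ENNReal.ofReal (heatKernel d t (x - y)) * f y

theorem wNorm_eq_wNormE (q : ℝ≥0∞) (s : ℝ) (f : Sp d → 𝕜) :
    wNorm q s f = wNormE q s (fun x => ‖f x‖ₑ) := by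
  refine eLpNorm_congr_enorm_ae (.of_forall fun x => ?_)
  rw [enorm_mul, enorm_norm, Real.enorm_eq_ofReal (by positivity), enorm_eq_self]

theorem wNormE_mono {q : ℝ≥0∞} {s : ℝ} {f g : Sp d → ℝ≥0∞}
    (h : ∀ᵐ x ∂(volume : Measure (Sp d)), f x ≤ g x) : wNormE q s f ≤ wNormE q s g := by
  refine eLpNorm_mono_enorm_ae ?_
  filter_upwards [h] with x hx
  simp only [enorm_eq_self]
  gcongr

theorem measurable_weight (s : ℝ) : Measurable (fun x : Sp d => ENNReal.ofReal (‖x‖ ^ s)) := by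
  fun_prop

theorem wNormE_add_le {q : ℝ≥0∞} (hq : 1 ≤ q) {s : ℝ} {f g : Sp d → ℝ≥0∞} (hf : AEMeasurable f)
    (hg : AEMeasurable g) : wNormE q s (fun x => f x + g x) ≤ wNormE q s f + wNormE q s g := by
  unfold wNormE
  simp_rw [mul_add]
  exact eLpNorm_add_le ((measurable_weight s).aemeasurable.mul hf).aestronglyMeasurable
    ((measurable_weight s).aemeasurable.mul hg).aestronglyMeasurable hq

theorem wNormE_const_mul_le {q : ℝ≥0∞} {s : ℝ} {f : Sp d → ℝ≥0∞} {c : ℝ≥0∞} (hc : c ≠ ⊤) :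
    wNormE q s (fun x => c * f x) ≤ c * wNormE q s f := by
  unfold wNormE
  simp_rw [mul_left_comm _ c]
  exact eLpNorm_const_mul_le hc

theorem heatKernel_nonneg {t : ℝ} (ht : 0 ≤ t) (x : Sp d) : 0 ≤ heatKernel d t x := by
  unfold heatKernel; positivity

theorem heatE_congr {t : ℝ} {f g : Sp d → ℝ≥0∞} (h : f =ᵐ[volume] g) : heatE t f = heatE t g := by
  ext x
  refine lintegral_congr_ae ?_
  filter_upwards [h] with y hy
  rw [hy]

@[fun_prop]
theorem measurable_heatKernel : Measurable (fun p : ℝ × Sp d => heatKernel d p.1 p.2) := by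
  unfold heatKernel
  fun_prop

theorem measurable_heatE {β : Type*} [MeasurableSpace β] {θ : β → ℝ} (hθ : Measurable θ)
    {x : β → Sp d} (hx : Measurable x) {f : β → Sp d → ℝ≥0∞}
    (hf : Measurable (Function.uncurry f)) : Measurable (fun b => heatE (θ b) (f b) (x b)) := by
  unfold heatE
  have : Measurable (fun p : β × Sp d =>
      ENNReal.ofReal (heatKernel d (θ p.1) (x p.1 - p.2)) * f p.1 p.2) := by
    refine Measurable.mul ?_ hf
    exact ENNReal.measurable_ofReal.comp (measurable_heatKernel.comp
      ((hθ.comp measurable_fst).prodMk ((hx.comp measurable_fst).sub measurable_snd)))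
  exact this.lintegral_prod_right'

/-! ### The kernel bound behind the weighted linear estimate -/

theorem norm_ratio_rpow_le {s : ℝ} {a b z : ℝ} (ha : 1 ≤ a) (hb : 1 ≤ b) (h1 : a ≤ b + z)
    (h2 : b ≤ a + z) : a ^ s * b ^ (-s) ≤ (1 + z) ^ |s| := by
  have key : ∀ {a b s : ℝ}, 1 ≤ b → 0 ≤ a → a ≤ b + z → 0 ≤ s → a ^ s * b ^ (-s) ≤ (1 + z) ^ s := by
    intro a b s hb ha h hs
    rw [Real.rpow_neg (by linarith), ← div_eq_mul_inv, ← Real.div_rpow ha (by linarith)]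
    refine Real.rpow_le_rpow (by positivity) ?_ hs
    rw [div_le_iff₀ (by linarith)]
    nlinarith
  rcases le_total 0 s with hs | hs
  · rw [abs_of_nonneg hs]
    exact key hb (by linarith) h1 hs
  · rw [abs_of_nonpos hs, mul_comm]
    have := key (s := -s) ha (by linarith) h2 (by linarith)
    rwa [neg_neg] at this

theorem one_add_rpow_mul_exp_le {m z : ℝ} (hm : 0 ≤ m) (hz : 0 ≤ z) :
    (1 + z) ^ m * Real.exp (-z ^ 2 / 4) ≤ Real.exp (2 * m ^ 2) * Real.exp (-z ^ 2 / 8) := by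
  have h1 : (1 + z) ^ m ≤ Real.exp (m * z) := by
    rw [mul_comm, Real.exp_mul]
    exact Real.rpow_le_rpow (by linarith) (by linarith [Real.add_one_le_exp z]) hm
  calc _ ≤ Real.exp (m * z) * Real.exp (-z ^ 2 / 4) := by gcongr
    _ ≤ _ := by
      rw [← Real.exp_add, ← Real.exp_add]
      refine Real.exp_le_exp.2 ?_
      nlinarith [sq_nonneg (z - 4 * m)]

/-- The weighted Gaussian kernel splits into a rank-one part, which takes care of the
singularities of the weights at the origin, and a convolution part, on which the ratio of the
weights is of polynomial growth in `x - y`. -/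
theorem weighted_gaussian_le {s₁ s₂ : ℝ} (hs : s₂ ≤ s₁) {x y : Sp d} (hx : x ≠ 0) (hy : y ≠ 0) :
    ‖x‖ ^ s₂ * Real.exp (-‖x - y‖ ^ 2 / 4) ≤ (Real.exp 1 + Real.exp (2 * |s₂| ^ 2)) *
      ((‖x‖ ^ s₂ * Real.exp (-(1 / 8) * ‖x‖ ^ 2)) * (‖y‖ ^ (-s₁) * Real.exp (-(1 / 8) * ‖y‖ ^ 2))
        + Real.exp (-(1 / 8) * ‖x - y‖ ^ 2)) * ‖y‖ ^ s₁ := by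
  have hx0 : 0 < ‖x‖ := norm_pos_iff.2 hx
  have hy0 : 0 < ‖y‖ := norm_pos_iff.2 hy
  have e1 : ‖y‖ ^ (-s₁) * ‖y‖ ^ s₁ = 1 := by rw [← Real.rpow_add hy0]; simp
  have t1 : ‖x‖ ≤ ‖y‖ + ‖x - y‖ := by
    have := norm_add_le y (x - y); simpa using this
  have t2 : ‖y‖ ≤ ‖x‖ + ‖x - y‖ := by
    have := norm_sub_le x (x - y); simpa using this
  have hz : 0 ≤ ‖x - y‖ := norm_nonneg _
  by_cases hsmall : ‖x‖ ≤ 1 ∨ ‖y‖ ≤ 1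
  · have h2 : ‖x‖ ^ 2 + ‖y‖ ^ 2 ≤ 2 * ‖x - y‖ ^ 2 + 3 := by
      rcases hsmall with h | h
      · nlinarith [sq_nonneg (‖x‖ - ‖x - y‖)]
      · nlinarith [sq_nonneg (‖y‖ - ‖x - y‖)]
    have h3 : Real.exp (-‖x - y‖ ^ 2 / 4) ≤
        Real.exp 1 * (Real.exp (-(1 / 8) * ‖x‖ ^ 2) * Real.exp (-(1 / 8) * ‖y‖ ^ 2)) := by
      rw [← Real.exp_add, ← Real.exp_add]
      exact Real.exp_le_exp.2 (by linarith)
    calc ‖x‖ ^ s₂ * Real.exp (-‖x - y‖ ^ 2 / 4) ≤ ‖x‖ ^ s₂ *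
          (Real.exp 1 * (Real.exp (-(1 / 8) * ‖x‖ ^ 2) * Real.exp (-(1 / 8) * ‖y‖ ^ 2))) := by gcongr
      _ = Real.exp 1 * ((‖x‖ ^ s₂ * Real.exp (-(1 / 8) * ‖x‖ ^ 2)) *
          (‖y‖ ^ (-s₁) * Real.exp (-(1 / 8) * ‖y‖ ^ 2)) + 0) * ‖y‖ ^ s₁ := by
        linear_combination (-Real.exp 1 * ‖x‖ ^ s₂ * Real.exp (-(1 / 8) * ‖x‖ ^ 2) *
          Real.exp (-(1 / 8) * ‖y‖ ^ 2)) * e1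
      _ ≤ _ := by
        gcongr
        · linarith [Real.exp_pos (2 * |s₂| ^ 2)]
        · positivity
  · push Not at hsmall
    have h1 := norm_ratio_rpow_le (s := s₂) hsmall.1.le hsmall.2.le t1 t2
    have h2 := one_add_rpow_mul_exp_le (abs_nonneg s₂) hz
    have h4 : ‖y‖ ^ s₂ ≤ ‖y‖ ^ s₁ := Real.rpow_le_rpow_of_exponent_le hsmall.2.le hs
    have e2 : ‖y‖ ^ (-s₂) * ‖y‖ ^ s₂ = 1 := by rw [← Real.rpow_add hy0]; simp
    calc ‖x‖ ^ s₂ * Real.exp (-‖x - y‖ ^ 2 / 4)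
        = (‖x‖ ^ s₂ * ‖y‖ ^ (-s₂)) * Real.exp (-‖x - y‖ ^ 2 / 4) * ‖y‖ ^ s₂ := by
          linear_combination (-‖x‖ ^ s₂ * Real.exp (-‖x - y‖ ^ 2 / 4)) * e2
      _ ≤ (1 + ‖x - y‖) ^ |s₂| * Real.exp (-‖x - y‖ ^ 2 / 4) * ‖y‖ ^ s₁ := by gcongr
      _ ≤ Real.exp (2 * |s₂| ^ 2) * Real.exp (-‖x - y‖ ^ 2 / 8) * ‖y‖ ^ s₁ := by gcongr
      _ = Real.exp (2 * |s₂| ^ 2) * (0 + Real.exp (-(1 / 8) * ‖x - y‖ ^ 2)) * ‖y‖ ^ s₁ := by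
          rw [zero_add]; ring_nf
      _ ≤ _ := by
        gcongr
        · linarith [Real.exp_pos 1]
        · positivity

theorem finrank_Sp : Module.finrank ℝ (Sp d) = d := by simp

theorem integrable_rpow_norm_mul_gaussian (hd : 1 ≤ d) {σ c : ℝ} (hc : 0 < c) (hσ : -(d : ℝ) < σ) :
    Integrable (fun x : Sp d => ‖x‖ ^ σ * Real.exp (-c * ‖x‖ ^ 2)) := by
  have : Nonempty (Fin d) := ⟨⟨0, hd⟩⟩
  rw [integrable_fun_norm_addHaar volume (f := fun r => r ^ σ * Real.exp (-c * r ^ 2)), finrank_Sp]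
  refine (integrableOn_rpow_mul_exp_neg_mul_sq hc (s := σ + (d - 1 : ℕ)) ?_).congr_fun ?_
    measurableSet_Ioi
  · push_cast [hd]; linarith
  · intro r hr
    have hr' : (0 : ℝ) < r := hr
    simp only [smul_eq_mul]
    rw [Real.rpow_add hr', Real.rpow_natCast]
    ring

theorem rpow_mul_gaussian_le {σ c : ℝ} (hc : 0 < c) (hσ : 0 ≤ σ) {r : ℝ} (hr : 0 ≤ r) :
    r ^ σ * Real.exp (-c * r ^ 2) ≤ Real.exp (σ ^ 2 / (4 * c)) := by
  have h1 : r ^ σ ≤ Real.exp (σ * r) := by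
    rw [mul_comm, Real.exp_mul]
    exact Real.rpow_le_rpow hr (by linarith [Real.add_one_le_exp r]) hσ
  calc _ ≤ Real.exp (σ * r) * Real.exp (-c * r ^ 2) := by gcongr
    _ ≤ _ := by
      rw [← Real.exp_add]
      refine Real.exp_le_exp.2 ?_
      rw [le_div_iff₀ (by positivity)]
      nlinarith [sq_nonneg (2 * c * r - σ)]

theorem eLpNorm_rpow_norm_mul_gaussian_lt_top (hd : 1 ≤ d) {p : ℝ≥0∞} (hp : p ≠ 0) {σ c : ℝ}
    (hc : 0 < c) (hσ : -(d : ℝ) * invExp p < σ ∨ σ = 0) :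
    eLpNorm (fun x : Sp d => ENNReal.ofReal (‖x‖ ^ σ * Real.exp (-c * ‖x‖ ^ 2))) p volume < ⊤ := by
  rcases eq_or_ne p ⊤ with rfl | hpt
  · have hσ0 : 0 ≤ σ := by
      rcases hσ with h | h
      · simp only [invExp, ENNReal.inv_top, ENNReal.toReal_zero, mul_zero] at h; exact h.le
      · exact h.ge
    rw [eLpNorm_exponent_top]
    refine lt_of_le_of_lt (eLpNormEssSup_le_of_ae_enorm_bound
      (C := ENNReal.ofReal (Real.exp (σ ^ 2 / (4 * c)))) (.of_forall fun x => ?_)) (by simp)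
    exact ENNReal.ofReal_le_ofReal (rpow_mul_gaussian_le hc hσ0 (norm_nonneg x))
  have hr : 0 < p.toReal := ENNReal.toReal_pos hp hpt
  rw [eLpNorm_lt_top_iff_lintegral_rpow_enorm_lt_top hp hpt]
  have hint := integrable_rpow_norm_mul_gaussian hd (σ := σ * p.toReal) (c := c * p.toReal)
    (by positivity) (by
      rcases hσ with h | h
      · have h2 : invExp p * p.toReal = 1 := by
          simp only [invExp, ENNReal.toReal_inv]; field_simp
        nlinarith
      · have : (1 : ℝ) ≤ d := by exact_mod_cast hd
        rw [h]; linarith)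
  refine lt_of_le_of_lt (lintegral_mono fun x => ?_) hint.lintegral_lt_top
  simp only [enorm_eq_self]
  rw [ENNReal.ofReal_rpow_of_nonneg (by positivity) hr.le]
  refine ENNReal.ofReal_le_ofReal (le_of_eq ?_)
  rw [Real.mul_rpow (by positivity) (by positivity), ← Real.rpow_mul (norm_nonneg x),
    ← Real.exp_mul]
  ring_nf

/-! ### The weighted linear estimate -/

/-- The Gaussian `e^{-c|z|²}` as a function with values in `[0,∞]`. -/
def gaussE (c : ℝ) (z : Sp d) : ℝ≥0∞ := ENNReal.ofReal (Real.exp (-c * ‖z‖ ^ 2))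

@[fun_prop]
theorem measurable_gaussE {c : ℝ} : Measurable (gaussE c : Sp d → ℝ≥0∞) := by
  unfold gaussE; fun_prop

theorem eLpNorm_gaussE_lt_top (hd : 1 ≤ d) {p : ℝ≥0∞} (hp : p ≠ 0) {c : ℝ} (hc : 0 < c) :
    eLpNorm (gaussE c : Sp d → ℝ≥0∞) p volume < ⊤ := by
  have := eLpNorm_rpow_norm_mul_gaussian_lt_top hd hp (σ := 0) hc (.inr rfl)
  simp only [Real.rpow_zero, one_mul] at this
  exact this

theorem exists_conj {p : ℝ≥0∞} (hp : 1 ≤ p) : ∃ p' : ℝ≥0∞, p' ≠ 0 ∧ p⁻¹ + p'⁻¹ = 1 := by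
  have h1 : p⁻¹ ≤ 1 := ENNReal.inv_le_one.2 hp
  refine ⟨(1 - p⁻¹)⁻¹, ?_, ?_⟩
  · rw [ENNReal.inv_ne_zero]
    exact ne_top_of_le_ne_top ENNReal.one_ne_top tsub_le_self
  · rw [inv_inv, add_tsub_cancel_of_le h1]

theorem invExp_conj {p p' : ℝ≥0∞} (h : p⁻¹ + p'⁻¹ = 1) : invExp p' = 1 - invExp p := by
  have h1 : p⁻¹ ≠ ⊤ := fun h' => by simp [h'] at h
  have h2 : p'⁻¹ ≠ ⊤ := fun h' => by simp [h'] at h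
  have := congrArg ENNReal.toReal h
  rw [ENNReal.toReal_add h1 h2, ENNReal.toReal_one] at this
  unfold invExp
  linarith

/-- Convolution with a Gaussian on functions with values in `[0,∞]`. -/
def gaussConv (c : ℝ) (g : Sp d → ℝ≥0∞) (x : Sp d) : ℝ≥0∞ := ∫⁻ y, gaussE c (x - y) * g y

theorem measurable_gaussConv {c : ℝ} {g : Sp d → ℝ≥0∞} (hg : Measurable g) :
    Measurable (gaussConv c g) := by
  unfold gaussConv
  have : Measurable (fun p : Sp d × Sp d => gaussE c (p.1 - p.2) * g p.2) := by fun_prop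
  exact this.lintegral_prod_right'

/-- Young's inequality for a Gaussian convolution kernel: it maps `L^p` to `L^r` for `p ≤ r`, by
Hölder's inequality (`r = ∞`), Minkowski's inequality (`r = p`), and interpolation. -/
theorem exists_eLpNorm_gaussConv_le (hd : 1 ≤ d) {p r : ℝ≥0∞} (hp : 1 ≤ p) (hpr : p ≤ r) {c : ℝ}
    (hc : 0 < c) : ∃ K : ℝ≥0, ∀ g : Sp d → ℝ≥0∞, Measurable g →
      eLpNorm (gaussConv c g) r volume ≤ K * eLpNorm g p volume := by
  obtain ⟨p', hp'0, hpp'⟩ := exists_conj hp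
  have hK1 := (eLpNorm_gaussE_lt_top hd hp'0 hc).ne
  have hK2 := (eLpNorm_gaussE_lt_top hd one_ne_zero hc).ne
  set K1 := eLpNorm (gaussE c : Sp d → ℝ≥0∞) p' volume with hK1def
  set K2 := eLpNorm (gaussE c : Sp d → ℝ≥0∞) 1 volume with hK2def
  have hK : max K1 K2 ≠ ⊤ := by simp [hK1, hK2]
  lift max K1 K2 to ℝ≥0 using hK with K hKeq
  have hK1K : K1 ≤ K := hKeq ▸ le_max_left _ _
  have hK2K : K2 ≤ K := hKeq ▸ le_max_right _ _
  refine ⟨K, fun g hg => ?_⟩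
  have hsup : ∀ x, gaussConv c g x ≤ K * eLpNorm g p volume := by
    intro x
    refine (lintegral_mul_le_eLpNorm_mul_eLpNorm hpp'
      (f := fun y => gaussE c (x - y)) (by fun_prop) hg.aemeasurable).trans ?_
    refine mul_le_mul_left (le_trans (le_of_eq ?_) hK1K) _
    exact eLpNorm_comp_measurePreserving (g := (gaussE c : Sp d → ℝ≥0∞))
      measurable_gaussE.aestronglyMeasurable (Measure.measurePreserving_sub_left volume x)
  have hself : eLpNorm (gaussConv c g) p volume ≤ K * eLpNorm g p volume := by
    have hconv : gaussConv c g = fun x => ∫⁻ z, gaussE c z * g (x - z) := by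
      ext x
      unfold gaussConv
      rw [← lintegral_sub_left_eq_self _ x]
      simp
    rw [hconv]
    have := eLpNorm_lintegral_le (μ := (volume : Measure (Sp d))) (ν := (volume : Measure (Sp d)))
      hp (F := fun z x => gaussE c z * g (x - z)) (by
        unfold Function.uncurry; fun_prop) (A := fun z => gaussE c z * eLpNorm g p volume)
      (by fun_prop) (.of_forall fun z => by
        refine (eLpNorm_const_mul_le (by simp [gaussE])).trans_eq ?_
        congr 1
        exact eLpNorm_comp_measurePreserving (g := g) hg.aestronglyMeasurable
          (measurePreserving_sub_right volume z))
    refine this.trans ?_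
    rw [lintegral_mul_const _ measurable_gaussE]
    refine mul_le_mul_left (le_trans (le_of_eq ?_) hK2K) _
    rw [hK2def, eLpNorm_one_eq_lintegral_enorm]
    rfl
  rcases eq_or_ne r ⊤ with rfl | hrt
  · rw [eLpNorm_exponent_top]
    exact eLpNormEssSup_le_of_ae_enorm_bound (.of_forall hsup)
  have hpt : p ≠ ⊤ := ne_top_of_le_ne_top hrt hpr
  have hp0 : p ≠ 0 := by positivity
  have hr0 : r ≠ 0 := fun h => by simp [h] at hpr; exact hp0 hpr
  have hp0' := ENNReal.toReal_pos hp0 hpt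
  have hr0' := ENNReal.toReal_pos hr0 hrt
  have hpr' : p.toReal ≤ r.toReal := ENNReal.toReal_mono hrt hpr
  rw [eLpNorm_eq_lintegral_rpow_enorm_toReal hp0 hpt (f := gaussConv c g), one_div,
    ENNReal.rpow_inv_le_iff hp0'] at hself
  rw [eLpNorm_eq_lintegral_rpow_enorm_toReal hr0 hrt, one_div, ENNReal.rpow_inv_le_iff hr0']
  simp only [enorm_eq_self] at hself ⊢
  have split : ∀ z : ℝ≥0∞, z ^ r.toReal = z ^ (r.toReal - p.toReal) * z ^ p.toReal := by
    intro z
    rw [← ENNReal.rpow_add_of_nonneg _ _ (by linarith) hp0'.le]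
    simp
  calc ∫⁻ x, gaussConv c g x ^ r.toReal
      ≤ ∫⁻ x, (K * eLpNorm g p volume) ^ (r.toReal - p.toReal) * gaussConv c g x ^ p.toReal := by
        refine lintegral_mono fun x => ?_
        simp only []
        rw [split]
        exact mul_le_mul_left (ENNReal.rpow_le_rpow (hsup x) (by linarith)) _
    _ = (K * eLpNorm g p volume) ^ (r.toReal - p.toReal) * ∫⁻ x, gaussConv c g x ^ p.toReal :=
        lintegral_const_mul _ ((measurable_gaussConv hg).pow_const _)
    _ ≤ _ := by
        rw [split (K * eLpNorm g p volume)]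
        gcongr

theorem ae_ne_zero (hd : 1 ≤ d) : ∀ᵐ x ∂(volume : Measure (Sp d)), x ≠ 0 := by
  have : Nonempty (Fin d) := ⟨⟨0, hd⟩⟩
  exact Measure.ae_ne volume 0

theorem invExp_nonneg (p : ℝ≥0∞) : 0 ≤ invExp p := ENNReal.toReal_nonneg

theorem ofReal_mul_weights {A C X Y H Z : ℝ} (hA : 0 ≤ A) (hC : 0 ≤ C) (hX : 0 ≤ X) (hY : 0 ≤ Y)
    (hH : 0 ≤ H) (F : ℝ≥0∞) :
    ENNReal.ofReal (A * (C * (X * Y + H) * Z)) * F = ENNReal.ofReal (A * C) *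
      (ENNReal.ofReal X * (ENNReal.ofReal Y * (ENNReal.ofReal Z * F)) +
        ENNReal.ofReal H * (ENNReal.ofReal Z * F)) := by
  rw [ENNReal.ofReal_mul hA, ENNReal.ofReal_mul hA, ENNReal.ofReal_mul (by positivity),
    ENNReal.ofReal_mul hC, ENNReal.ofReal_add (by positivity) hH, ENNReal.ofReal_mul hX]
  ring

theorem heatE_one_pointwise {s₁ s₂ : ℝ} (hs : s₂ ≤ s₁) (hd : 1 ≤ d) {f : Sp d → ℝ≥0∞}
    (hf : Measurable f) {x : Sp d} (hx : x ≠ 0) :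
    ENNReal.ofReal (‖x‖ ^ s₂) * heatE 1 f x ≤
      ENNReal.ofReal ((4 * Real.pi) ^ (-(d : ℝ) / 2) * (Real.exp 1 + Real.exp (2 * |s₂| ^ 2))) *
        (ENNReal.ofReal (‖x‖ ^ s₂ * Real.exp (-(1 / 8) * ‖x‖ ^ 2)) *
          (∫⁻ y, ENNReal.ofReal (‖y‖ ^ (-s₁) * Real.exp (-(1 / 8) * ‖y‖ ^ 2)) *
            (ENNReal.ofReal (‖y‖ ^ s₁) * f y)) +
          gaussConv (1 / 8) (fun y => ENNReal.ofReal (‖y‖ ^ s₁) * f y) x) := by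
  have m1 : Measurable (fun y : Sp d => ENNReal.ofReal (heatKernel d 1 (x - y)) * f y) := by
    refine Measurable.mul ?_ hf
    exact ENNReal.measurable_ofReal.comp (measurable_heatKernel.comp
      (measurable_const.prodMk (measurable_const.sub measurable_id)))
  have m2 : Measurable (fun y : Sp d =>
    ENNReal.ofReal (‖y‖ ^ (-s₁) * Real.exp (-(1 / 8) * ‖y‖ ^ 2)) *
            (ENNReal.ofReal (‖y‖ ^ s₁) * f y)) := by fun_prop
  have m3 : Measurable (fun y : Sp d => gaussE (1 / 8) (x - y) *
            (ENNReal.ofReal (‖y‖ ^ s₁) * f y)) := by fun_prop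
  unfold heatE gaussConv
  beta_reduce
  rw [← lintegral_const_mul _ m1, ← lintegral_const_mul _ m2,
    ← lintegral_add_left (m2.const_mul _), ← lintegral_const_mul]
  swap
  · exact (m2.const_mul _).add m3
  refine lintegral_mono_ae ?_
  filter_upwards [ae_ne_zero hd] with y hy
  have key := weighted_gaussian_le hs hx hy
  have hA : (0 : ℝ) ≤ (4 * Real.pi) ^ (-(d : ℝ) / 2) := by positivity
  have key2 := mul_le_mul_of_nonneg_left key hA
  have e : heatKernel d 1 (x - y) =
      (4 * Real.pi) ^ (-(d : ℝ) / 2) * Real.exp (-‖x - y‖ ^ 2 / 4) := by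
    simp [heatKernel]
  calc ENNReal.ofReal (‖x‖ ^ s₂) * (ENNReal.ofReal (heatKernel d 1 (x - y)) * f y)
      = ENNReal.ofReal ((4 * Real.pi) ^ (-(d : ℝ) / 2) *
          (‖x‖ ^ s₂ * Real.exp (-‖x - y‖ ^ 2 / 4))) * f y := by
        rw [← mul_assoc, ← ENNReal.ofReal_mul (by positivity), e]
        ring_nf
    _ ≤ ENNReal.ofReal _ * f y := mul_le_mul_left (ENNReal.ofReal_le_ofReal key2) _
    _ = _ := by
        exact ofReal_mul_weights (by positivity) (by positivity) (by positivity) (by positivity)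
          (by positivity) _

/-- The weighted linear estimate at time `1`. -/
theorem exists_wNormE_heatE_one_le (hd : 1 ≤ d) {p r : ℝ≥0∞} (hp : 1 ≤ p) (hpr : p ≤ r)
    {s₁ s₂ : ℝ} (hs : s₂ ≤ s₁) (h2 : -(d : ℝ) * invExp r < s₂) (h1 : s₁ < d * (1 - invExp p)) :
    ∃ K : ℝ≥0, ∀ f : Sp d → ℝ≥0∞, Measurable f →
      wNormE r s₂ (heatE 1 f) ≤ K * wNormE p s₁ f := by
  obtain ⟨K1, hK1⟩ := exists_eLpNorm_gaussConv_le hd hp hpr (c := 1 / 8) (by norm_num)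
  obtain ⟨p', hp'0, hpp'⟩ := exists_conj hp
  have hr0 : r ≠ 0 := (lt_of_lt_of_le (by positivity) (hp.trans hpr)).ne'
  have hA := (eLpNorm_rpow_norm_mul_gaussian_lt_top hd hr0 (σ := s₂) (c := 1 / 8)
    (by norm_num) (.inl h2)).ne
  have hB := (eLpNorm_rpow_norm_mul_gaussian_lt_top hd hp'0 (σ := -s₁) (c := 1 / 8)
    (by norm_num) (.inl (by rw [invExp_conj hpp']; linarith))).ne
  set A := eLpNorm (fun x : Sp d => ENNReal.ofReal (‖x‖ ^ s₂ * Real.exp (-(1 / 8) * ‖x‖ ^ 2)))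
    r volume with hAdef
  set B := eLpNorm (fun x : Sp d => ENNReal.ofReal (‖x‖ ^ (-s₁) * Real.exp (-(1 / 8) * ‖x‖ ^ 2)))
    p' volume with hBdef
  set D := ENNReal.ofReal ((4 * Real.pi) ^ (-(d : ℝ) / 2) *
    (Real.exp 1 + Real.exp (2 * |s₂| ^ 2))) with hD
  have hKtop : D * (A * B + K1) + 1 ≠ ⊤ := by finiteness
  refine ⟨(D * (A * B + K1) + 1).toNNReal, fun f hf => ?_⟩
  rw [ENNReal.coe_toNNReal hKtop]
  set g : Sp d → ℝ≥0∞ := fun y => ENNReal.ofReal (‖y‖ ^ s₁) * f y with hg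
  have hgm : Measurable g := by fun_prop
  set J := ∫⁻ y, ENNReal.ofReal (‖y‖ ^ (-s₁) * Real.exp (-(1 / 8) * ‖y‖ ^ 2)) * g y with hJ
  have hJle : J ≤ B * eLpNorm g p volume :=
    lintegral_mul_le_eLpNorm_mul_eLpNorm hpp' (by fun_prop) hgm.aemeasurable
  have hgn : wNormE p s₁ f = eLpNorm g p volume := rfl
  rw [hgn]
  by_cases hgt : eLpNorm g p volume = ⊤
  · rw [hgt, ENNReal.mul_top (by positivity)]; exact le_top
  have hJt : J ≠ ⊤ := ne_top_of_le_ne_top (by finiteness) hJle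
  calc wNormE r s₂ (heatE 1 f)
      ≤ eLpNorm (fun x : Sp d => D * (ENNReal.ofReal (‖x‖ ^ s₂ * Real.exp (-(1 / 8) * ‖x‖ ^ 2)) * J
          + gaussConv (1 / 8) g x)) r volume := by
        refine eLpNorm_mono_enorm_ae ?_
        filter_upwards [ae_ne_zero hd] with x hx
        exact heatE_one_pointwise hs hd hf hx
    _ ≤ D * (A * J + K1 * eLpNorm g p volume) := by
        refine (eLpNorm_const_mul_le (by simp [hD])).trans (mul_le_mul_right ?_ _)
        refine (eLpNorm_add_le (Measurable.aestronglyMeasurable (by fun_prop))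
          (measurable_gaussConv hgm).aestronglyMeasurable (hp.trans hpr)).trans ?_
        refine add_le_add ?_ (hK1 g hgm)
        simp_rw [mul_comm _ J]
        exact eLpNorm_const_mul_le hJt
    _ ≤ D * (A * (B * eLpNorm g p volume) + K1 * eLpNorm g p volume) := by gcongr
    _ = D * (A * B + K1) * eLpNorm g p volume := by ring
    _ ≤ _ := by gcongr; exact le_self_add

/-- Scaling of the weighted norm. -/
theorem wNormE_comp_smul {q : ℝ≥0∞} {s l : ℝ} (hl : 0 < l) (f : Sp d → ℝ≥0∞) :
    wNormE q s (fun x => f (l • x)) = ENNReal.ofReal (l ^ (-s - d * invExp q)) * wNormE q s f := by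
  have h1 : wNormE q s (fun x => f (l • x)) = eLpNorm (fun x => ENNReal.ofReal (l ^ (-s)) *
      ((fun z => ENNReal.ofReal (‖z‖ ^ s) * f z) (l • x))) q volume := by
    unfold wNormE
    congr 1
    ext x
    rw [← mul_assoc, ← ENNReal.ofReal_mul (by positivity), norm_smul, Real.norm_of_nonneg hl.le,
      Real.mul_rpow hl.le (norm_nonneg x), ← mul_assoc, ← Real.rpow_add hl]
    simp
  have hc : ENNReal.ofReal (l ^ (-s)) ≠ ⊤ := by simp
  have hc0 : ENNReal.ofReal (l ^ (-s)) ≠ 0 := by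
    have : 0 < l ^ (-s) := by positivity
    simp [this]
  have hmul : ∀ (g : Sp d → ℝ≥0∞), eLpNorm (fun x => ENNReal.ofReal (l ^ (-s)) * g x) q volume
      = ENNReal.ofReal (l ^ (-s)) * eLpNorm g q volume := by
    intro g
    refine le_antisymm (eLpNorm_const_mul_le hc) ?_
    have := eLpNorm_const_mul_le (μ := (volume : Measure (Sp d))) (p := q)
      (f := fun x => ENNReal.ofReal (l ^ (-s)) * g x) (c := (ENNReal.ofReal (l ^ (-s)))⁻¹)
      (by simpa using hc0)
    simp_rw [← mul_assoc, ENNReal.inv_mul_cancel hc0 hc, one_mul] at this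
    calc _ ≤ ENNReal.ofReal (l ^ (-s)) * _ := mul_le_mul_right this _
      _ = _ := by rw [← mul_assoc, ENNReal.mul_inv_cancel hc0 hc, one_mul]
  rw [h1, hmul]
  have hemb : MeasurableEmbedding (fun x : Sp d => l • x) :=
    (Homeomorph.smulOfNeZero l hl.ne').measurableEmbedding
  have h2 := hemb.eLpNorm_map_measure (μ := (volume : Measure (Sp d)))
    (g := fun z => ENNReal.ofReal (‖z‖ ^ s) * f z) (p := q)
  have h3 : eLpNorm (fun x => (fun z => ENNReal.ofReal (‖z‖ ^ s) * f z) (l • x)) q volume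
      = ENNReal.ofReal (l ^ (-(d : ℝ) * invExp q)) * wNormE q s f := by
    change eLpNorm ((fun z => ENNReal.ofReal (‖z‖ ^ s) * f z) ∘ fun x => l • x) q volume = _
    rw [← h2, Measure.map_addHaar_smul _ hl.ne', eLpNorm_smul_measure_of_ne_zero, smul_eq_mul]
    · unfold wNormE
      congr 1
      rw [ENNReal.ofReal_rpow_of_pos (by positivity)]
      congr 1
      rw [abs_of_pos (by positivity), finrank_Sp, one_div, ← Real.rpow_natCast,
        ← Real.rpow_neg hl.le, ← Real.rpow_mul hl.le]
      rfl
    · have : 0 < |(l ^ Module.finrank ℝ (Sp d))⁻¹| := by positivity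
      simp only [ne_eq, ENNReal.ofReal_eq_zero, not_le]
      exact this
  rw [h3, ← mul_assoc, ← ENNReal.ofReal_mul (by positivity), ← Real.rpow_add hl]
  congr 3
  ring

theorem heatE_scaling {t : ℝ} (ht : 0 < t) (f : Sp d → ℝ≥0∞) (x : Sp d) :
    heatE t f x = heatE 1 (fun y => f (√t • y)) ((√t)⁻¹ • x) := by
  have hl : 0 < √t := Real.sqrt_pos.2 ht
  have hl2 : √t ^ 2 = t := Real.sq_sqrt ht.le
  have hemb : MeasurableEmbedding (fun x : Sp d => √t • x) :=
    (Homeomorph.smulOfNeZero (√t) hl.ne').measurableEmbedding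
  have key := hemb.lintegral_map (μ := (volume : Measure (Sp d)))
    (fun y => ENNReal.ofReal (heatKernel d t (x - y)) * f y)
  rw [Measure.map_addHaar_smul _ hl.ne', lintegral_smul_measure] at key
  have hcpos : 0 < (√t ^ d)⁻¹ := by positivity
  have hker : ∀ y : Sp d, heatKernel d 1 ((√t)⁻¹ • x - y) = √t ^ d * heatKernel d t (x - √t • y) := by
    intro y
    unfold heatKernel
    have e1 : (√t)⁻¹ • x - y = (√t)⁻¹ • (x - √t • y) := by
      rw [smul_sub, smul_smul, inv_mul_cancel₀ hl.ne', one_smul]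
    rw [e1, norm_smul, Real.norm_of_nonneg (by positivity), mul_pow, inv_pow, hl2, ← mul_assoc,
      Real.mul_rpow (by positivity) ht.le]
    have e2 : √t ^ d * t ^ (-(d : ℝ) / 2) = 1 := by
      nth_rewrite 2 [← hl2]
      rw [← Real.rpow_natCast, ← Real.rpow_natCast, ← Real.rpow_mul hl.le, ← Real.rpow_add hl]
      have : (d : ℝ) + ((2 : ℕ) : ℝ) * (-(d : ℝ) / 2) = 0 := by push_cast; ring
      rw [this, Real.rpow_zero]
    have e3 : -(t⁻¹ * ‖x - √t • y‖ ^ 2) / (4 * 1) = -‖x - √t • y‖ ^ 2 / (4 * t) := by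
      field_simp
    rw [e3, mul_one]
    linear_combination -((4 * Real.pi) ^ (-(d : ℝ) / 2) *
      Real.exp (-‖x - √t • y‖ ^ 2 / (4 * t))) * e2
  unfold heatE
  simp_rw [hker]
  have hpow : (0 : ℝ) ≤ √t ^ d := by positivity
  simp_rw [ENNReal.ofReal_mul hpow, mul_assoc]
  rw [lintegral_const_mul' _ _ (by simp), ← key, smul_eq_mul, ← mul_assoc, finrank_Sp,
    abs_of_pos hcpos, ← ENNReal.ofReal_mul hpow, mul_inv_cancel₀ (by positivity)]
  simp

/-- **The weighted linear estimate.** For `1 ≤ p ≤ r ≤ ∞` and `-d/r < s₂ ≤ s₁ < d(1 - 1/p)` the heat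
semigroup maps `L^p_{s₁}` to `L^r_{s₂}`. -/
theorem exists_wNormE_heatE_le (hd : 1 ≤ d) {p r : ℝ≥0∞} (hp : 1 ≤ p) (hpr : p ≤ r)
    {s₁ s₂ : ℝ} (hs : s₂ ≤ s₁) (h2 : -(d : ℝ) * invExp r < s₂) (h1 : s₁ < d * (1 - invExp p)) :
    ∃ K : ℝ≥0, ∀ t : ℝ, 0 < t → ∀ f : Sp d → ℝ≥0∞, AEMeasurable f →
      wNormE r s₂ (heatE t f) ≤
        K * ENNReal.ofReal (t ^ (-((d * (invExp p - invExp r) + (s₁ - s₂)) / 2))) *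
          wNormE p s₁ f := by
  obtain ⟨K, hK⟩ := exists_wNormE_heatE_one_le hd hp hpr hs h2 h1
  refine ⟨K, fun t ht f hf => ?_⟩
  have hl : 0 < √t := Real.sqrt_pos.2 ht
  have hfe : wNormE p s₁ f = wNormE p s₁ (hf.mk f) := by
    refine eLpNorm_congr_ae ?_
    filter_upwards [hf.ae_eq_mk] with x hx
    rw [hx]
  rw [heatE_congr hf.ae_eq_mk, hfe]
  have e1 : heatE t (hf.mk f) =
      fun x => (heatE 1 (fun y => hf.mk f (√t • y))) ((√t)⁻¹ • x) := by
    ext x; exact heatE_scaling ht _ x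
  rw [e1, wNormE_comp_smul (inv_pos.2 hl)]
  refine (mul_le_mul_right (hK _ (hf.measurable_mk.comp (measurable_const_smul _))) _).trans
    (le_of_eq ?_)
  have e2 := wNormE_comp_smul (q := p) (s := s₁) hl (hf.mk f)
  change _ * (_ * wNormE p s₁ (fun x => hf.mk f (√t • x))) = _
  rw [e2, mul_left_comm, ← mul_assoc (ENNReal.ofReal _) (ENNReal.ofReal _),
    ← ENNReal.ofReal_mul (by positivity), mul_assoc]
  congr 4
  rw [Real.inv_rpow hl.le, ← Real.rpow_neg hl.le, ← Real.rpow_add hl, Real.sqrt_eq_rpow,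
    ← Real.rpow_mul ht.le]
  congr 1
  ring

/-! ### The semigroup property -/

theorem gaussian_completion {r t : ℝ} (hr : 0 < r) (ht : 0 < t) (v w : Sp d) :
    -‖v - w‖ ^ 2 / (4 * r) + -‖w‖ ^ 2 / (4 * t) =
      -‖v‖ ^ 2 / (4 * (r + t)) + -((r + t) / (4 * r * t)) * ‖w - (t / (r + t)) • v‖ ^ 2 := by
  rw [norm_sub_sq_real v w, norm_sub_sq_real w, norm_smul, inner_smul_right, real_inner_comm,
    Real.norm_of_nonneg (by positivity)]
  field_simp
  ring

theorem lintegral_heatKernel_mul {r t : ℝ} (hr : 0 < r) (ht : 0 < t) (x z : Sp d) :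
    ∫⁻ y, ENNReal.ofReal (heatKernel d r (x - y)) * ENNReal.ofReal (heatKernel d t (y - z)) =
      ENNReal.ofReal (heatKernel d (r + t) (x - z)) := by
  rw [← lintegral_add_right_eq_self _ z]
  have hb : 0 < (r + t) / (4 * r * t) := by positivity
  set b := (r + t) / (4 * r * t) with hbdef
  have e : ∀ y : Sp d, ENNReal.ofReal (heatKernel d r (x - (y + z))) *
      ENNReal.ofReal (heatKernel d t (y + z - z)) =
      ENNReal.ofReal ((4 * Real.pi * r) ^ (-(d : ℝ) / 2) * (4 * Real.pi * t) ^ (-(d : ℝ) / 2) *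
        Real.exp (-‖x - z‖ ^ 2 / (4 * (r + t)))) *
      ENNReal.ofReal (Real.exp (-b * ‖y - (t / (r + t)) • (x - z)‖ ^ 2)) := by
    intro y
    rw [← ENNReal.ofReal_mul (heatKernel_nonneg hr.le _), ← ENNReal.ofReal_mul (by positivity)]
    congr 1
    unfold heatKernel
    have h1 : x - (y + z) = (x - z) - y := by abel
    rw [add_sub_cancel_right, h1, mul_assoc _ (Real.exp _) (Real.exp _), ← Real.exp_add,
      ← gaussian_completion hr ht, Real.exp_add]
    ring
  simp_rw [e]
  rw [lintegral_const_mul' _ _ (by simp),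
    lintegral_sub_right_eq_self (fun y : Sp d => ENNReal.ofReal (Real.exp (-b * ‖y‖ ^ 2)))]
  have hI := GaussianFourier.integral_rexp_neg_mul_sq_norm (V := Sp d) hb
  have hint : Integrable (fun v : Sp d => Real.exp (-b * ‖v‖ ^ 2)) := by
    by_contra h
    rw [integral_undef h] at hI
    have : 0 < (Real.pi / b) ^ ((Module.finrank ℝ (Sp d) : ℝ) / 2) := by positivity
    exact this.ne hI
  rw [← ofReal_integral_eq_lintegral_ofReal hint (.of_forall fun _ => (Real.exp_pos _).le), hI,
    ← ENNReal.ofReal_mul (by positivity), finrank_Sp]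
  congr 1
  unfold heatKernel
  have h2 : (4 * Real.pi * r) ^ (-(d : ℝ) / 2) * (4 * Real.pi * t) ^ (-(d : ℝ) / 2) *
      (Real.pi / b) ^ ((d : ℝ) / 2) = (4 * Real.pi * (r + t)) ^ (-(d : ℝ) / 2) := by
    have h3 : (Real.pi / b) ^ ((d : ℝ) / 2) = (b / Real.pi) ^ (-(d : ℝ) / 2) := by
      rw [← inv_div, Real.inv_rpow (by positivity), ← Real.rpow_neg (by positivity)]
      congr 1; ring
    rw [h3, ← Real.mul_rpow (by positivity) (by positivity),
      ← Real.mul_rpow (by positivity) (by positivity)]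
    congr 1
    rw [hbdef]
    field_simp
    try ring
  linear_combination Real.exp (-‖x - z‖ ^ 2 / (4 * (r + t))) * h2

theorem measurable_heatKernel_sub (t : ℝ) :
    Measurable (fun p : Sp d × Sp d => heatKernel d t (p.1 - p.2)) := by
  unfold heatKernel; fun_prop

theorem measurable_heatKernel_const_sub (t : ℝ) (x : Sp d) :
    Measurable (fun y => heatKernel d t (x - y)) := by
  unfold heatKernel; fun_prop

theorem measurable_heatKernel_sub_const (t : ℝ) (z : Sp d) :
    Measurable (fun y => heatKernel d t (y - z)) := by
  unfold heatKernel; fun_prop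

theorem integral_heatKernel_mul {r t : ℝ} (hr : 0 < r) (ht : 0 < t) (x z : Sp d) :
    ∫ y, heatKernel d r (x - y) * heatKernel d t (y - z) = heatKernel d (r + t) (x - z) := by
  rw [integral_eq_lintegral_of_nonneg_ae
    (.of_forall fun y => mul_nonneg (heatKernel_nonneg hr.le _) (heatKernel_nonneg ht.le _))
    ((measurable_heatKernel_const_sub r x).mul
      (measurable_heatKernel_sub_const t z)).aestronglyMeasurable]
  have e : ∀ y, ENNReal.ofReal (heatKernel d r (x - y) * heatKernel d t (y - z)) =
      ENNReal.ofReal (heatKernel d r (x - y)) * ENNReal.ofReal (heatKernel d t (y - z)) :=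
    fun y => ENNReal.ofReal_mul (heatKernel_nonneg hr.le _)
  simp_rw [e]
  rw [lintegral_heatKernel_mul hr ht, ENNReal.toReal_ofReal (heatKernel_nonneg (by positivity) _)]

theorem heatE_heatE {r t : ℝ} (hr : 0 < r) (ht : 0 < t) {f : Sp d → ℝ≥0∞} (hf : AEMeasurable f)
    (x : Sp d) : heatE r (heatE t f) x = heatE (r + t) f x := by
  rw [heatE_congr (t := t) hf.ae_eq_mk, heatE_congr (t := r + t) hf.ae_eq_mk]
  set g := hf.mk f
  have hg : Measurable g := hf.measurable_mk
  unfold heatE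
  have m1 : ∀ y : Sp d, Measurable (fun z => ENNReal.ofReal (heatKernel d t (y - z)) * g z) :=
    fun y => (measurable_heatKernel_const_sub t y).ennreal_ofReal.mul hg
  have e1 : ∀ y, ENNReal.ofReal (heatKernel d r (x - y)) *
      ∫⁻ z, ENNReal.ofReal (heatKernel d t (y - z)) * g z = ∫⁻ z,
      ENNReal.ofReal (heatKernel d r (x - y)) * (ENNReal.ofReal (heatKernel d t (y - z)) * g z) :=
    fun y => (lintegral_const_mul _ (m1 y)).symm
  simp_rw [e1]
  rw [lintegral_lintegral_swap]
  · refine lintegral_congr fun z => ?_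
    simp_rw [← mul_assoc]
    rw [lintegral_mul_const, lintegral_heatKernel_mul hr ht]
    exact (measurable_heatKernel_const_sub r x).ennreal_ofReal.mul
      (measurable_heatKernel_sub_const t z).ennreal_ofReal
  · refine Measurable.aemeasurable ?_
    unfold Function.uncurry
    exact ((measurable_heatKernel_const_sub r x).ennreal_ofReal.comp measurable_fst).mul
      ((measurable_heatKernel_sub t).ennreal_ofReal.mul (hg.comp measurable_snd))

theorem two_rpow_mul_heatKernel {t : ℝ} (ht : 0 < t) (y : Sp d) :
    (4 * Real.pi * t) ^ (-(d : ℝ) / 2) * Real.exp (-‖y‖ ^ 2 / (8 * t)) =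
      2 ^ ((d : ℝ) / 2) * heatKernel d (2 * t) y := by
  unfold heatKernel
  have e : (4 * Real.pi * (2 * t)) = 2 * (4 * Real.pi * t) := by ring
  rw [e, Real.mul_rpow (x := 2) (by positivity) (by positivity), ← mul_assoc, ← mul_assoc,
    ← Real.rpow_add (by norm_num)]
  have e2 : (d : ℝ) / 2 + -(d : ℝ) / 2 = 0 := by ring
  rw [e2, Real.rpow_zero, one_mul]
  ring_nf

/-- Moving the centre of the kernel by at most `R` costs a factor and a doubling of the time. -/
theorem heatKernel_le_of_norm_sub_le {t R : ℝ} (ht : 0 < t) {x x₀ : Sp d} (h : ‖x - x₀‖ ≤ R)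
    (y : Sp d) : heatKernel d t (x - y) ≤
      Real.exp (R ^ 2 / (4 * t)) * 2 ^ ((d : ℝ) / 2) * heatKernel d (2 * t) (x₀ - y) := by
  rw [mul_assoc, ← two_rpow_mul_heatKernel ht]
  unfold heatKernel
  have h1 : ‖x₀ - y‖ ^ 2 ≤ 2 * ‖x - y‖ ^ 2 + 2 * R ^ 2 := by
    have : ‖x₀ - y‖ ≤ ‖x - y‖ + R := by
      have h2 := norm_sub_le (x - y) (x - x₀)
      rw [show x - y - (x - x₀) = x₀ - y by abel] at h2
      linarith
    have h0 := norm_nonneg (x₀ - y)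
    nlinarith [sq_nonneg (‖x - y‖ - R)]
  have h2 : Real.exp (-‖x - y‖ ^ 2 / (4 * t)) ≤
      Real.exp (R ^ 2 / (4 * t)) * Real.exp (-‖x₀ - y‖ ^ 2 / (8 * t)) := by
    rw [← Real.exp_add]
    refine Real.exp_le_exp.2 ?_
    have : R ^ 2 / (4 * t) + -‖x₀ - y‖ ^ 2 / (8 * t) - -‖x - y‖ ^ 2 / (4 * t) =
      (2 * ‖x - y‖ ^ 2 + 2 * R ^ 2 - ‖x₀ - y‖ ^ 2) / (8 * t) := by field_simp; ring
    have h3 : 0 ≤ (2 * ‖x - y‖ ^ 2 + 2 * R ^ 2 - ‖x₀ - y‖ ^ 2) / (8 * t) := by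
      apply div_nonneg <;> linarith
    linarith
  calc _ ≤ (4 * Real.pi * t) ^ (-(d : ℝ) / 2) *
        (Real.exp (R ^ 2 / (4 * t)) * Real.exp (-‖x₀ - y‖ ^ 2 / (8 * t))) := by gcongr
    _ = _ := by ring

theorem ae_lt_top_of_wNormE (hd : 1 ≤ d) {q : ℝ≥0∞} (hq : q ≠ 0) {s : ℝ} {f : Sp d → ℝ≥0∞}
    (hf : AEMeasurable f) (h : wNormE q s f < ⊤) : ∀ᵐ x ∂(volume : Measure (Sp d)), f x < ⊤ := by
  have key : ∀ᵐ x ∂(volume : Measure (Sp d)), ENNReal.ofReal (‖x‖ ^ s) * f x < ⊤ := by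
    rcases eq_or_ne q ⊤ with rfl | hqt
    · unfold wNormE at h
      rw [eLpNorm_exponent_top] at h
      filter_upwards [ae_le_eLpNormEssSup (f := fun x => ENNReal.ofReal (‖x‖ ^ s) * f x)
        (μ := (volume : Measure (Sp d)))] with x hx
      exact lt_of_le_of_lt hx h
    · have h2 := lintegral_rpow_enorm_lt_top_of_eLpNorm_lt_top hq hqt h
      have hr := ENNReal.toReal_pos hq hqt
      have m : AEMeasurable (fun x : Sp d => (‖ENNReal.ofReal (‖x‖ ^ s) * f x‖ₑ) ^ q.toReal) := by
        simp only [enorm_eq_self]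
        exact ((measurable_weight s).aemeasurable.mul hf).pow_const _
      filter_upwards [ae_lt_top' m h2.ne] with x hx
      simpa [ENNReal.rpow_lt_top_iff_of_pos hr] using hx
  filter_upwards [key, ae_ne_zero hd] with x hx hx0
  by_contra hcon
  rw [not_lt_top_iff] at hcon
  have : 0 < ‖x‖ ^ s := Real.rpow_pos_of_pos (norm_pos_iff.2 hx0) _
  rw [hcon, ENNReal.mul_top (by simpa using this)] at hx
  exact lt_irrefl _ hx

/-! ### The heat semigroup on scalar functions -/

theorem enorm_heat_le {t : ℝ} (ht : 0 < t) (f : Sp d → 𝕜) (x : Sp d) :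
    ‖heat t f x‖ₑ ≤ heatE t (fun y => ‖f y‖ₑ) x := by
  unfold heat heatE
  rw [if_neg ht.ne']
  refine (enorm_integral_le_lintegral_enorm _).trans (lintegral_mono fun y => ?_)
  rw [enorm_smul, Real.enorm_eq_ofReal (heatKernel_nonneg ht.le _)]

theorem integrable_heatKernel_smul {t : ℝ} (ht : 0 < t) {f : Sp d → 𝕜}
    (hf : AEStronglyMeasurable f volume) {x : Sp d} (h : heatE t (fun y => ‖f y‖ₑ) x < ⊤) :
    Integrable (fun y => heatKernel d t (x - y) • f y) := by
  refine ⟨?_, ?_⟩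
  · refine AEStronglyMeasurable.smul ?_ hf
    exact (measurable_heatKernel.comp
      (measurable_const.prodMk (measurable_const.sub measurable_id))).aestronglyMeasurable
  · refine lt_of_le_of_lt (lintegral_mono fun y => ?_) h
    rw [enorm_smul, Real.enorm_eq_ofReal (heatKernel_nonneg ht.le _)]

theorem heat_sub {t : ℝ} (ht : 0 < t) {f g : Sp d → 𝕜} (hf : AEStronglyMeasurable f volume)
    (hg : AEStronglyMeasurable g volume) {x : Sp d} (h : heatE t (fun y => ‖f y‖ₑ) x < ⊤)
    (h' : heatE t (fun y => ‖g y‖ₑ) x < ⊤) :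
    heat t (fun y => f y - g y) x = heat t f x - heat t g x := by
  unfold heat
  simp only [if_neg ht.ne']
  rw [← integral_sub (integrable_heatKernel_smul ht hf h) (integrable_heatKernel_smul ht hg h')]
  simp_rw [smul_sub]

theorem heat_congr {t : ℝ} (ht : t ≠ 0) {f g : Sp d → 𝕜} (h : f =ᵐ[volume] g) :
    heat t f = heat t g := by
  ext x
  unfold heat
  simp only [if_neg ht]
  refine integral_congr_ae ?_
  filter_upwards [h] with y hy
  rw [hy]

theorem heat_zero (f : Sp d → 𝕜) : heat 0 f = f := by
  ext x; simp [heat]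

theorem stronglyMeasurable_heat {β : Type*} [MeasurableSpace β] {θ : β → ℝ} (hθ : Measurable θ)
    {x : β → Sp d} (hx : Measurable x) {f : β → Sp d → 𝕜}
    (hf : StronglyMeasurable (Function.uncurry f)) :
    StronglyMeasurable (fun b => heat (θ b) (f b) (x b)) := by
  unfold heat
  refine StronglyMeasurable.ite (hθ (measurableSet_singleton 0)) ?_ ?_
  · exact hf.comp_measurable (measurable_id.prodMk hx)
  · have : StronglyMeasurable (fun p : β × Sp d =>
        heatKernel d (θ p.1) (x p.1 - p.2) • f p.1 p.2) := by
      refine StronglyMeasurable.smul ?_ hf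
      exact (measurable_heatKernel.comp
        ((hθ.comp measurable_fst).prodMk ((hx.comp measurable_fst).sub
          measurable_snd))).stronglyMeasurable
    exact this.integral_prod_right'

theorem aestronglyMeasurable_heat {t : ℝ} {f : Sp d → 𝕜} (hf : AEStronglyMeasurable f volume) :
    AEStronglyMeasurable (heat t f) volume := by
  by_cases ht : t = 0
  · rw [ht, heat_zero]; exact hf
  · rw [heat_congr ht hf.ae_eq_mk]
    exact (stronglyMeasurable_heat (θ := fun _ : Sp d => t) measurable_const measurable_id
      (f := fun _ => hf.mk f)
      (hf.stronglyMeasurable_mk.comp_measurable measurable_snd)).aestronglyMeasurable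

theorem heat_heat {r t : ℝ} (hr : 0 < r) (ht : 0 < t) {f : Sp d → 𝕜}
    (hf : AEStronglyMeasurable f volume) {x : Sp d}
    (h : heatE (r + t) (fun y => ‖f y‖ₑ) x < ⊤) : heat r (heat t f) x = heat (r + t) f x := by
  have h0 : heatE (r + t) (fun y => ‖hf.mk f y‖ₑ) x < ⊤ := by
    rwa [← heatE_congr (f := fun y => ‖f y‖ₑ)]
    filter_upwards [hf.ae_eq_mk] with y hy
    rw [← hy]
  rw [heat_congr ht.ne' hf.ae_eq_mk, heat_congr (by positivity : r + t ≠ 0) hf.ae_eq_mk]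
  have hg := hf.stronglyMeasurable_mk
  set g := hf.mk f
  have hgm : Measurable (fun y => ‖g y‖ₑ) := hg.enorm
  rw [← heatE_heatE hr ht hgm.aemeasurable] at h0
  have sm : StronglyMeasurable (Function.uncurry fun y z =>
      heatKernel d r (x - y) • heatKernel d t (y - z) • g z) := by
    unfold Function.uncurry
    refine StronglyMeasurable.smul ?_ (StronglyMeasurable.smul ?_ ?_)
    · exact ((measurable_heatKernel_const_sub r x).comp measurable_fst).stronglyMeasurable
    · exact (measurable_heatKernel_sub t).stronglyMeasurable
    · exact hg.comp_measurable measurable_snd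
  have hint : Integrable (Function.uncurry fun y z =>
      heatKernel d r (x - y) • heatKernel d t (y - z) • g z)
      ((volume : Measure (Sp d)).prod volume) := by
    refine ⟨sm.aestronglyMeasurable, ?_⟩
    unfold HasFiniteIntegral
    rw [lintegral_prod _ sm.enorm.aemeasurable]
    refine lt_of_le_of_lt (le_of_eq ?_) h0
    unfold heatE
    refine lintegral_congr fun y => ?_
    rw [← lintegral_const_mul' _ _ (by simp)]
    refine lintegral_congr fun z => ?_
    simp only [Function.uncurry_apply_pair]
    rw [enorm_smul, enorm_smul, Real.enorm_eq_ofReal (heatKernel_nonneg hr.le _),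
      Real.enorm_eq_ofReal (heatKernel_nonneg ht.le _)]
  unfold heat
  simp only [if_neg hr.ne', if_neg ht.ne', if_neg (by positivity : r + t ≠ 0)]
  simp_rw [← integral_smul]
  rw [integral_integral_swap hint]
  refine integral_congr_ae (.of_forall fun z => ?_)
  simp only [smul_smul]
  rw [integral_smul_const, integral_heatKernel_mul hr ht]

/-! ### The Duhamel integral -/

/-- Up to null sets in almost every slice, `F` is a jointly measurable function on `(0,T) × ℝ^d`. -/
def SliceMeas (T : ℝ) (F : ℝ → Sp d → 𝕜) : Prop :=
  ∃ G : ℝ → Sp d → 𝕜, StronglyMeasurable (Function.uncurry G) ∧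
    ∀ᵐ τ ∂(volume.restrict (Ioo 0 T)), F τ =ᵐ[volume] G τ

/-- The Duhamel integral `∫_0^t e^{(r-τ)Δ} F(τ) dτ`, with a separate time `r ≥ t` of evaluation. -/
def duh (t r : ℝ) (F : ℝ → Sp d → 𝕜) (x : Sp d) : 𝕜 := ∫ τ in (0 : ℝ)..t, heat (r - τ) (F τ) x

/-- The Duhamel integral of absolute values, with values in `[0,∞]`; it dominates `duh`. -/
def duhE (t r : ℝ) (F : ℝ → Sp d → 𝕜) (x : Sp d) : ℝ≥0∞ :=
  ∫⁻ τ in Ioo 0 t, heatE (r - τ) (fun y => ‖F τ y‖ₑ) x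

theorem SliceMeas.of_aestronglyMeasurable {T : ℝ} {F : ℝ → Sp d → 𝕜}
    (h : AEStronglyMeasurable (fun p : ℝ × Sp d => F p.1 p.2)
      ((volume.restrict (Ioo 0 T)).prod volume)) : SliceMeas T F :=
  ⟨fun τ x => h.mk _ (τ, x), h.stronglyMeasurable_mk, Measure.ae_ae_of_ae_prod h.ae_eq_mk⟩

theorem SliceMeas.of_stronglyMeasurable {T : ℝ} {F : ℝ → Sp d → 𝕜}
    (h : StronglyMeasurable (Function.uncurry F)) : SliceMeas T F :=
  ⟨F, h, .of_forall fun _ => .rfl⟩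

theorem SliceMeas.mono {T T' : ℝ} {F : ℝ → Sp d → 𝕜} (h : SliceMeas T F) (hT : T' ≤ T) :
    SliceMeas T' F := by
  obtain ⟨G, hG, hFG⟩ := h
  exact ⟨G, hG, ae_restrict_of_ae_restrict_of_subset (Ioo_subset_Ioo_right hT) hFG⟩

theorem SliceMeas.sub {T : ℝ} {F G : ℝ → Sp d → 𝕜} (hF : SliceMeas T F) (hG : SliceMeas T G) :
    SliceMeas T (fun τ x => F τ x - G τ x) := by
  obtain ⟨F', hF', hF⟩ := hF
  obtain ⟨G', hG', hG⟩ := hG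
  refine ⟨fun τ x => F' τ x - G' τ x, hF'.sub hG', ?_⟩
  filter_upwards [hF, hG] with τ h1 h2
  filter_upwards [h1, h2] with x h1 h2
  rw [h1, h2]

theorem SliceMeas.aestronglyMeasurable_slice {T : ℝ} {F : ℝ → Sp d → 𝕜} (h : SliceMeas T F) :
    ∀ᵐ τ ∂(volume.restrict (Ioo 0 T)), AEStronglyMeasurable (F τ) volume := by
  obtain ⟨G, hG, hFG⟩ := h
  filter_upwards [hFG] with τ h
  exact ⟨G τ, hG.of_uncurry_left, h⟩

theorem ae_restrict_Ioo_add {t a : ℝ} (ha : 0 ≤ a) {T : ℝ} (hT : a + t ≤ T) {p : ℝ → Prop}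
    (h : ∀ᵐ τ ∂(volume.restrict (Ioo 0 T)), p τ) :
    ∀ᵐ τ ∂(volume.restrict (Ioo 0 t)), p (a + τ) := by
  rw [ae_restrict_iff' measurableSet_Ioo] at h ⊢
  have := (measurePreserving_add_left (volume : Measure ℝ) a).quasiMeasurePreserving.ae h
  filter_upwards [this] with τ hτ h'
  exact hτ ⟨by linarith [h'.1], by linarith [h'.2]⟩

theorem SliceMeas.shift {T t a : ℝ} {F : ℝ → Sp d → 𝕜} (h : SliceMeas T F) (ha : 0 ≤ a)
    (hT : a + t ≤ T) : SliceMeas t (fun τ => F (a + τ)) := by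
  obtain ⟨G, hG, hFG⟩ := h
  refine ⟨fun τ => G (a + τ), ?_, ae_restrict_Ioo_add ha hT hFG⟩
  exact hG.comp_measurable ((measurable_const.add measurable_fst).prodMk measurable_snd)

theorem duh_eq {t : ℝ} (ht : 0 ≤ t) (r : ℝ) (F : ℝ → Sp d → 𝕜) (x : Sp d) :
    duh t r F x = ∫ τ in Ioo 0 t, heat (r - τ) (F τ) x := by
  rw [duh, intervalIntegral.integral_of_le ht, integral_Ioc_eq_integral_Ioo]

theorem ae_heat_congr {t r : ℝ} (hr : t ≤ r) {F G : ℝ → Sp d → 𝕜}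
    (h : ∀ᵐ τ ∂(volume.restrict (Ioo 0 t)), F τ =ᵐ[volume] G τ) :
    ∀ᵐ τ ∂(volume.restrict (Ioo 0 t)), heat (r - τ) (F τ) = heat (r - τ) (G τ) := by
  filter_upwards [h, ae_restrict_mem measurableSet_Ioo] with τ hτ hm
  exact heat_congr (by linarith [hm.2] : (0 : ℝ) < r - τ).ne' hτ

theorem duh_congr {t r : ℝ} (ht : 0 ≤ t) (hr : t ≤ r) {F G : ℝ → Sp d → 𝕜}
    (h : ∀ᵐ τ ∂(volume.restrict (Ioo 0 t)), F τ =ᵐ[volume] G τ) : duh t r F = duh t r G := by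
  ext x
  rw [duh_eq ht, duh_eq ht]
  refine integral_congr_ae ?_
  filter_upwards [ae_heat_congr hr h] with τ hτ
  rw [hτ]

theorem duhE_congr {t r : ℝ} {F G : ℝ → Sp d → 𝕜}
    (h : ∀ᵐ τ ∂(volume.restrict (Ioo 0 t)), F τ =ᵐ[volume] G τ) : duhE t r F = duhE t r G := by
  ext x
  refine lintegral_congr_ae ?_
  filter_upwards [h] with τ hτ
  rw [heatE_congr]
  filter_upwards [hτ] with y hy
  rw [hy]

theorem enorm_duh_le {t r : ℝ} (ht : 0 ≤ t) (hr : t ≤ r) (F : ℝ → Sp d → 𝕜) (x : Sp d) :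
    ‖duh t r F x‖ₑ ≤ duhE t r F x := by
  rw [duh_eq ht]
  refine (enorm_integral_le_lintegral_enorm _).trans (lintegral_mono_ae ?_)
  filter_upwards [ae_restrict_mem measurableSet_Ioo] with τ hm
  exact enorm_heat_le (by linarith [hm.2]) _ _

theorem measurable_heatE_duh {r : ℝ} {F : ℝ → Sp d → 𝕜}
    (hF : StronglyMeasurable (Function.uncurry F)) :
    Measurable (fun p : ℝ × Sp d => heatE (r - p.1) (fun y => ‖F p.1 y‖ₑ) p.2) := by
  refine measurable_heatE (measurable_const.sub measurable_fst) measurable_snd ?_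
  exact hF.enorm.comp ((measurable_fst.comp measurable_fst).prodMk measurable_snd)

theorem measurable_heatE_duh_slice {r : ℝ} {F : ℝ → Sp d → 𝕜}
    (hF : StronglyMeasurable (Function.uncurry F)) (x : Sp d) :
    Measurable (fun τ : ℝ => heatE (r - τ) (fun y => ‖F τ y‖ₑ) x) :=
  measurable_heatE (measurable_const.sub measurable_id) measurable_const hF.enorm

theorem stronglyMeasurable_heat_duh {r : ℝ} {F : ℝ → Sp d → 𝕜}
    (hF : StronglyMeasurable (Function.uncurry F)) :
    StronglyMeasurable (fun p : ℝ × Sp d => heat (r - p.1) (F p.1) p.2) := by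
  refine stronglyMeasurable_heat (f := fun p : ℝ × Sp d => F p.1)
    (measurable_const.sub measurable_fst) measurable_snd ?_
  exact hF.comp_measurable ((measurable_fst.comp measurable_fst).prodMk measurable_snd)

theorem measurable_duhE {t r : ℝ} {F : ℝ → Sp d → 𝕜} (hF : SliceMeas t F) :
    Measurable (duhE t r F) := by
  obtain ⟨G, hG, hFG⟩ := hF
  rw [duhE_congr hFG]
  unfold duhE
  have m := (measurable_heatE_duh (r := r) hG).comp (measurable_swap (α := Sp d) (β := ℝ))
  exact m.lintegral_prod_right'

theorem stronglyMeasurable_duh_joint {F : ℝ → Sp d → 𝕜}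
    (hF : StronglyMeasurable (Function.uncurry F)) :
    StronglyMeasurable (fun p : ℝ × Sp d => duh p.1 p.1 F p.2) := by
  have m : StronglyMeasurable (fun z : (ℝ × Sp d) × ℝ => heat (z.1.1 - z.2) (F z.2) z.1.2) := by
    refine stronglyMeasurable_heat (f := fun z : (ℝ × Sp d) × ℝ => F z.2)
      ((measurable_fst.comp measurable_fst).sub measurable_snd)
      (measurable_snd.comp measurable_fst) ?_
    exact hF.comp_measurable ((measurable_snd.comp measurable_fst).prodMk measurable_snd)
  unfold duh intervalIntegral
  have key : ∀ a b : (ℝ × Sp d) → ℝ, Measurable a → Measurable b → StronglyMeasurable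
      (fun p : ℝ × Sp d => ∫ τ in Ioc (a p) (b p), heat (p.1 - τ) (F τ) p.2) := by
    intro a b ha hb
    simp_rw [← integral_indicator measurableSet_Ioc]
    have : StronglyMeasurable (fun z : (ℝ × Sp d) × ℝ =>
        {z : (ℝ × Sp d) × ℝ | a z.1 < z.2 ∧ z.2 ≤ b z.1}.indicator
          (fun z => heat (z.1.1 - z.2) (F z.2) z.1.2) z) := by
      refine m.indicator ?_
      exact (measurableSet_lt (ha.comp measurable_fst) measurable_snd).inter
        (measurableSet_le measurable_snd (hb.comp measurable_fst))
    exact this.integral_prod_right'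
  exact (key _ _ measurable_const measurable_fst).sub (key _ _ measurable_fst measurable_const)

theorem aestronglyMeasurable_heat_duh {t r : ℝ} (hr : t ≤ r) {F : ℝ → Sp d → 𝕜}
    (hF : SliceMeas t F) (x : Sp d) :
    AEStronglyMeasurable (fun τ => heat (r - τ) (F τ) x) (volume.restrict (Ioo 0 t)) := by
  obtain ⟨G, hG, hFG⟩ := hF
  refine ⟨fun τ => heat (r - τ) (G τ) x, ?_, ?_⟩
  · exact (stronglyMeasurable_heat_duh hG).comp_measurable (measurable_id.prodMk measurable_const)
  · filter_upwards [ae_heat_congr hr hFG] with τ hτ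
    rw [hτ]

theorem intervalIntegrable_of_duhE {t r : ℝ} (ht : 0 ≤ t) (hr : t ≤ r) {F : ℝ → Sp d → 𝕜}
    (hF : SliceMeas t F) {x : Sp d} (h : duhE t r F x < ⊤) :
    IntervalIntegrable (fun τ => heat (r - τ) (F τ) x) volume 0 t := by
  rw [intervalIntegrable_iff_integrableOn_Ioo_of_le ht]
  refine ⟨aestronglyMeasurable_heat_duh hr hF x, ?_⟩
  refine lt_of_le_of_lt (lintegral_mono_ae ?_) h
  filter_upwards [ae_restrict_mem measurableSet_Ioo] with τ hm
  exact enorm_heat_le (by linarith [hm.2]) _ _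

theorem ae_heatE_lt_top_of_duhE {t r : ℝ} {F : ℝ → Sp d → 𝕜}
    (hF : SliceMeas t F) {x : Sp d} (h : duhE t r F x < ⊤) :
    ∀ᵐ τ ∂(volume.restrict (Ioo 0 t)), heatE (r - τ) (fun y => ‖F τ y‖ₑ) x < ⊤ := by
  refine ae_lt_top' ?_ h.ne
  obtain ⟨G, hG, hFG⟩ := hF
  refine ⟨fun τ => heatE (r - τ) (fun y => ‖G τ y‖ₑ) x, ?_, ?_⟩
  · exact measurable_heatE_duh_slice hG x
  · filter_upwards [hFG] with τ hτ
    rw [heatE_congr]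
    filter_upwards [hτ] with y hy
    rw [hy]

theorem duh_sub {t r : ℝ} (ht : 0 ≤ t) (hr : t ≤ r) {F G : ℝ → Sp d → 𝕜} (hF : SliceMeas t F)
    (hG : SliceMeas t G) {x : Sp d} (h : duhE t r F x < ⊤) (h' : duhE t r G x < ⊤) :
    duh t r (fun τ y => F τ y - G τ y) x = duh t r F x - duh t r G x := by
  have i1 := intervalIntegrable_of_duhE ht hr hF h
  have i2 := intervalIntegrable_of_duhE ht hr hG h'
  rw [intervalIntegrable_iff_integrableOn_Ioo_of_le ht] at i1 i2
  rw [duh_eq ht, duh_eq ht, duh_eq ht, ← integral_sub i1 i2]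
  refine integral_congr_ae ?_
  filter_upwards [ae_heatE_lt_top_of_duhE hF h, ae_heatE_lt_top_of_duhE hG h',
    hF.aestronglyMeasurable_slice, hG.aestronglyMeasurable_slice,
    ae_restrict_mem measurableSet_Ioo] with τ h1 h2 m1 m2 hm
  exact heat_sub (by linarith [hm.2]) m1 m2 h1 h2

theorem heatE_duhE {t r h : ℝ} (hh : 0 < h) (hr : t ≤ r) {F : ℝ → Sp d → 𝕜} (hF : SliceMeas t F)
    (x : Sp d) : heatE h (duhE t r F) x = duhE t (h + r) F x := by
  obtain ⟨G, hG, hFG⟩ := hF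
  rw [duhE_congr hFG, duhE_congr hFG]
  unfold duhE
  have ms : ∀ y, Measurable (fun τ => heatE (r - τ) (fun z => ‖G τ z‖ₑ) y) := fun y =>
    measurable_heatE_duh_slice hG y
  have e1 : heatE h (fun x => ∫⁻ τ in Ioo 0 t, heatE (r - τ) (fun y => ‖G τ y‖ₑ) x) x =
      ∫⁻ y, ∫⁻ τ in Ioo 0 t, ENNReal.ofReal (heatKernel d h (x - y)) *
        heatE (r - τ) (fun z => ‖G τ z‖ₑ) y := by
    unfold heatE
    refine lintegral_congr fun y => ?_
    exact (lintegral_const_mul _ (ms y)).symm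
  rw [e1, lintegral_lintegral_swap]
  · refine lintegral_congr_ae ?_
    filter_upwards [ae_restrict_mem measurableSet_Ioo] with τ hm
    have := heatE_heatE hh (by linarith [hm.2] : 0 < r - τ) (f := fun z => ‖G τ z‖ₑ)
      (hG.of_uncurry_left (x := τ)).enorm.aemeasurable x
    rw [show h + r - τ = h + (r - τ) by ring, ← this]
    rfl
  · have m2 : Measurable (fun p : Sp d × ℝ => heatE (r - p.2) (fun y => ‖G p.2 y‖ₑ) p.1) := by
      refine measurable_heatE (measurable_const.sub measurable_snd) measurable_fst ?_
      exact hG.enorm.comp ((measurable_snd.comp measurable_fst).prodMk measurable_snd)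
    have m1 : Measurable (fun p : Sp d × ℝ => ENNReal.ofReal (heatKernel d h (x - p.1))) :=
      (measurable_heatKernel_const_sub h x).ennreal_ofReal.comp measurable_fst
    exact (m1.mul m2).aemeasurable

/-- The heat semigroup acts on a Duhamel integral by advancing the time of evaluation. -/
theorem heat_duh {t r h : ℝ} (ht : 0 ≤ t) (hh : 0 < h) (hr : t ≤ r) {F : ℝ → Sp d → 𝕜}
    (hF : SliceMeas t F) {x : Sp d} (hx : duhE t (h + r) F x < ⊤) :
    heat h (duh t r F) x = duh t (h + r) F x := by
  have hx' := hx
  have hF' := hF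
  obtain ⟨G, hG, hFG⟩ := hF
  rw [duhE_congr hFG] at hx
  rw [duh_congr ht hr hFG, duh_congr ht (by linarith) hFG]
  have hGS : SliceMeas t G := .of_stronglyMeasurable hG
  have hfin := ae_heatE_lt_top_of_duhE hGS hx
  have m := stronglyMeasurable_heat_duh (r := r) hG
  have sm : StronglyMeasurable (Function.uncurry fun y τ =>
      heatKernel d h (x - y) • heat (r - τ) (G τ) y) := by
    refine StronglyMeasurable.smul ?_ (m.comp_measurable measurable_swap)
    exact ((measurable_heatKernel_const_sub h x).comp measurable_fst).stronglyMeasurable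
  have hint : Integrable (Function.uncurry fun y τ =>
      heatKernel d h (x - y) • heat (r - τ) (G τ) y)
      ((volume : Measure (Sp d)).prod (volume.restrict (Ioo 0 t))) := by
    refine ⟨sm.aestronglyMeasurable, ?_⟩
    unfold HasFiniteIntegral
    rw [lintegral_prod _ sm.enorm.aemeasurable]
    rw [← heatE_duhE hh hr hGS] at hx
    refine lt_of_le_of_lt ?_ hx
    unfold heatE
    refine lintegral_mono fun y => ?_
    unfold duhE
    simp only []
    rw [← lintegral_const_mul' _ _ (by simp)]
    refine lintegral_mono_ae ?_
    filter_upwards [ae_restrict_mem measurableSet_Ioo] with τ hm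
    simp only [Function.uncurry_apply_pair]
    rw [enorm_smul, Real.enorm_eq_ofReal (heatKernel_nonneg hh.le _)]
    exact mul_le_mul_right (enorm_heat_le (by linarith [hm.2]) _ _) _
  have e1 : heat h (duh t r G) x =
      ∫ y, ∫ τ in Ioo 0 t, heatKernel d h (x - y) • heat (r - τ) (G τ) y := by
    unfold heat
    rw [if_neg hh.ne']
    refine integral_congr_ae (.of_forall fun y => ?_)
    simp only []
    rw [duh_eq ht, ← integral_smul]
    rfl
  rw [e1, integral_integral_swap hint, duh_eq ht]
  refine integral_congr_ae ?_
  filter_upwards [ae_restrict_mem measurableSet_Ioo, hfin] with τ hm hf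
  have e2 : h + r - τ = h + (r - τ) := by ring
  rw [e2] at hf ⊢
  rw [← heat_heat hh (by linarith [hm.2]) (hG.of_uncurry_left (x := τ)).aestronglyMeasurable hf]
  exact (if_neg hh.ne').symm

/-- The weighted norm of a Duhamel integral, from a bound of the semigroup and Minkowski's
inequality; `A` is a majorant of the norms of the slices. -/
theorem wNormE_duhE_le {p q : ℝ≥0∞} {s₁ s₂ κ : ℝ} {K : ℝ≥0} (hq : 1 ≤ q)
    (hK : ∀ t : ℝ, 0 < t → ∀ f : Sp d → ℝ≥0∞, AEMeasurable f →
      wNormE q s₂ (heatE t f) ≤ K * ENNReal.ofReal (t ^ (-κ)) * wNormE p s₁ f)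
    {t r : ℝ} (hr : t ≤ r) {F : ℝ → Sp d → 𝕜} (hF : SliceMeas t F) {A : ℝ → ℝ≥0∞}
    (hA : Measurable A) (hFA : ∀ᵐ τ ∂(volume.restrict (Ioo 0 t)), wNorm p s₁ (F τ) ≤ A τ) :
    wNormE q s₂ (duhE t r F) ≤
      ∫⁻ τ in Ioo 0 t, K * ENNReal.ofReal ((r - τ) ^ (-κ)) * A τ := by
  obtain ⟨G, hG, hFG⟩ := hF
  rw [duhE_congr hFG]
  have e : (fun x => ENNReal.ofReal (‖x‖ ^ s₂) * duhE t r G x) = fun x =>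
      ∫⁻ τ in Ioo 0 t, ENNReal.ofReal (‖x‖ ^ s₂) * heatE (r - τ) (fun y => ‖G τ y‖ₑ) x := by
    ext x
    unfold duhE
    rw [lintegral_const_mul' _ _ (by simp)]
  unfold wNormE
  rw [e]
  refine eLpNorm_lintegral_le hq ?_ (by fun_prop) ?_
  · exact (((measurable_weight s₂).comp measurable_snd).mul (measurable_heatE_duh hG)).aemeasurable
  · filter_upwards [hFA, hFG, ae_restrict_mem measurableSet_Ioo] with τ h1 h2 hm
    refine (hK (r - τ) (by linarith [hm.2]) _
      (hG.of_uncurry_left (x := τ)).enorm.aemeasurable).trans ?_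
    refine mul_le_mul_right (le_trans (le_of_eq ?_) h1) _
    rw [← wNorm_eq_wNormE]
    refine eLpNorm_congr_ae ?_
    filter_upwards [h2] with x hx
    rw [hx]

/-! ### Time integrals with two endpoint singularities -/

theorem lintegral_rpow_neg {b : ℝ} (hb : b < 1) {t : ℝ} (ht : 0 < t) :
    ∫⁻ τ in Ioo 0 t, ENNReal.ofReal (τ ^ (-b)) = ENNReal.ofReal (t ^ (1 - b) / (1 - b)) := by
  have hint : IntegrableOn (fun τ : ℝ => τ ^ (-b)) (Ioo 0 t) := by
    rw [← intervalIntegrable_iff_integrableOn_Ioo_of_le ht.le]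
    exact intervalIntegral.intervalIntegrable_rpow' (by linarith)
  rw [← ofReal_integral_eq_lintegral_ofReal hint]
  · rw [← integral_Ioc_eq_integral_Ioo, ← intervalIntegral.integral_of_le ht.le,
      integral_rpow (.inl (by linarith))]
    rw [Real.zero_rpow (by linarith), sub_zero]
    ring_nf
  · filter_upwards [ae_restrict_mem measurableSet_Ioo] with τ hτ
    exact Real.rpow_nonneg hτ.1.le _

theorem lintegral_sub_rpow_neg {a : ℝ} (ha : a < 1) {t : ℝ} (ht : 0 < t) :
    ∫⁻ τ in Ioo 0 t, ENNReal.ofReal ((t - τ) ^ (-a)) = ENNReal.ofReal (t ^ (1 - a) / (1 - a)) := by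
  rw [← lintegral_rpow_neg ha ht, ← lintegral_indicator measurableSet_Ioo,
    ← lintegral_indicator measurableSet_Ioo, ← lintegral_sub_left_eq_self _ t]
  refine lintegral_congr fun τ => ?_
  by_cases h : τ ∈ Ioo 0 t
  · rw [indicator_of_mem (show t - τ ∈ Ioo 0 t from ⟨by linarith [h.2], by linarith [h.1]⟩),
      indicator_of_mem h]
    simp
  · rw [indicator_of_notMem (fun h' : t - τ ∈ Ioo 0 t => h ⟨by linarith [h'.2], by linarith [h'.1]⟩),
      indicator_of_notMem h]

/-- The bound of the beta integral `∫_0^t (t-τ)^{-a} τ^{-b} dτ`; one of the two factors is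
nonsingular on each half of the interval. -/
theorem exists_lintegral_beta_le {a b : ℝ} (ha0 : 0 ≤ a) (ha : a < 1) (hb0 : 0 ≤ b) (hb : b < 1) :
    ∃ B : ℝ≥0, ∀ t : ℝ, 0 < t →
      ∫⁻ τ in Ioo 0 t, ENNReal.ofReal ((t - τ) ^ (-a)) * ENNReal.ofReal (τ ^ (-b)) ≤
        B * ENNReal.ofReal (t ^ (1 - a - b)) := by
  have h1a : 0 < 1 - a := by linarith
  have h1b : 0 < 1 - b := by linarith
  refine ⟨(2 ^ a / (1 - b) + 2 ^ b / (1 - a)).toNNReal, fun t ht => ?_⟩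
  have pt : ∀ τ ∈ Ioo 0 t, ENNReal.ofReal ((t - τ) ^ (-a)) * ENNReal.ofReal (τ ^ (-b)) ≤
      ENNReal.ofReal ((t / 2) ^ (-a)) * ENNReal.ofReal (τ ^ (-b)) +
        ENNReal.ofReal ((t / 2) ^ (-b)) * ENNReal.ofReal ((t - τ) ^ (-a)) := by
    intro τ hτ
    rcases le_total τ (t / 2) with h | h
    · refine le_trans ?_ le_self_add
      exact mul_le_mul_left (ENNReal.ofReal_le_ofReal
        (Real.rpow_le_rpow_of_nonpos (by linarith) (by linarith) (by linarith))) _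
    · refine le_trans ?_ le_add_self
      rw [mul_comm]
      exact mul_le_mul_left (ENNReal.ofReal_le_ofReal
        (Real.rpow_le_rpow_of_nonpos (by linarith) (by linarith) (by linarith))) _
  refine (setLIntegral_mono' measurableSet_Ioo pt).trans ?_
  rw [lintegral_add_left (by fun_prop), lintegral_const_mul _ (by fun_prop),
    lintegral_const_mul _ (by fun_prop), lintegral_rpow_neg hb ht, lintegral_sub_rpow_neg ha ht,
    ← ENNReal.ofReal_mul (by positivity), ← ENNReal.ofReal_mul (by positivity),
    ← ENNReal.ofReal_add (by positivity) (by positivity)]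
  change _ ≤ ENNReal.ofReal _ * _
  rw [← ENNReal.ofReal_mul (by positivity)]
  refine ENNReal.ofReal_le_ofReal (le_of_eq ?_)
  have h2 : ∀ x y : ℝ, (t / 2) ^ (-x) * (t ^ (1 - y) / (1 - y)) =
      2 ^ x / (1 - y) * t ^ (1 - x - y) := by
    intro x y
    have e : (1 - x - y) = -x + (1 - y) := by ring
    rw [Real.div_rpow ht.le (by norm_num), e, Real.rpow_add ht, Real.rpow_neg (by norm_num : (0:ℝ) ≤ 2)]
    field_simp
  rw [h2, h2, show 1 - b - a = 1 - a - b by ring]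
  ring

/-! ### The nonlinearity -/

theorem rpow_sub_mul_le {β r R : ℝ} (hβ : 0 < β) (hr : 0 ≤ r) (hrR : r ≤ R) :
    (R ^ β - r ^ β) * r ≤ (1 + β) * R ^ β * (R - r) := by
  rcases hr.eq_or_lt with rfl | hr0
  · have hR : 0 ≤ R := hrR
    rw [mul_zero]; positivity
  have hR : 0 < R := by linarith
  -- Bernoulli's inequality for `(r/R)^{1+β}`
  have hb := one_add_mul_self_le_rpow_one_add (s := r / R - 1) (p := 1 + β)
    (by have : 0 ≤ r / R := by positivity
        linarith) (by linarith)
  have e1 : 1 + (r / R - 1) = r / R := by ring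
  rw [e1, Real.div_rpow hr hR.le, Real.rpow_add hr0, Real.rpow_add hR, Real.rpow_one,
    Real.rpow_one, le_div_iff₀ (by positivity)] at hb
  have e2 : (1 + (1 + β) * (r / R - 1)) * (R * R ^ β) = R * R ^ β + (1 + β) * (r - R) * R ^ β := by
    field_simp
  rw [e2] at hb
  have hmono : r * R ^ β ≤ R * R ^ β := by gcongr
  nlinarith

theorem norm_rpow_smul_sub_le {β : ℝ} (hβ : 0 < β) (a b : 𝕜) :
    ‖((‖a‖ ^ β : ℝ) • a : 𝕜) - (‖b‖ ^ β : ℝ) • b‖ ≤ (2 + β) * (‖a‖ ^ β + ‖b‖ ^ β) * ‖a - b‖ := by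
  wlog h : ‖b‖ ≤ ‖a‖ generalizing a b with H
  · have := H b a (le_of_not_ge h)
    rw [norm_sub_rev, norm_sub_rev a b, add_comm (‖a‖ ^ β)]
    exact this
  have e : ((‖a‖ ^ β : ℝ) • a : 𝕜) - (‖b‖ ^ β : ℝ) • b =
      (‖a‖ ^ β : ℝ) • (a - b) + (‖a‖ ^ β - ‖b‖ ^ β : ℝ) • b := by
    rw [smul_sub, sub_smul]; abel
  have h0 : ‖b‖ ^ β ≤ ‖a‖ ^ β := Real.rpow_le_rpow (norm_nonneg _) h hβ.le
  have h1 := rpow_sub_mul_le hβ (norm_nonneg b) h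
  have h2 : ‖a‖ - ‖b‖ ≤ ‖a - b‖ := norm_sub_norm_le a b
  have hA : 0 ≤ ‖a‖ ^ β := by positivity
  have hB : 0 ≤ ‖b‖ ^ β := by positivity
  rw [e]
  refine (norm_add_le _ _).trans ?_
  rw [norm_smul, norm_smul, Real.norm_of_nonneg hA, Real.norm_of_nonneg (by linarith)]
  have h3 : (1 + β) * ‖a‖ ^ β * (‖a‖ - ‖b‖) ≤ (1 + β) * ‖a‖ ^ β * ‖a - b‖ := by gcongr
  have h4 : 0 ≤ (2 + β) * ‖b‖ ^ β * ‖a - b‖ := by positivity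
  nlinarith

theorem norm_nonlin_sub_le {γ α : ℝ} (hα : 1 < α) (f g : Sp d → 𝕜) (x : Sp d) :
    ‖nonlin γ α f x - nonlin γ α g x‖ ≤
      ‖x‖ ^ γ * ((1 + α) * (‖f x‖ ^ (α - 1) + ‖g x‖ ^ (α - 1)) * ‖f x - g x‖) := by
  unfold nonlin
  rw [mul_smul, mul_smul, ← smul_sub, norm_smul, Real.norm_of_nonneg (by positivity)]
  have := norm_rpow_smul_sub_le (β := α - 1) (by linarith) (f x) (g x)
  rw [show 2 + (α - 1) = 1 + α by ring] at this
  gcongr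

theorem nonlin_congr {γ α : ℝ} {f g : Sp d → 𝕜} (h : f =ᵐ[volume] g) :
    nonlin γ α f =ᵐ[volume] nonlin γ α g := by
  filter_upwards [h] with x hx
  simp [nonlin, hx]

theorem SliceMeas.nonlin {T γ α : ℝ} {u : ℝ → Sp d → 𝕜} (h : SliceMeas T u) :
    SliceMeas T (fun τ => nonlin γ α (u τ)) := by
  obtain ⟨G, hG, hu⟩ := h
  refine ⟨fun τ => HardyHenon.nonlin γ α (G τ), ?_, ?_⟩
  · unfold HardyHenon.nonlin
    have h1 : Measurable (fun p : ℝ × Sp d => ‖G p.1 p.2‖) := hG.norm.measurable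
    have h2 : Measurable (fun p : ℝ × Sp d => ‖p.2‖ ^ γ) := by fun_prop
    exact (h2.mul (h1.pow_const _)).stronglyMeasurable.smul hG
  · filter_upwards [hu] with τ hτ
    exact nonlin_congr hτ

theorem wNorm_congr {q : ℝ≥0∞} {s : ℝ} {f g : Sp d → 𝕜} (h : f =ᵐ[volume] g) :
    wNorm q s f = wNorm q s g := by
  refine eLpNorm_congr_ae ?_
  filter_upwards [h] with x hx
  rw [hx]

/-- The nonlinearity is locally Lipschitz from `L^q_s` to `L^{q/α}_{αs-γ}`, by Hölder's
inequality. -/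
theorem wNorm_nonlin_sub_le (hd : 1 ≤ d) {γ α s : ℝ} (hα : 1 < α) {q : ℝ≥0∞}
    (hqα : ENNReal.ofReal α ≤ q) {f g : Sp d → 𝕜}
    (hf : AEStronglyMeasurable f volume) (hg : AEStronglyMeasurable g volume) :
    wNorm (q / ENNReal.ofReal α) (α * s - γ) (fun x => nonlin γ α f x - nonlin γ α g x) ≤
      ENNReal.ofReal (1 + α) * (wNorm q s f ^ (α - 1) + wNorm q s g ^ (α - 1)) *
        wNorm q s (fun x => f x - g x) := by
  have hα1 : 0 < α - 1 := by linarith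
  have hα0 : 0 < ENNReal.ofReal α := by rw [ENNReal.ofReal_pos]; linarith
  have hα10 : 0 < ENNReal.ofReal (α - 1) := by rwa [ENNReal.ofReal_pos]
  have mw : ∀ (f : Sp d → 𝕜), AEStronglyMeasurable f volume →
      AEStronglyMeasurable (fun x => ‖x‖ ^ s * ‖f x‖) volume := by
    intro f hf
    have h2 : Measurable (fun x : Sp d => ‖x‖ ^ s) := by fun_prop
    exact h2.aestronglyMeasurable.mul hf.norm
  have mw1 : ∀ (f : Sp d → 𝕜), AEStronglyMeasurable f volume →
      AEStronglyMeasurable (fun x => (‖x‖ ^ s * ‖f x‖) ^ (α - 1)) volume := fun f hf =>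
    ((mw f hf).aemeasurable.pow_const _).aestronglyMeasurable
  have hpow : ∀ f : Sp d → 𝕜, eLpNorm (fun x => (‖x‖ ^ s * ‖f x‖) ^ (α - 1))
      (q / ENNReal.ofReal (α - 1)) volume = wNorm q s f ^ (α - 1) := by
    intro f
    have := eLpNorm_norm_rpow (μ := (volume : Measure (Sp d))) (p := q / ENNReal.ofReal (α - 1))
      (fun x => ‖x‖ ^ s * ‖f x‖) hα1
    rw [ENNReal.div_mul_cancel hα10.ne' (by simp)] at this
    rw [wNorm, ← this]
    congr 1
    ext x
    rw [Real.norm_of_nonneg (by positivity)]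
  have hH : ENNReal.HolderTriple (q / ENNReal.ofReal (α - 1)) q (q / ENNReal.ofReal α) := by
    constructor
    rw [ENNReal.inv_div (by simp) (by simp [hα10.ne']), ENNReal.inv_div (by simp) (by simp [hα0.ne']),
      ENNReal.div_eq_inv_mul, ENNReal.div_eq_inv_mul]
    nth_rewrite 2 [← mul_one q⁻¹]
    rw [← mul_add, ← ENNReal.ofReal_one, ← ENNReal.ofReal_add hα1.le zero_le_one]
    congr 2
    ring
  have hr1 : 1 ≤ q / ENNReal.ofReal α := by
    rw [ENNReal.le_div_iff_mul_le (.inl hα0.ne') (.inl (by simp))]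
    simpa using hqα
  set w : Sp d → 𝕜 := fun x => f x - g x with hw
  have hwm : AEStronglyMeasurable w volume := hf.sub hg
  have hol : ∀ f : Sp d → 𝕜, AEStronglyMeasurable f volume →
      eLpNorm (fun x => (‖x‖ ^ s * ‖f x‖) ^ (α - 1) * (‖x‖ ^ s * ‖w x‖)) (q / ENNReal.ofReal α) volume
        ≤ wNorm q s f ^ (α - 1) * wNorm q s w := by
    intro f hf
    have := eLpNorm_le_eLpNorm_mul_eLpNorm'_of_norm (hpqr := hH) (mw1 f hf) (mw w hwm)
      (fun a b : ℝ => a * b) 1 (.of_forall fun x => by rw [norm_mul]; simp)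
    rwa [hpow f, ENNReal.coe_one, one_mul] at this
  calc wNorm (q / ENNReal.ofReal α) (α * s - γ) (fun x => nonlin γ α f x - nonlin γ α g x)
      ≤ eLpNorm ((1 + α) • fun x => ((‖x‖ ^ s * ‖f x‖) ^ (α - 1) * (‖x‖ ^ s * ‖w x‖) +
          (‖x‖ ^ s * ‖g x‖) ^ (α - 1) * (‖x‖ ^ s * ‖w x‖))) (q / ENNReal.ofReal α) volume := by
        refine eLpNorm_mono_ae_real ?_
        filter_upwards [ae_ne_zero hd] with x hx
        have hx0 : 0 < ‖x‖ := norm_pos_iff.2 hx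
        rw [Real.norm_of_nonneg (by positivity)]
        refine (mul_le_mul_of_nonneg_left (norm_nonlin_sub_le hα f g x) (by positivity)).trans
          (le_of_eq ?_)
        simp only [Pi.smul_apply, smul_eq_mul]
        rw [Real.mul_rpow (by positivity) (by positivity), Real.mul_rpow (by positivity) (by positivity),
          ← Real.rpow_mul hx0.le, ← mul_assoc, ← Real.rpow_add hx0]
        have e : ‖x‖ ^ (α * s - γ + γ) = ‖x‖ ^ (s * (α - 1)) * ‖x‖ ^ s := by
          rw [← Real.rpow_add hx0]; congr 1; ring
        rw [e, hw]
        ring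
    _ ≤ ENNReal.ofReal (1 + α) * (wNorm q s f ^ (α - 1) * wNorm q s w +
          wNorm q s g ^ (α - 1) * wNorm q s w) := by
        rw [eLpNorm_const_smul, Real.enorm_eq_ofReal (by linarith)]
        refine mul_le_mul_right ?_ _
        refine (eLpNorm_add_le ((mw1 f hf).mul (mw w hwm)) ((mw1 g hg).mul (mw w hwm)) hr1).trans ?_
        exact add_le_add (hol f hf) (hol g hg)
    _ = _ := by ring

/-! ### Admissible parameters and the Kato estimates -/

/-- The exponent conditions in the form in which the estimates use them: `-d/q < s < s̃ ≤ αs - γ`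
and `αs - γ < d(1 - α/q)` are the conditions of the linear estimates, and
`(α - 1)(s̃ + d/q) < 2 + γ` says that `s̃` is subcritical. -/
structure Admissible (d : ℕ) (γ α s' s : ℝ) (q : ℝ≥0∞) : Prop where
  one_le_d : 1 ≤ d
  one_lt_alpha : 1 < α
  alpha_le_q : ENNReal.ofReal α ≤ q
  lower : -(d : ℝ) * invExp q < s
  s_lt : s < s'
  le_source : s' ≤ α * s - γ
  source_lt : α * s - γ < d * (1 - α * invExp q)
  subcritical : (α - 1) * (s' + d * invExp q) < 2 + γ

/-- The gain `δ` of powers of `t` in the Duhamel estimate; it equals `(α-1)(s_c - s̃)/2`. -/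
def gain (d : ℕ) (γ α s' : ℝ) (q : ℝ≥0∞) : ℝ := 1 - ((α - 1) * (s' + d * invExp q) - γ) / 2

namespace Admissible

variable {γ α s' s : ℝ} {q : ℝ≥0∞}

theorem one_le_q (h : Admissible d γ α s' s q) : 1 ≤ q := by
  refine le_trans ?_ h.alpha_le_q
  rw [← ENNReal.ofReal_one]
  exact ENNReal.ofReal_le_ofReal h.one_lt_alpha.le

theorem q_ne_zero (h : Admissible d γ α s' s q) : q ≠ 0 :=
  (lt_of_lt_of_le zero_lt_one h.one_le_q).ne'

theorem gain_pos (h : Admissible d γ α s' s q) : 0 < gain d γ α s' q := by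
  have := h.subcritical
  unfold gain
  linarith

theorem one_le_source (h : Admissible d γ α s' s q) : 1 ≤ q / ENNReal.ofReal α := by
  have hα0 : 0 < ENNReal.ofReal α := by rw [ENNReal.ofReal_pos]; linarith [h.one_lt_alpha]
  rw [ENNReal.le_div_iff_mul_le (.inl hα0.ne') (.inl (by simp))]
  simpa using h.alpha_le_q

theorem source_le (h : Admissible d γ α s' s q) : q / ENNReal.ofReal α ≤ q := by
  refine ENNReal.div_le_of_le_mul ?_
  calc q = q * 1 := (mul_one q).symm
    _ ≤ q * ENNReal.ofReal α := by
      gcongr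
      rw [← ENNReal.ofReal_one]
      exact ENNReal.ofReal_le_ofReal h.one_lt_alpha.le

theorem invExp_source (h : Admissible d γ α s' s q) :
    invExp (q / ENNReal.ofReal α) = α * invExp q := by
  have hα0 : 0 < ENNReal.ofReal α := by rw [ENNReal.ofReal_pos]; linarith [h.one_lt_alpha]
  unfold invExp
  rw [ENNReal.inv_div (by simp) (by simp [hα0.ne']), ENNReal.toReal_div,
    ENNReal.toReal_ofReal (by linarith [h.one_lt_alpha]), ENNReal.toReal_inv]
  rfl

theorem lt_upper (h : Admissible d γ α s' s q) : s' < d * (1 - invExp q) := by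
  have h1 := h.le_source
  have h2 := h.source_lt
  have h3 : (d : ℝ) * invExp q ≤ d * (α * invExp q) := by
    have := mul_le_mul_of_nonneg_right h.one_lt_alpha.le (invExp_nonneg q)
    rw [one_mul] at this
    gcongr
  nlinarith

theorem dinv_nonneg (_h : Admissible d γ α s' s q) : 0 ≤ d * invExp q := by
  have := invExp_nonneg q
  positivity

theorem weight_lt_one (h : Admissible d γ α s' s q) : α * ((s' - s) / 2) < 1 := by
  have h1 := h.le_source
  have h2 := h.subcritical
  have h3 := mul_nonneg (by linarith [h.one_lt_alpha] : 0 ≤ α - 1) h.dinv_nonneg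
  nlinarith

theorem weight_pos (h : Admissible d γ α s' s q) : 0 < (s' - s) / 2 := by linarith [h.s_lt]

/-- The smoothing effect of the heat semigroup on data. -/
theorem exists_heatE_le (h : Admissible d γ α s' s q) : ∃ K : ℝ≥0, ∀ t : ℝ, 0 < t →
    ∀ f : Sp d → ℝ≥0∞, AEMeasurable f →
      wNormE q s (heatE t f) ≤ K * ENNReal.ofReal (t ^ (-((s' - s) / 2))) * wNormE q s' f ∧
      wNormE q s' (heatE t f) ≤ K * wNormE q s' f := by
  obtain ⟨K1, h1⟩ := exists_wNormE_heatE_le h.one_le_d h.one_le_q le_rfl h.s_lt.le h.lower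
    h.lt_upper
  obtain ⟨K2, h2⟩ := exists_wNormE_heatE_le h.one_le_d h.one_le_q le_rfl (le_refl s')
    (h.lower.trans h.s_lt) h.lt_upper
  refine ⟨max K1 K2, fun t ht f hf => ⟨?_, ?_⟩⟩
  · refine (h1 t ht f hf).trans ?_
    have e : (d * (invExp q - invExp q) + (s' - s)) / 2 = (s' - s) / 2 := by ring
    rw [e]
    gcongr
    exact le_max_left _ _
  · refine (h2 t ht f hf).trans ?_
    have e : -((d * (invExp q - invExp q) + (s' - s')) / 2) = 0 := by ring
    rw [e, Real.rpow_zero, ENNReal.ofReal_one, mul_one]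
    gcongr
    exact le_max_right _ _

end Admissible

theorem exists_wNormE_duhE_le {p q : ℝ≥0∞} {s₁ s₂ κ b : ℝ} {K : ℝ≥0} (hq : 1 ≤ q)
    (hκ0 : 0 ≤ κ) (hκ : κ < 1) (hb0 : 0 ≤ b) (hb : b < 1)
    (hK : ∀ t : ℝ, 0 < t → ∀ f : Sp d → ℝ≥0∞, AEMeasurable f →
      wNormE q s₂ (heatE t f) ≤ K * ENNReal.ofReal (t ^ (-κ)) * wNormE p s₁ f) :
    ∃ B : ℝ≥0, ∀ t : ℝ, 0 < t → ∀ F : ℝ → Sp d → 𝕜, SliceMeas t F → ∀ M : ℝ≥0∞,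
      (∀ᵐ τ ∂(volume.restrict (Ioo 0 t)), wNorm p s₁ (F τ) ≤ M * ENNReal.ofReal (τ ^ (-b))) →
      wNormE q s₂ (duhE t t F) ≤ B * M * ENNReal.ofReal (t ^ (1 - κ - b)) := by
  obtain ⟨B, hB⟩ := exists_lintegral_beta_le hκ0 hκ hb0 hb
  refine ⟨K * B, fun t ht F hF M hM => ?_⟩
  refine (wNormE_duhE_le hq hK le_rfl hF (by fun_prop) hM).trans ?_
  calc ∫⁻ τ in Ioo 0 t, K * ENNReal.ofReal ((t - τ) ^ (-κ)) * (M * ENNReal.ofReal (τ ^ (-b)))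
      = ∫⁻ τ in Ioo 0 t, (K * M) *
          (ENNReal.ofReal ((t - τ) ^ (-κ)) * ENNReal.ofReal (τ ^ (-b))) := by
        refine lintegral_congr fun τ => ?_
        ring
    _ = (K * M) * ∫⁻ τ in Ioo 0 t,
          (ENNReal.ofReal ((t - τ) ^ (-κ)) * ENNReal.ofReal (τ ^ (-b))) :=
        lintegral_const_mul _ (by fun_prop)
    _ ≤ (K * M) * (B * ENNReal.ofReal (t ^ (1 - κ - b))) := by gcongr; exact hB t ht
    _ = _ := by push_cast; ring

/-- The exponential weight gains a negative power of `l`. -/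
theorem exp_neg_le_rpow_neg {x ε : ℝ} (hx : 0 < x) (hε0 : 0 < ε) (hε : ε ≤ 1) :
    Real.exp (-x) ≤ x ^ (-ε) := by
  rw [Real.exp_neg, Real.rpow_neg hx.le]
  refine inv_anti₀ (by positivity) ?_
  calc x ^ ε ≤ (Real.exp x) ^ ε :=
        Real.rpow_le_rpow hx.le (by linarith [Real.add_one_le_exp x]) hε0.le
    _ = Real.exp (x * ε) := by rw [← Real.exp_mul]
    _ ≤ Real.exp x := Real.exp_le_exp.2 (by nlinarith)

/-- The Duhamel estimate with an exponential weight `e^{lτ}`, whose constant is small for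
large `l`. -/
theorem exists_wNormE_duhE_exp_le {p q : ℝ≥0∞} {s₁ s₂ κ b ε : ℝ} {K : ℝ≥0} (hq : 1 ≤ q)
    (hκ0 : 0 ≤ κ) (hb0 : 0 ≤ b) (hb : b < 1) (hε0 : 0 < ε) (hε : κ + ε < 1)
    (hK : ∀ t : ℝ, 0 < t → ∀ f : Sp d → ℝ≥0∞, AEMeasurable f →
      wNormE q s₂ (heatE t f) ≤ K * ENNReal.ofReal (t ^ (-κ)) * wNormE p s₁ f) :
    ∃ B : ℝ≥0, ∀ t : ℝ, 0 < t → ∀ F : ℝ → Sp d → 𝕜, SliceMeas t F → ∀ M : ℝ≥0∞, ∀ l : ℝ, 0 < l →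
      (∀ᵐ τ ∂(volume.restrict (Ioo 0 t)),
        wNorm p s₁ (F τ) ≤ M * ENNReal.ofReal (τ ^ (-b) * Real.exp (l * τ))) →
      wNormE q s₂ (duhE t t F) ≤
        B * M * ENNReal.ofReal (l ^ (-ε) * Real.exp (l * t) * t ^ (1 - κ - ε - b)) := by
  obtain ⟨B, hB⟩ := exists_lintegral_beta_le (a := κ + ε) (by linarith) hε hb0 hb
  refine ⟨K * B, fun t ht F hF M l hl hM => ?_⟩
  refine (wNormE_duhE_le hq hK le_rfl hF (by fun_prop) hM).trans ?_
  have hle : 0 ≤ l ^ (-ε) * Real.exp (l * t) := by positivity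
  calc ∫⁻ τ in Ioo 0 t, K * ENNReal.ofReal ((t - τ) ^ (-κ)) *
        (M * ENNReal.ofReal (τ ^ (-b) * Real.exp (l * τ)))
      ≤ ∫⁻ τ in Ioo 0 t, (K * M * ENNReal.ofReal (l ^ (-ε) * Real.exp (l * t))) *
          (ENNReal.ofReal ((t - τ) ^ (-(κ + ε))) * ENNReal.ofReal (τ ^ (-b))) := by
        refine setLIntegral_mono' measurableSet_Ioo fun τ hτ => ?_
        have h0 : 0 < t - τ := by linarith [hτ.2]
        have hτ0 : 0 < τ := hτ.1
        have key : (t - τ) ^ (-κ) * (τ ^ (-b) * Real.exp (l * τ)) ≤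
            (l ^ (-ε) * Real.exp (l * t)) * ((t - τ) ^ (-(κ + ε)) * τ ^ (-b)) := by
          have h1 := exp_neg_le_rpow_neg (mul_pos hl h0) hε0 (by linarith)
          rw [Real.mul_rpow hl.le h0.le] at h1
          have h2 : Real.exp (l * τ) = Real.exp (l * t) * Real.exp (-(l * (t - τ))) := by
            rw [← Real.exp_add]; congr 1; ring
          rw [h2, neg_add, Real.rpow_add h0]
          calc _ = ((t - τ) ^ (-κ) * τ ^ (-b) * Real.exp (l * t)) * Real.exp (-(l * (t - τ))) := by
                ring
            _ ≤ ((t - τ) ^ (-κ) * τ ^ (-b) * Real.exp (l * t)) * (l ^ (-ε) * (t - τ) ^ (-ε)) := by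
                gcongr
            _ = _ := by ring
        calc _ = K * M * ENNReal.ofReal ((t - τ) ^ (-κ) * (τ ^ (-b) * Real.exp (l * τ))) := by
              rw [ENNReal.ofReal_mul (by positivity : 0 ≤ (t - τ) ^ (-κ))]; ring
          _ ≤ K * M * ENNReal.ofReal ((l ^ (-ε) * Real.exp (l * t)) *
              ((t - τ) ^ (-(κ + ε)) * τ ^ (-b))) := by gcongr
          _ = _ := by
              rw [ENNReal.ofReal_mul hle, ENNReal.ofReal_mul (by positivity : 0 ≤ (t - τ) ^ (-(κ+ε)))]
              ring
    _ = (K * M * ENNReal.ofReal (l ^ (-ε) * Real.exp (l * t))) * ∫⁻ τ in Ioo 0 t,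
          (ENNReal.ofReal ((t - τ) ^ (-(κ + ε))) * ENNReal.ofReal (τ ^ (-b))) :=
        lintegral_const_mul _ (by fun_prop)
    _ ≤ (K * M * ENNReal.ofReal (l ^ (-ε) * Real.exp (l * t))) *
          (B * ENNReal.ofReal (t ^ (1 - (κ + ε) - b))) := by gcongr; exact hB t ht
    _ = _ := by
        rw [ENNReal.ofReal_mul hle, show 1 - (κ + ε) - b = 1 - κ - ε - b by ring]
        push_cast; ring

namespace Admissible

variable {γ α s' s : ℝ} {q : ℝ≥0∞}

/-- The linear estimates from the source space `L^{q/α}_{αs-γ}`, with the exponents of `t`. -/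
theorem exists_heatE_source_le (h : Admissible d γ α s' s q) {σ : ℝ} (hσ : σ ≤ s') (hσ' : s ≤ σ) :
    ∃ K : ℝ≥0, ∀ t : ℝ, 0 < t → ∀ f : Sp d → ℝ≥0∞, AEMeasurable f →
      wNormE q σ (heatE t f) ≤
        K * ENNReal.ofReal (t ^ (-(1 - gain d γ α s' q - α * ((s' - s) / 2) + (s' - σ) / 2))) *
          wNormE (q / ENNReal.ofReal α) (α * s - γ) f := by
  obtain ⟨K, hK⟩ := exists_wNormE_heatE_le h.one_le_d h.one_le_source h.source_le
    (s₁ := α * s - γ) (s₂ := σ) (hσ.trans h.le_source) (lt_of_lt_of_le h.lower hσ')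
    (by rw [h.invExp_source]; exact h.source_lt)
  refine ⟨K, fun t ht f hf => ?_⟩
  have := hK t ht f hf
  rw [h.invExp_source] at this
  convert this using 6
  unfold gain
  ring

theorem source_exp_nonneg (h : Admissible d γ α s' s q) {σ : ℝ} (hσ : σ ≤ s') :
    0 ≤ 1 - gain d γ α s' q - α * ((s' - s) / 2) + (s' - σ) / 2 := by
  have h1 := h.le_source
  have h3 := mul_nonneg (by linarith [h.one_lt_alpha] : 0 ≤ α - 1) h.dinv_nonneg
  unfold gain
  nlinarith

theorem source_exp_lt_one (h : Admissible d γ α s' s q) {σ : ℝ} (hσ' : s ≤ σ) :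
    1 - gain d γ α s' q - α * ((s' - s) / 2) + (s' - σ) / 2 < 1 := by
  have h1 := h.gain_pos
  have h2 : (s' - s) / 2 ≤ α * ((s' - s) / 2) := by nlinarith [h.weight_pos, h.one_lt_alpha]
  linarith

theorem weight_nonneg (h : Admissible d γ α s' s q) : 0 ≤ α * ((s' - s) / 2) :=
  mul_nonneg (by linarith [h.one_lt_alpha]) h.weight_pos.le

/-- **Duhamel estimate.** A source of size `τ^{-α(s̃-s)/2}` in `L^{q/α}_{αs-γ}` gains `t^δ`. -/
theorem exists_duhE_le (𝕜 : Type*) [RCLike 𝕜] (h : Admissible d γ α s' s q) :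
    ∃ K : ℝ≥0, ∀ t : ℝ, 0 < t →
    ∀ F : ℝ → Sp d → 𝕜, SliceMeas t F → ∀ M : ℝ≥0∞,
      (∀ᵐ τ ∂(volume.restrict (Ioo 0 t)), wNorm (q / ENNReal.ofReal α) (α * s - γ) (F τ) ≤
        M * ENNReal.ofReal (τ ^ (-(α * ((s' - s) / 2))))) →
      wNormE q s (duhE t t F) ≤
        K * M * ENNReal.ofReal (t ^ (gain d γ α s' q - (s' - s) / 2)) ∧
      wNormE q s' (duhE t t F) ≤ K * M * ENNReal.ofReal (t ^ gain d γ α s' q) := by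
  obtain ⟨K1, h1⟩ := h.exists_heatE_source_le h.s_lt.le le_rfl
  obtain ⟨K2, h2⟩ := h.exists_heatE_source_le le_rfl h.s_lt.le
  obtain ⟨B1, hB1⟩ := exists_wNormE_duhE_le (𝕜 := 𝕜) h.one_le_q (h.source_exp_nonneg h.s_lt.le)
    (h.source_exp_lt_one le_rfl) h.weight_nonneg h.weight_lt_one h1
  obtain ⟨B2, hB2⟩ := exists_wNormE_duhE_le (𝕜 := 𝕜) h.one_le_q (h.source_exp_nonneg le_rfl)
    (h.source_exp_lt_one h.s_lt.le) h.weight_nonneg h.weight_lt_one h2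
  refine ⟨max B1 B2, fun t ht F hF M hM => ⟨?_, ?_⟩⟩
  · refine (hB1 t ht F hF M hM).trans ?_
    rw [show 1 - (1 - gain d γ α s' q - α * ((s' - s) / 2) + (s' - s) / 2) - α * ((s' - s) / 2) =
      gain d γ α s' q - (s' - s) / 2 by ring]
    gcongr
    exact le_max_left _ _
  · refine (hB2 t ht F hF M hM).trans ?_
    rw [show 1 - (1 - gain d γ α s' q - α * ((s' - s) / 2) + (s' - s') / 2) - α * ((s' - s) / 2) =
      gain d γ α s' q by ring]
    gcongr
    exact le_max_right _ _

theorem exists_duhE_exp_le (𝕜 : Type*) [RCLike 𝕜] (h : Admissible d γ α s' s q) :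
    ∃ (K : ℝ≥0) (ε : ℝ), 0 < ε ∧ ε ≤ gain d γ α s' q ∧ ∀ t : ℝ, 0 < t →
    ∀ F : ℝ → Sp d → 𝕜, SliceMeas t F → ∀ M : ℝ≥0∞, ∀ l : ℝ, 0 < l →
      (∀ᵐ τ ∂(volume.restrict (Ioo 0 t)), wNorm (q / ENNReal.ofReal α) (α * s - γ) (F τ) ≤
        M * ENNReal.ofReal (τ ^ (-(α * ((s' - s) / 2))) * Real.exp (l * τ))) →
      wNormE q s (duhE t t F) ≤ K * M * ENNReal.ofReal
        (l ^ (-ε) * Real.exp (l * t) * t ^ (gain d γ α s' q - ε - (s' - s) / 2)) := by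
  obtain ⟨K1, h1⟩ := h.exists_heatE_source_le h.s_lt.le le_rfl
  have hlt := h.source_exp_lt_one (σ := s) le_rfl
  set κ := 1 - gain d γ α s' q - α * ((s' - s) / 2) + (s' - s) / 2 with hκ
  set ε := min (gain d γ α s' q) ((1 - κ) / 2) with hε
  have hε0 : 0 < ε := lt_min h.gain_pos (by linarith)
  have hε1 : κ + ε < 1 := by
    have : ε ≤ (1 - κ) / 2 := min_le_right _ _
    linarith
  obtain ⟨B, hB⟩ := exists_wNormE_duhE_exp_le (𝕜 := 𝕜) h.one_le_q (h.source_exp_nonneg h.s_lt.le)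
    h.weight_nonneg h.weight_lt_one hε0 hε1 h1
  refine ⟨B, ε, hε0, min_le_left _ _, fun t ht F hF M l hl hM => ?_⟩
  refine (hB t ht F hF M l hl hM).trans (le_of_eq ?_)
  congr 4
  ring

/-- The source term in terms of weighted norms of the solutions. -/
theorem nonlin_sub_le (h : Admissible d γ α s' s q) {f g : Sp d → 𝕜}
    (hf : AEStronglyMeasurable f volume) (hg : AEStronglyMeasurable g volume) {M D : ℝ≥0∞} {τ : ℝ}
    (hτ : 0 < τ) (hfM : wNorm q s f ≤ M * ENNReal.ofReal (τ ^ (-((s' - s) / 2))))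
    (hgM : wNorm q s g ≤ M * ENNReal.ofReal (τ ^ (-((s' - s) / 2))))
    (hD : wNorm q s (fun x => f x - g x) ≤ D * ENNReal.ofReal (τ ^ (-((s' - s) / 2)))) :
    wNorm (q / ENNReal.ofReal α) (α * s - γ) (fun x => nonlin γ α f x - nonlin γ α g x) ≤
      (2 * ENNReal.ofReal (1 + α) * M ^ (α - 1) * D) *
        ENNReal.ofReal (τ ^ (-(α * ((s' - s) / 2)))) := by
  have hα1 : 0 ≤ α - 1 := by linarith [h.one_lt_alpha]
  refine (wNorm_nonlin_sub_le h.one_le_d h.one_lt_alpha h.alpha_le_q hf hg).trans ?_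
  calc ENNReal.ofReal (1 + α) * (wNorm q s f ^ (α - 1) + wNorm q s g ^ (α - 1)) *
        wNorm q s (fun x => f x - g x)
      ≤ ENNReal.ofReal (1 + α) * ((M * ENNReal.ofReal (τ ^ (-((s' - s) / 2)))) ^ (α - 1) +
          (M * ENNReal.ofReal (τ ^ (-((s' - s) / 2)))) ^ (α - 1)) *
          (D * ENNReal.ofReal (τ ^ (-((s' - s) / 2)))) := by gcongr
    _ = _ := by
      have e : ENNReal.ofReal (τ ^ (-(α * ((s' - s) / 2)))) =
          ENNReal.ofReal (τ ^ (-((s' - s) / 2))) ^ (α - 1) *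
            ENNReal.ofReal (τ ^ (-((s' - s) / 2))) := by
        rw [ENNReal.ofReal_rpow_of_pos (by positivity), ← ENNReal.ofReal_mul (by positivity),
          ← Real.rpow_mul hτ.le, ← Real.rpow_add hτ]
        congr 2
        ring
      rw [e, ENNReal.mul_rpow_of_nonneg _ _ hα1]
      ring

end Admissible

/-! ### Kato bounds -/

theorem ofReal_rpow_mul_cancel {t c : ℝ} (ht : 0 < t) :
    ENNReal.ofReal (t ^ (-c)) * ENNReal.ofReal t ^ c = 1 := by
  rw [ENNReal.ofReal_rpow_of_pos ht, ← ENNReal.ofReal_mul (by positivity), ← Real.rpow_add ht]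
  simp

theorem wNorm_le_katoNorm {q : ℝ≥0∞} {s' s T : ℝ} (u : ℝ → Sp d → 𝕜) {t : ℝ} (ht : 0 < t)
    (htT : t ≤ T) :
    wNorm q s (u t) ≤ katoNorm q s' s T u * ENNReal.ofReal (t ^ (-((s' - s) / 2))) := by
  have h1 : ENNReal.ofReal t ^ ((s' - s) / 2) * wNorm q s (u t) ≤ katoNorm q s' s T u :=
    le_iSup₂ (f := fun t (_ : t ∈ Icc (0 : ℝ) T) =>
      ENNReal.ofReal t ^ ((s' - s) / 2) * wNorm q s (u t)) t ⟨ht.le, htT⟩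
  calc wNorm q s (u t) = (ENNReal.ofReal (t ^ (-((s' - s) / 2))) * ENNReal.ofReal t ^ ((s' - s) / 2))
        * wNorm q s (u t) := by rw [ofReal_rpow_mul_cancel ht, one_mul]
    _ = (ENNReal.ofReal t ^ ((s' - s) / 2) * wNorm q s (u t)) *
        ENNReal.ofReal (t ^ (-((s' - s) / 2))) := by ring
    _ ≤ _ := by gcongr

theorem katoNorm_le {q : ℝ≥0∞} {s' s T : ℝ} (hs : s < s') {u : ℝ → Sp d → 𝕜} {M : ℝ≥0∞}
    (h : ∀ t, 0 < t → t ≤ T → wNorm q s (u t) ≤ M * ENNReal.ofReal (t ^ (-((s' - s) / 2)))) :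
    katoNorm q s' s T u ≤ M := by
  refine iSup₂_le fun t ht => ?_
  rcases ht.1.eq_or_lt with rfl | h0
  · have : 0 < (s' - s) / 2 := by linarith
    simp [this]
  · calc ENNReal.ofReal t ^ ((s' - s) / 2) * wNorm q s (u t)
        ≤ ENNReal.ofReal t ^ ((s' - s) / 2) * (M * ENNReal.ofReal (t ^ (-((s' - s) / 2)))) := by
          gcongr
          exact h t h0 ht.2
      _ = M * (ENNReal.ofReal (t ^ (-((s' - s) / 2))) * ENNReal.ofReal t ^ ((s' - s) / 2)) := by ring
      _ = M := by rw [ofReal_rpow_mul_cancel h0, mul_one]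

theorem katoNorm_congr {q : ℝ≥0∞} {s' s T : ℝ} {u v : ℝ → Sp d → 𝕜}
    (h : ∀ t ∈ Icc (0 : ℝ) T, u t =ᵐ[volume] v t) :
    katoNorm q s' s T u = katoNorm q s' s T v := by
  refine iSup_congr fun t => iSup_congr fun ht => ?_
  rw [wNorm_congr (h t ht)]

/-- `u` is jointly measurable on `(0,T) × ℝ^d` up to null sets in almost every slice, and
`‖u(τ)‖_{L^q_s} ≤ M τ^{-c}` for `0 < τ < T`. -/
structure KatoBdd (q : ℝ≥0∞) (s c T : ℝ) (M : ℝ≥0∞) (u : ℝ → Sp d → 𝕜) : Prop where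
  meas : SliceMeas T u
  bound : ∀ τ ∈ Ioo (0 : ℝ) T, wNorm q s (u τ) ≤ M * ENNReal.ofReal (τ ^ (-c))

theorem KatoBdd.mono {q : ℝ≥0∞} {s c T T' : ℝ} {M : ℝ≥0∞} {u : ℝ → Sp d → 𝕜}
    (h : KatoBdd q s c T M u) (hT : T' ≤ T) : KatoBdd q s c T' M u :=
  ⟨h.meas.mono hT, fun τ hτ => h.bound τ ⟨hτ.1, hτ.2.trans_le hT⟩⟩

theorem KatoBdd.mono_right {q : ℝ≥0∞} {s c T : ℝ} {M M' : ℝ≥0∞} {u : ℝ → Sp d → 𝕜}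
    (h : KatoBdd q s c T M u) (hM : M ≤ M') : KatoBdd q s c T M' u :=
  ⟨h.meas, fun τ hτ => (h.bound τ hτ).trans (by gcongr)⟩

theorem katoBdd_zero {q : ℝ≥0∞} {s c T : ℝ} {M : ℝ≥0∞} :
    KatoBdd q s c T M (fun _ (_ : Sp d) => (0 : 𝕜)) :=
  ⟨.of_stronglyMeasurable stronglyMeasurable_const, fun τ _ => by simp [wNorm]⟩

theorem katoBdd_of_katoNorm {q : ℝ≥0∞} {s' s T T' : ℝ} {u : ℝ → Sp d → 𝕜} (hu : SliceMeas T u)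
    (hT : T ≤ T') : KatoBdd q s ((s' - s) / 2) T (katoNorm q s' s T' u) u :=
  ⟨hu, fun _ hτ => wNorm_le_katoNorm u hτ.1 (hτ.2.le.trans hT)⟩

theorem IsKato.sliceMeas {q : ℝ≥0∞} {s' s T : ℝ} {u : ℝ → Sp d → 𝕜} (h : IsKato q s' s T u) :
    SliceMeas T u := .of_aestronglyMeasurable h.1

theorem ae_eq_zero_of_wNorm (hd : 1 ≤ d) {q : ℝ≥0∞} (hq : q ≠ 0) {s : ℝ} {f : Sp d → 𝕜}
    (hf : AEStronglyMeasurable f volume) (h : wNorm q s f = 0) : f =ᵐ[volume] 0 := by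
  have h1 : Measurable (fun x : Sp d => ‖x‖ ^ s) := by fun_prop
  have h2 : AEStronglyMeasurable (fun x => ‖x‖ ^ s * ‖f x‖) volume :=
    h1.aestronglyMeasurable.mul hf.norm
  rw [wNorm, eLpNorm_eq_zero_iff h2 hq] at h
  filter_upwards [h, ae_ne_zero hd] with x hx hx0
  have hx1 : 0 < ‖x‖ := norm_pos_iff.2 hx0
  have hx2 : ‖x‖ ^ s ≠ 0 := by positivity
  simpa only [Pi.zero_apply, mul_eq_zero, hx2, false_or, norm_eq_zero] using hx

theorem nonlin_zero {γ α : ℝ} : nonlin γ α (fun _ : Sp d => (0 : 𝕜)) = fun _ => 0 := by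
  ext x; simp [nonlin]

theorem SolvesIntegralEq.ae_eq {γ α T : ℝ} {u₀ : Sp d → 𝕜} {u : ℝ → Sp d → 𝕜}
    (h : SolvesIntegralEq γ α T u₀ u) {t : ℝ} (ht : t ∈ Icc 0 T) :
    u t =ᵐ[volume] fun x => heat t u₀ x + duh t t (fun τ => nonlin γ α (u τ)) x := by
  filter_upwards [h t ht] with x hx
  exact hx.2

namespace Admissible

variable {γ α s' s : ℝ} {q : ℝ≥0∞}

/-- The source of the difference of two Kato-bounded functions. -/
theorem ae_nonlin_sub_le (h : Admissible d γ α s' s q) {t : ℝ} {M D : ℝ≥0∞}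
    {u v : ℝ → Sp d → 𝕜} (hu : KatoBdd q s ((s' - s) / 2) t M u)
    (hv : KatoBdd q s ((s' - s) / 2) t M v)
    (hD : ∀ τ ∈ Ioo 0 t, wNorm q s (fun x => u τ x - v τ x) ≤
      D * ENNReal.ofReal (τ ^ (-((s' - s) / 2)))) :
    ∀ᵐ τ ∂(volume.restrict (Ioo 0 t)), wNorm (q / ENNReal.ofReal α) (α * s - γ)
      (fun x => nonlin γ α (u τ) x - nonlin γ α (v τ) x) ≤
      (2 * ENNReal.ofReal (1 + α) * M ^ (α - 1) * D) *
        ENNReal.ofReal (τ ^ (-(α * ((s' - s) / 2)))) := by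
  filter_upwards [hu.meas.aestronglyMeasurable_slice, hv.meas.aestronglyMeasurable_slice,
    ae_restrict_mem measurableSet_Ioo] with τ h1 h2 hτ
  exact h.nonlin_sub_le h1 h2 hτ.1 (hu.bound τ hτ) (hv.bound τ hτ) (hD τ hτ)

theorem ae_nonlin_le (h : Admissible d γ α s' s q) {t : ℝ} {M : ℝ≥0∞}
    {u : ℝ → Sp d → 𝕜} (hu : KatoBdd q s ((s' - s) / 2) t M u) :
    ∀ᵐ τ ∂(volume.restrict (Ioo 0 t)), wNorm (q / ENNReal.ofReal α) (α * s - γ)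
      (nonlin γ α (u τ)) ≤ (2 * ENNReal.ofReal (1 + α) * M ^ (α - 1) * M) *
        ENNReal.ofReal (τ ^ (-(α * ((s' - s) / 2)))) := by
  have := h.ae_nonlin_sub_le hu (katoBdd_zero (𝕜 := 𝕜) (M := M)) (D := M)
    (fun τ hτ => by simpa using hu.bound τ hτ)
  filter_upwards [this] with τ hτ
  simpa [nonlin_zero] using hτ

/-- `duhE` of the nonlinearity is finite almost everywhere, at any later time of evaluation. -/
theorem duhE_nonlin_lt_top (h : Admissible d γ α s' s q) {t r : ℝ} (ht : 0 ≤ t) (hr : t ≤ r)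
    {M : ℝ≥0∞} (hM : M ≠ ⊤) {u : ℝ → Sp d → 𝕜} (hu : KatoBdd q s ((s' - s) / 2) t M u) :
    ∀ᵐ x ∂(volume : Measure (Sp d)), duhE t r (fun τ => nonlin γ α (u τ)) x < ⊤ := by
  rcases ht.eq_or_lt with rfl | ht
  · simp [duhE]
  obtain ⟨K, hK⟩ := h.exists_duhE_le 𝕜
  have hN := hu.meas.nonlin (γ := γ) (α := α)
  have h1 := (hK t ht _ hN _ (h.ae_nonlin_le hu)).2
  have hα1 : 0 ≤ α - 1 := by linarith [h.one_lt_alpha]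
  have hfin : wNormE q s' (duhE t t (fun τ => nonlin γ α (u τ))) < ⊤ := by
    refine lt_of_le_of_lt h1 ?_
    have : M ^ (α - 1) ≠ ⊤ := ENNReal.rpow_ne_top_of_nonneg hα1 hM
    finiteness
  rcases hr.eq_or_lt with rfl | hr
  · exact ae_lt_top_of_wNormE h.one_le_d h.q_ne_zero (measurable_duhE hN).aemeasurable hfin
  obtain ⟨K', hK'⟩ := h.exists_heatE_le
  have h2 := (hK' (r - t) (by linarith) _ (measurable_duhE hN (r := t)).aemeasurable).2
  have e : heatE (r - t) (duhE t t fun τ => nonlin γ α (u τ)) =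
      duhE t r fun τ => nonlin γ α (u τ) := by
    ext x
    rw [heatE_duhE (by linarith) le_rfl hN, sub_add_cancel]
  rw [e] at h2
  refine ae_lt_top_of_wNormE h.one_le_d h.q_ne_zero (measurable_duhE hN).aemeasurable
    (lt_of_le_of_lt h2 ?_)
  finiteness

theorem wNorm_duh_sub_le (h : Admissible d γ α s' s q) {t r σ : ℝ} (ht : 0 ≤ t) (hr : t ≤ r)
    {M : ℝ≥0∞} (hM : M ≠ ⊤) {u v : ℝ → Sp d → 𝕜} (hu : KatoBdd q s ((s' - s) / 2) t M u)
    (hv : KatoBdd q s ((s' - s) / 2) t M v) :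
    wNorm q σ (fun x => duh t r (fun τ => nonlin γ α (u τ)) x -
        duh t r (fun τ => nonlin γ α (v τ)) x) ≤
      wNormE q σ (duhE t r (fun τ x => nonlin γ α (u τ) x - nonlin γ α (v τ) x)) := by
  rw [wNorm_eq_wNormE]
  refine wNormE_mono ?_
  filter_upwards [h.duhE_nonlin_lt_top ht hr hM hu, h.duhE_nonlin_lt_top ht hr hM hv] with x h1 h2
  rw [← duh_sub ht hr hu.meas.nonlin hv.meas.nonlin h1 h2]
  exact enorm_duh_le ht hr _ x

/-- **Uniqueness in the Kato space.** The Kato norm of the difference with the weight `e^{-lt}`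
is at most half of itself when `l` is large. -/
theorem ae_eq_of_solves (h : Admissible d γ α s' s q) {T : ℝ} {u₀ : Sp d → 𝕜}
    {u v : ℝ → Sp d → 𝕜} (hu : IsKato q s' s T u) (hv : IsKato q s' s T v)
    (hue : SolvesIntegralEq γ α T u₀ u) (hve : SolvesIntegralEq γ α T u₀ v) {t : ℝ}
    (ht : t ∈ Icc 0 T) : u t =ᵐ[volume] v t := by
  have hα1 : 0 ≤ α - 1 := by linarith [h.one_lt_alpha]
  -- it suffices to treat `t < T`
  suffices H : ∀ t ∈ Ioo 0 T, u t =ᵐ[volume] v t by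
    have e : duh t t (fun τ => nonlin γ α (u τ)) = duh t t (fun τ => nonlin γ α (v τ)) := by
      refine duh_congr ht.1 le_rfl ?_
      filter_upwards [ae_restrict_mem measurableSet_Ioo] with τ hτ
      exact nonlin_congr (H τ ⟨hτ.1, hτ.2.trans_le ht.2⟩)
    filter_upwards [hue.ae_eq ht, hve.ae_eq ht] with x h1 h2
    rw [h1, h2, e]
  intro T' hT'
  have hku := hu.2.2 T' hT'
  have hkv := hv.2.2 T' hT'
  set M := max (katoNorm q s' s T' u) (katoNorm q s' s T' v) with hM
  have hMt : M ≠ ⊤ := (max_lt hku hkv).ne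
  have hub : KatoBdd q s ((s' - s) / 2) T' M u :=
    (katoBdd_of_katoNorm (hu.sliceMeas.mono hT'.2.le) le_rfl).mono_right (le_max_left _ _)
  have hvb : KatoBdd q s ((s' - s) / 2) T' M v :=
    (katoBdd_of_katoNorm (hv.sliceMeas.mono hT'.2.le) le_rfl).mono_right (le_max_right _ _)
  have hα0 : 0 < ENNReal.ofReal (1 + α) := by rw [ENNReal.ofReal_pos]; linarith
  obtain ⟨K, ε, hε0, hεδ, hK⟩ := h.exists_duhE_exp_le 𝕜
  set w : ℝ → Sp d → 𝕜 := fun τ x => u τ x - v τ x with hw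
  -- the weighted norm of the difference
  let S : ℝ → ℝ≥0∞ := fun l => ⨆ t ∈ Ioc 0 T',
    ENNReal.ofReal (t ^ ((s' - s) / 2) * Real.exp (-(l * t))) * wNorm q s (w t)
  have hSle : ∀ l, ∀ τ ∈ Ioc 0 T', wNorm q s (w τ) ≤
      S l * ENNReal.ofReal (Real.exp (l * τ)) * ENNReal.ofReal (τ ^ (-((s' - s) / 2))) := by
    intro l τ hτ
    have h1 : ENNReal.ofReal (τ ^ ((s' - s) / 2) * Real.exp (-(l * τ))) * wNorm q s (w τ) ≤ S l :=
      le_iSup₂ (f := fun t (_ : t ∈ Ioc 0 T') =>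
        ENNReal.ofReal (t ^ ((s' - s) / 2) * Real.exp (-(l * t))) * wNorm q s (w t)) τ hτ
    have hτ0 : 0 < τ := hτ.1
    have e : ENNReal.ofReal (τ ^ ((s' - s) / 2) * Real.exp (-(l * τ))) *
        (ENNReal.ofReal (Real.exp (l * τ)) * ENNReal.ofReal (τ ^ (-((s' - s) / 2)))) = 1 := by
      rw [← ENNReal.ofReal_mul (by positivity), ← ENNReal.ofReal_mul (by positivity),
        Real.exp_neg, Real.rpow_neg hτ0.le, ← ENNReal.ofReal_one]
      congr 1
      field_simp
    calc wNorm q s (w τ) = (ENNReal.ofReal (τ ^ ((s' - s) / 2) * Real.exp (-(l * τ))) *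
        (ENNReal.ofReal (Real.exp (l * τ)) * ENNReal.ofReal (τ ^ (-((s' - s) / 2))))) *
          wNorm q s (w τ) := by rw [e, one_mul]
      _ = (ENNReal.ofReal (τ ^ ((s' - s) / 2) * Real.exp (-(l * τ))) * wNorm q s (w τ)) *
        ENNReal.ofReal (Real.exp (l * τ)) * ENNReal.ofReal (τ ^ (-((s' - s) / 2))) := by ring
      _ ≤ _ := by gcongr
  have hwm : ∀ τ ∈ Ioc 0 T', wNorm q s (w τ) ≤
      (M + M) * ENNReal.ofReal (τ ^ (-((s' - s) / 2))) := by
    intro τ hτ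
    have hτT : τ ∈ Ioo 0 T := ⟨hτ.1, hτ.2.trans_lt hT'.2⟩
    have h1 := wNorm_le_katoNorm (q := q) (s' := s') (s := s) u hτ.1 hτ.2
    have h2 := wNorm_le_katoNorm (q := q) (s' := s') (s := s) v hτ.1 hτ.2
    have h3 : wNorm q s (w τ) ≤ wNorm q s (u τ) + wNorm q s (v τ) := by
      rw [wNorm_eq_wNormE, wNorm_eq_wNormE, wNorm_eq_wNormE]
      refine le_trans (wNormE_mono (.of_forall fun x => enorm_sub_le)) ?_
      exact wNormE_add_le h.one_le_q (hu.2.1 τ hτT).enorm (hv.2.1 τ hτT).enorm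
    refine h3.trans ?_
    rw [add_mul]
    refine add_le_add (h1.trans ?_) (h2.trans ?_)
    · gcongr; exact le_max_left _ _
    · gcongr; exact le_max_right _ _
  have hSfin : ∀ l, 0 < l → S l ≠ ⊤ := by
    intro l hl
    refine ne_top_of_le_ne_top (by finiteness : M + M ≠ ⊤) (iSup₂_le fun τ hτ => ?_)
    have hτ0 : 0 < τ := hτ.1
    calc _ ≤ ENNReal.ofReal (τ ^ ((s' - s) / 2) * 1) *
          ((M + M) * ENNReal.ofReal (τ ^ (-((s' - s) / 2)))) := by
          gcongr
          · rw [Real.exp_le_one_iff]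
            have := mul_pos hl hτ0
            linarith
          · exact hwm τ hτ
      _ = (M + M) * (ENNReal.ofReal (τ ^ ((s' - s) / 2)) *
          ENNReal.ofReal (τ ^ (-((s' - s) / 2)))) := by rw [mul_one]; ring
      _ = M + M := by
          rw [← ENNReal.ofReal_mul (by positivity), ← Real.rpow_add hτ0]
          simp
  set C : ℝ≥0∞ := K * (2 * ENNReal.ofReal (1 + α) * M ^ (α - 1)) *
    ENNReal.ofReal (T' ^ (gain d γ α s' q - ε)) with hC
  have hCt : C ≠ ⊤ := by
    have : M ^ (α - 1) ≠ ⊤ := ENNReal.rpow_ne_top_of_nonneg hα1 hMt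
    finiteness
  have hcontr : ∀ l, 0 < l → S l ≤ C * ENNReal.ofReal (l ^ (-ε)) * S l := by
    intro l hl
    refine iSup₂_le fun t htt => ?_
    have ht0 : 0 < t := htt.1
    have htT : t ∈ Icc 0 T := ⟨ht0.le, htt.2.trans hT'.2.le⟩
    have hub' := hub.mono htt.2
    have hvb' := hvb.mono htt.2
    have h1 : wNorm q s (w t) ≤ wNormE q s (duhE t t
        (fun τ x => nonlin γ α (u τ) x - nonlin γ α (v τ) x)) := by
      refine le_trans (le_of_eq ?_) (h.wNorm_duh_sub_le ht0.le le_rfl hMt hub' hvb')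
      refine wNorm_congr ?_
      filter_upwards [hue.ae_eq htT, hve.ae_eq htT] with x h1 h2
      simp only [hw, h1, h2]
      abel
    have h2 := hK t ht0 _ (hub'.meas.nonlin.sub hvb'.meas.nonlin)
      (2 * ENNReal.ofReal (1 + α) * M ^ (α - 1) * S l) l hl (by
        filter_upwards [hub'.meas.aestronglyMeasurable_slice, hvb'.meas.aestronglyMeasurable_slice,
          ae_restrict_mem measurableSet_Ioo] with τ m1 m2 hτ
        refine (h.nonlin_sub_le m1 m2 hτ.1 (hub'.bound τ hτ) (hvb'.bound τ hτ)
          (hSle l τ ⟨hτ.1, hτ.2.le.trans htt.2⟩)).trans (le_of_eq ?_)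
        have hτ0 := hτ.1
        rw [ENNReal.ofReal_mul (by positivity)]
        ring)
    calc ENNReal.ofReal (t ^ ((s' - s) / 2) * Real.exp (-(l * t))) * wNorm q s (w t)
        ≤ ENNReal.ofReal (t ^ ((s' - s) / 2) * Real.exp (-(l * t))) *
          (K * (2 * ENNReal.ofReal (1 + α) * M ^ (α - 1) * S l) * ENNReal.ofReal
            (l ^ (-ε) * Real.exp (l * t) * t ^ (gain d γ α s' q - ε - (s' - s) / 2))) := by
          gcongr
          exact h1.trans h2
      _ = (K * (2 * ENNReal.ofReal (1 + α) * M ^ (α - 1) * S l)) *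
          (ENNReal.ofReal (t ^ ((s' - s) / 2) * Real.exp (-(l * t))) * ENNReal.ofReal
            (l ^ (-ε) * Real.exp (l * t) * t ^ (gain d γ α s' q - ε - (s' - s) / 2))) := by ring
      _ = (K * (2 * ENNReal.ofReal (1 + α) * M ^ (α - 1) * S l)) *
          ENNReal.ofReal (t ^ (gain d γ α s' q - ε) * l ^ (-ε)) := by
          congr 1
          rw [← ENNReal.ofReal_mul (by positivity)]
          congr 1
          have e1 : gain d γ α s' q - ε = (s' - s) / 2 + (gain d γ α s' q - ε - (s' - s) / 2) := by
            ring
          have e2 : Real.exp (-(l * t)) * Real.exp (l * t) = 1 := by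
            rw [← Real.exp_add]; simp
          rw [e1, Real.rpow_add ht0, ← e1]
          linear_combination (t ^ ((s' - s) / 2) * l ^ (-ε) *
            t ^ (gain d γ α s' q - ε - (s' - s) / 2)) * e2
      _ ≤ (K * (2 * ENNReal.ofReal (1 + α) * M ^ (α - 1) * S l)) *
          ENNReal.ofReal (T' ^ (gain d γ α s' q - ε) * l ^ (-ε)) := by
          gcongr
          exact htt.2
      _ = _ := by
          have hT0 : 0 < T' := hT'.1
          rw [ENNReal.ofReal_mul (by positivity), hC]
          ring
  -- choose `l` with `C l^{-ε} < 1`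
  obtain ⟨l, hl0, hl⟩ : ∃ l : ℝ, 0 < l ∧ C * ENNReal.ofReal (l ^ (-ε)) < 1 := by
    have t1 : Tendsto (fun l : ℝ => C * ENNReal.ofReal (l ^ (-ε))) atTop (𝓝 (C * 0)) := by
      refine ENNReal.Tendsto.const_mul ?_ (.inr hCt)
      have := ENNReal.tendsto_ofReal (tendsto_rpow_neg_atTop hε0)
      simpa using this
    rw [mul_zero] at t1
    obtain ⟨l, h1, h2⟩ := ((t1.eventually (gt_mem_nhds zero_lt_one)).and
      (eventually_gt_atTop (0 : ℝ))).exists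
    exact ⟨l, h2, h1⟩
  have hS0 : S l = 0 := by
    by_contra hne
    have h1 := hcontr l hl0
    have h2 : C * ENNReal.ofReal (l ^ (-ε)) * S l < 1 * S l :=
      ENNReal.mul_lt_mul_left hne (hSfin l hl0) hl
    rw [one_mul] at h2
    exact absurd h1 (not_le.2 h2)
  have hw0 : wNorm q s (w T') = 0 := by
    have := hSle l T' ⟨hT'.1, le_rfl⟩
    rw [hS0] at this
    simpa using this
  have hwmeas : AEStronglyMeasurable (w T') volume := (hu.2.1 T' hT').sub (hv.2.1 T' hT')
  filter_upwards [ae_eq_zero_of_wNorm h.one_le_d h.q_ne_zero hwmeas hw0] with x hx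
  exact sub_eq_zero.1 hx

end Admissible

/-! ### Strong continuity of the heat semigroup -/

theorem wNorm_add_le {q : ℝ≥0∞} (hq : 1 ≤ q) {s : ℝ} {f g : Sp d → 𝕜}
    (hf : AEStronglyMeasurable f volume) (hg : AEStronglyMeasurable g volume) :
    wNorm q s (fun x => f x + g x) ≤ wNorm q s f + wNorm q s g := by
  simp only [wNorm_eq_wNormE]
  exact (wNormE_mono (.of_forall fun x => enorm_add_le _ _)).trans
    (wNormE_add_le hq hf.enorm hg.enorm)

theorem wNorm_sub_le_add {q : ℝ≥0∞} (hq : 1 ≤ q) {s : ℝ} {f g h : Sp d → 𝕜}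
    (hf : AEStronglyMeasurable f volume) (hg : AEStronglyMeasurable g volume)
    (hh : AEStronglyMeasurable h volume) :
    wNorm q s (fun x => f x - h x) ≤
      wNorm q s (fun x => f x - g x) + wNorm q s (fun x => g x - h x) := by
  refine le_trans (le_of_eq ?_) (wNorm_add_le hq (hf.sub hg) (hg.sub hh))
  congr 1
  ext x
  abel

theorem wNorm_sub_le {q : ℝ≥0∞} (hq : 1 ≤ q) {s : ℝ} {f g : Sp d → 𝕜}
    (hf : AEStronglyMeasurable f volume) (hg : AEStronglyMeasurable g volume) :
    wNorm q s (fun x => f x - g x) ≤ wNorm q s f + wNorm q s g := by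
  simp only [wNorm_eq_wNormE]
  exact (wNormE_mono (.of_forall fun x => enorm_sub_le)).trans
    (wNormE_add_le hq hf.enorm hg.enorm)

theorem wNorm_sub_comm {q : ℝ≥0∞} {s : ℝ} (f g : Sp d → 𝕜) :
    wNorm q s (fun x => f x - g x) = wNorm q s (fun x => g x - f x) := by
  simp only [wNorm, norm_sub_rev]

theorem lintegral_heatKernel {t : ℝ} (ht : 0 < t) (x : Sp d) :
    ∫⁻ y, ENNReal.ofReal (heatKernel d t (x - y)) = 1 := by
  rw [lintegral_sub_left_eq_self (fun y => ENNReal.ofReal (heatKernel d t y))]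
  have hb : 0 < (4 * t)⁻¹ := by positivity
  have hI := GaussianFourier.integral_rexp_neg_mul_sq_norm (V := Sp d) hb
  have hint : Integrable (fun v : Sp d => Real.exp (-(4 * t)⁻¹ * ‖v‖ ^ 2)) := by
    by_contra h
    rw [integral_undef h] at hI
    have : 0 < (Real.pi / (4 * t)⁻¹) ^ ((Module.finrank ℝ (Sp d) : ℝ) / 2) := by positivity
    exact this.ne hI
  have e : ∀ y : Sp d, heatKernel d t y =
      (4 * Real.pi * t) ^ (-(d : ℝ) / 2) * Real.exp (-(4 * t)⁻¹ * ‖y‖ ^ 2) := by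
    intro y
    unfold heatKernel
    congr 2
    field_simp
  simp_rw [e]
  rw [← ofReal_integral_eq_lintegral_ofReal (hint.const_mul _)
    (.of_forall fun _ => by positivity), integral_const_mul, hI, finrank_Sp, div_inv_eq_mul,
    show Real.pi * (4 * t) = 4 * Real.pi * t by ring, ← Real.rpow_add (by positivity)]
  have : -(d : ℝ) / 2 + (d : ℝ) / 2 = 0 := by ring
  rw [this]
  simp

theorem integrable_heatKernel {t : ℝ} (ht : 0 < t) (x : Sp d) :
    Integrable (fun y => heatKernel d t (x - y)) := by
  refine ⟨(measurable_heatKernel_const_sub t x).aestronglyMeasurable, ?_⟩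
  refine lt_of_le_of_lt (le_of_eq ?_) ENNReal.one_lt_top
  rw [← lintegral_heatKernel ht x]
  exact lintegral_congr fun y => Real.enorm_eq_ofReal (heatKernel_nonneg ht.le _)

theorem integral_heatKernel {t : ℝ} (ht : 0 < t) (x : Sp d) :
    ∫ y, heatKernel d t (x - y) = 1 := by
  rw [integral_eq_lintegral_of_nonneg_ae (.of_forall fun y => heatKernel_nonneg ht.le _)
    (measurable_heatKernel_const_sub t x).aestronglyMeasurable, lintegral_heatKernel ht]
  rfl

/-- Outside a ball of radius `η` the kernel is exponentially small as `t → 0`, relatively to the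
kernel at time `2t`. -/
theorem heatKernel_le_of_le_norm {t η : ℝ} (ht : 0 < t) (hη : 0 ≤ η) {z : Sp d} (hz : η ≤ ‖z‖) :
    heatKernel d t z ≤
      Real.exp (-η ^ 2 / (8 * t)) * 2 ^ ((d : ℝ) / 2) * heatKernel d (2 * t) z := by
  rw [mul_assoc, ← two_rpow_mul_heatKernel ht]
  unfold heatKernel
  have h2 : Real.exp (-‖z‖ ^ 2 / (4 * t)) ≤
      Real.exp (-η ^ 2 / (8 * t)) * Real.exp (-‖z‖ ^ 2 / (8 * t)) := by
    rw [← Real.exp_add]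
    refine Real.exp_le_exp.2 ?_
    have e : -η ^ 2 / (8 * t) + -‖z‖ ^ 2 / (8 * t) - -‖z‖ ^ 2 / (4 * t) =
      (‖z‖ ^ 2 - η ^ 2) / (8 * t) := by field_simp; ring
    have : 0 ≤ (‖z‖ ^ 2 - η ^ 2) / (8 * t) := by
      apply div_nonneg _ (by positivity)
      nlinarith
    linarith
  calc _ ≤ (4 * Real.pi * t) ^ (-(d : ℝ) / 2) *
        (Real.exp (-η ^ 2 / (8 * t)) * Real.exp (-‖z‖ ^ 2 / (8 * t))) := by gcongr
    _ = _ := by ring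

/-- Balls have finite weighted norm. -/
theorem wNormE_indicator_closedBall_lt_top (hd : 1 ≤ d) {q : ℝ≥0∞} (hq : q ≠ 0) {s R : ℝ}
    (hs : -(d : ℝ) * invExp q < s) :
    wNormE q s ((Metric.closedBall (0 : Sp d) R).indicator 1) < ⊤ := by
  have h1 := eLpNorm_rpow_norm_mul_gaussian_lt_top hd hq (σ := s) (c := 1) one_pos (.inl hs)
  have h2 : wNormE q s ((Metric.closedBall (0 : Sp d) R).indicator 1) ≤
      eLpNorm (fun x : Sp d => ENNReal.ofReal (Real.exp (R ^ 2)) *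
        ENNReal.ofReal (‖x‖ ^ s * Real.exp (-1 * ‖x‖ ^ 2))) q volume := by
    refine eLpNorm_mono_enorm fun x => ?_
    simp only [enorm_eq_self]
    by_cases hx : x ∈ Metric.closedBall (0 : Sp d) R
    · rw [indicator_of_mem hx, ← ENNReal.ofReal_mul (by positivity)]
      simp only [Pi.one_apply, mul_one]
      refine ENNReal.ofReal_le_ofReal ?_
      have hx' : ‖x‖ ≤ R := by simpa using hx
      have : 1 ≤ Real.exp (R ^ 2) * Real.exp (-1 * ‖x‖ ^ 2) := by
        rw [← Real.exp_add]
        refine Real.one_le_exp ?_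
        nlinarith [norm_nonneg x]
      calc ‖x‖ ^ s = ‖x‖ ^ s * 1 := (mul_one _).symm
        _ ≤ ‖x‖ ^ s * (Real.exp (R ^ 2) * Real.exp (-1 * ‖x‖ ^ 2)) := by gcongr
        _ = _ := by ring
    · rw [indicator_of_notMem hx]; simp
  refine lt_of_le_of_lt (h2.trans (eLpNorm_const_mul_le (by simp))) ?_
  finiteness

theorem exists_forall_norm_le_of_hasCompactSupport {φ : Sp d → 𝕜} (hc : Continuous φ)
    (hs : HasCompactSupport φ) : ∃ R : ℝ, ∃ C : ℝ, 0 ≤ R ∧ 0 ≤ C ∧ (∀ x, ‖φ x‖ ≤ C) ∧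
      ∀ x, R < ‖x‖ → φ x = 0 := by
  obtain ⟨C, hC⟩ := hs.exists_bound_of_continuous hc
  obtain ⟨R, hR⟩ := hs.isCompact.isBounded.subset_closedBall (0 : Sp d)
  refine ⟨max R 0, C, le_max_right _ _, (norm_nonneg _).trans (hC 0), hC, fun x hx => ?_⟩
  by_contra h
  have := hR (subset_tsupport _ h)
  simp only [Metric.mem_closedBall, dist_zero_right] at this
  exact absurd (this.trans (le_max_left _ _)) (not_le.2 hx)

theorem wNorm_le_of_bounded {q : ℝ≥0∞} {s : ℝ}
    {φ : Sp d → 𝕜} {R C : ℝ} (hC : ∀ x, ‖φ x‖ ≤ C)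
    (hR : ∀ x, R < ‖x‖ → φ x = 0) :
    wNorm q s φ ≤ ENNReal.ofReal C *
      wNormE q s ((Metric.closedBall (0 : Sp d) R).indicator 1) := by
  rw [wNorm_eq_wNormE]
  refine (wNormE_mono (.of_forall fun x => ?_)).trans (wNormE_const_mul_le (by simp))
  by_cases hx : x ∈ Metric.closedBall (0 : Sp d) R
  · rw [indicator_of_mem hx, Pi.one_apply, mul_one, ← ofReal_norm]
    exact ENNReal.ofReal_le_ofReal (hC x)
  · have : φ x = 0 := hR x (by simpa using hx)
    simp [this]

theorem enorm_heat_sub_self_le {t η ε R : ℝ} (ht : 0 < t) (hη : 0 ≤ η) (hη1 : η ≤ 1)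
    {φ : Sp d → 𝕜} (hc : Continuous φ) (hs : HasCompactSupport φ)
    (hR : ∀ x, R < ‖x‖ → φ x = 0) (hu : ∀ x y, ‖x - y‖ ≤ η → ‖φ y - φ x‖ ≤ ε) (x : Sp d) :
    ‖heat t φ x - φ x‖ₑ ≤
      ENNReal.ofReal ε * (Metric.closedBall (0 : Sp d) (R + 1)).indicator 1 x +
      ENNReal.ofReal (Real.exp (-η ^ 2 / (8 * t)) * 2 ^ ((d : ℝ) / 2)) *
        (heatE (2 * t) (fun y => ‖φ y‖ₑ) x + ‖φ x‖ₑ) := by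
  obtain ⟨C, hC⟩ := hs.exists_bound_of_continuous hc
  have i1 : Integrable (fun y => heatKernel d t (x - y) • φ y) :=
    (integrable_heatKernel ht x).smul_bdd C hc.aestronglyMeasurable (.of_forall hC)
  have e1 : heat t φ x - φ x = ∫ y, heatKernel d t (x - y) • (φ y - φ x) := by
    have e2 : φ x = ∫ y, heatKernel d t (x - y) • φ x := by
      rw [integral_smul_const, integral_heatKernel ht, one_smul]
    simp only [heat, if_neg ht.ne']
    conv_lhs => rw [e2]
    rw [← integral_sub i1 ((integrable_heatKernel ht x).smul_const _)]
    simp_rw [smul_sub]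
  rw [e1]
  refine (enorm_integral_le_lintegral_enorm _).trans ?_
  set I := (Metric.closedBall (0 : Sp d) (R + 1)).indicator (1 : Sp d → ℝ≥0∞) x with hI
  set c := ENNReal.ofReal (Real.exp (-η ^ 2 / (8 * t)) * 2 ^ ((d : ℝ) / 2)) with hcdef
  have pt : ∀ y, ‖heatKernel d t (x - y) • (φ y - φ x)‖ₑ ≤
      (ENNReal.ofReal ε * I) * ENNReal.ofReal (heatKernel d t (x - y)) +
      c * (ENNReal.ofReal (heatKernel d (2 * t) (x - y)) * ‖φ y‖ₑ +
        ENNReal.ofReal (heatKernel d (2 * t) (x - y)) * ‖φ x‖ₑ) := by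
    intro y
    rw [enorm_smul, Real.enorm_eq_ofReal (heatKernel_nonneg ht.le _)]
    by_cases hxy : ‖x - y‖ ≤ η
    · refine le_trans ?_ le_self_add
      rw [mul_comm]
      gcongr
      by_cases hx : ‖x‖ ≤ R + 1
      · have : I = 1 := by rw [hI, indicator_of_mem (by simpa using hx)]; rfl
        rw [this, mul_one, ← ofReal_norm]
        exact ENNReal.ofReal_le_ofReal (hu x y hxy)
      · have h1 : φ x = 0 := hR x (by linarith)
        have h2 : φ y = 0 := hR y (by
          have := norm_sub_norm_le x y
          linarith)
        simp [h1, h2]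
    · refine le_trans ?_ le_add_self
      have h1 := heatKernel_le_of_le_norm ht hη (le_of_not_ge hxy)
      calc _ ≤ (c * ENNReal.ofReal (heatKernel d (2 * t) (x - y))) * (‖φ y‖ₑ + ‖φ x‖ₑ) := by
            refine mul_le_mul' ?_ enorm_sub_le
            rw [hcdef, ← ENNReal.ofReal_mul (by positivity)]
            exact ENNReal.ofReal_le_ofReal h1
        _ = _ := by ring
  have m1 := (measurable_heatKernel_const_sub t x).ennreal_ofReal
  have m2 := (measurable_heatKernel_const_sub (2 * t) x).ennreal_ofReal
  have m3 : Measurable fun y => ‖φ y‖ₑ := hc.measurable.enorm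
  refine (lintegral_mono pt).trans (le_of_eq ?_)
  rw [lintegral_add_left (m1.const_mul _), lintegral_const_mul _ m1, lintegral_const_mul' _ _ (by simp [hcdef]),
    lintegral_add_right _ (m2.mul_const _), lintegral_mul_const _ m2, lintegral_heatKernel ht,
    lintegral_heatKernel (by positivity), mul_one, one_mul]
  rfl

namespace Admissible

variable {γ α s' s : ℝ} {q : ℝ≥0∞}

theorem lower' (h : Admissible d γ α s' s q) : -(d : ℝ) * invExp q < s' := h.lower.trans h.s_lt

theorem tendsto_heat_of_hasCompactSupport (h : Admissible d γ α s' s q) {φ : Sp d → 𝕜}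
    (hc : Continuous φ) (hs : HasCompactSupport φ) :
    Tendsto (fun t => wNorm q s' (fun x => heat t φ x - φ x)) (𝓝[>] 0) (𝓝 0) := by
  obtain ⟨R, C, hR0, hC0, hC, hR⟩ := exists_forall_norm_le_of_hasCompactSupport hc hs
  obtain ⟨K, hK⟩ := h.exists_heatE_le
  have hN : wNorm q s' φ ≠ ⊤ := by
    refine ne_top_of_le_ne_top ?_ (wNorm_le_of_bounded hC hR)
    have := wNormE_indicator_closedBall_lt_top h.one_le_d h.q_ne_zero h.lower' (R := R)
    finiteness
  have hW := wNormE_indicator_closedBall_lt_top h.one_le_d h.q_ne_zero h.lower' (R := R + 1)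
  set W := wNormE q s' ((Metric.closedBall (0 : Sp d) (R + 1)).indicator 1) with hWdef
  have hmI : Measurable ((Metric.closedBall (0 : Sp d) (R + 1)).indicator (1 : Sp d → ℝ≥0∞)) :=
    measurable_one.indicator measurableSet_closedBall
  rw [ENNReal.tendsto_nhds_zero]
  intro δ hδ
  -- the size of the uniform oscillation
  obtain ⟨ε, hε0, hε⟩ : ∃ ε : ℝ, 0 < ε ∧ ENNReal.ofReal ε * W ≤ δ / 2 := by
    have t1 : Tendsto (fun ε : ℝ => ENNReal.ofReal ε * W) (𝓝[>] 0) (𝓝 0) := by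
      have : Tendsto (fun ε : ℝ => ENNReal.ofReal ε * W) (𝓝 0) (𝓝 (ENNReal.ofReal 0 * W)) :=
        ENNReal.Tendsto.mul_const (ENNReal.continuous_ofReal.tendsto 0) (.inr hW.ne)
      rw [ENNReal.ofReal_zero, zero_mul] at this
      exact this.mono_left nhdsWithin_le_nhds
    obtain ⟨ε, h1, h2⟩ := ((ENNReal.tendsto_nhds_zero.1 t1 (δ / 2)
      (ENNReal.div_pos hδ.ne' (by simp))).and self_mem_nhdsWithin).exists
    exact ⟨ε, h2, h1⟩
  obtain ⟨η, hη0, hη1, hu⟩ : ∃ η : ℝ, 0 < η ∧ η ≤ 1 ∧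
      ∀ x y : Sp d, ‖x - y‖ ≤ η → ‖φ y - φ x‖ ≤ ε := by
    have huc := hs.uniformContinuous_of_continuous hc
    obtain ⟨η, hη, h2⟩ := Metric.uniformContinuous_iff.1 huc ε hε0
    refine ⟨min (η / 2) 1, by positivity, min_le_right _ _, fun x y hxy => ?_⟩
    have h3 : dist y x < η := by
      rw [dist_comm, dist_eq_norm]
      have : min (η / 2) 1 ≤ η / 2 := min_le_left _ _
      linarith
    have := h2 h3
    rw [dist_eq_norm] at this
    exact this.le
  have t2 : Tendsto (fun t : ℝ => ENNReal.ofReal (Real.exp (-η ^ 2 / (8 * t)) * 2 ^ ((d : ℝ) / 2)) *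
      (K * wNorm q s' φ + wNorm q s' φ)) (𝓝[>] 0) (𝓝 0) := by
    have t3 : Tendsto (fun t : ℝ => Real.exp (-η ^ 2 / (8 * t)) * 2 ^ ((d : ℝ) / 2)) (𝓝[>] 0)
        (𝓝 (0 * 2 ^ ((d : ℝ) / 2))) := by
      refine Tendsto.mul_const _ (Real.tendsto_exp_atBot.comp ?_)
      have : (fun t : ℝ => -η ^ 2 / (8 * t)) = fun t => (-η ^ 2 / 8) * t⁻¹ := by
        ext t
        rw [div_mul_eq_div_div, div_eq_mul_inv]
      rw [this]
      exact tendsto_inv_nhdsGT_zero.const_mul_atTop_of_neg (by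
        have : 0 < η ^ 2 := by positivity
        linarith)
    rw [zero_mul] at t3
    have t4 := ENNReal.Tendsto.mul_const (b := K * wNorm q s' φ + wNorm q s' φ)
      (ENNReal.tendsto_ofReal t3) (.inr (by finiteness))
    simpa using t4
  filter_upwards [ENNReal.tendsto_nhds_zero.1 t2 (δ / 2) (ENNReal.div_pos hδ.ne' (by simp)),
    self_mem_nhdsWithin] with t h2 ht
  have ht0 : (0 : ℝ) < t := ht
  have m2 : AEMeasurable (fun y => ‖φ y‖ₑ) volume := hc.measurable.enorm.aemeasurable
  have m3 : Measurable (heatE (2 * t) (fun y => ‖φ y‖ₑ)) := by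
    refine measurable_heatE (θ := fun _ => 2 * t) measurable_const measurable_id
      (f := fun _ y => ‖φ y‖ₑ) ?_
    exact hc.measurable.enorm.comp measurable_snd
  calc wNorm q s' (fun x => heat t φ x - φ x)
      ≤ wNormE q s' (fun x =>
          ENNReal.ofReal ε * (Metric.closedBall (0 : Sp d) (R + 1)).indicator 1 x +
          ENNReal.ofReal (Real.exp (-η ^ 2 / (8 * t)) * 2 ^ ((d : ℝ) / 2)) *
            (heatE (2 * t) (fun y => ‖φ y‖ₑ) x + ‖φ x‖ₑ)) := by
        rw [wNorm_eq_wNormE]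
        exact wNormE_mono (.of_forall fun x =>
          enorm_heat_sub_self_le ht0 hη0.le hη1 hc hs hR hu x)
    _ ≤ ENNReal.ofReal ε * W +
          ENNReal.ofReal (Real.exp (-η ^ 2 / (8 * t)) * 2 ^ ((d : ℝ) / 2)) *
            (K * wNorm q s' φ + wNorm q s' φ) := by
        refine (wNormE_add_le h.one_le_q (hmI.const_mul _).aemeasurable
          ((m3.aemeasurable.add m2).const_mul _)).trans (add_le_add ?_ ?_)
        · exact wNormE_const_mul_le (by simp)
        · refine (wNormE_const_mul_le (by simp)).trans (mul_le_mul_right ?_ _)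
          refine (wNormE_add_le h.one_le_q m3.aemeasurable m2).trans ?_
          rw [wNorm_eq_wNormE]
          exact add_le_add (hK (2 * t) (by positivity) _ m2).2 le_rfl
    _ ≤ δ / 2 + δ / 2 := add_le_add hε h2
    _ = δ := ENNReal.add_halves δ

theorem ae_heatE_lt_top (h : Admissible d γ α s' s q) {t : ℝ} (ht : 0 < t) {f : Sp d → 𝕜}
    (hf : MemW q s' f) :
    ∀ᵐ x ∂(volume : Measure (Sp d)), heatE t (fun y => ‖f y‖ₑ) x < ⊤ := by
  obtain ⟨K, hK⟩ := h.exists_heatE_le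
  have h2 := (hK t ht _ hf.1.enorm).2
  have hm : AEMeasurable (heatE t (fun y => ‖f y‖ₑ)) := by
    rw [heatE_congr hf.1.enorm.ae_eq_mk]
    exact (measurable_heatE (θ := fun _ => t) measurable_const measurable_id
      (f := fun _ => hf.1.enorm.mk _)
      (hf.1.enorm.measurable_mk.comp measurable_snd)).aemeasurable
  refine ae_lt_top_of_wNormE h.one_le_d h.q_ne_zero hm (lt_of_le_of_lt h2 ?_)
  rw [← wNorm_eq_wNormE]
  have := hf.2
  finiteness

/-- The heat semigroup is Lipschitz in `L^q_{s̃}`, uniformly in time. -/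
theorem exists_wNorm_heat_sub_le (𝕜 : Type*) [RCLike 𝕜] (h : Admissible d γ α s' s q) :
    ∃ K : ℝ≥0, ∀ t : ℝ, 0 ≤ t → ∀ f g : Sp d → 𝕜, MemW q s' f → MemW q s' g →
      wNorm q s' (fun x => heat t f x - heat t g x) ≤ K * wNorm q s' (fun x => f x - g x) ∧
      (0 < t → wNorm q s (fun x => heat t f x - heat t g x) ≤
        K * wNorm q s' (fun x => f x - g x) * ENNReal.ofReal (t ^ (-((s' - s) / 2)))) := by
  obtain ⟨K, hK⟩ := h.exists_heatE_le
  refine ⟨max K 1, fun t ht f g hf hg => ?_⟩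
  rcases ht.eq_or_lt with rfl | ht0
  · refine ⟨?_, fun h => absurd h (lt_irrefl _)⟩
    simp only [heat_zero]
    calc _ = 1 * wNorm q s' (fun x => f x - g x) := (one_mul _).symm
      _ ≤ _ := by
        gcongr
        exact_mod_cast le_max_right K 1
  have hfin : ∀ f : Sp d → 𝕜, MemW q s' f →
      ∀ᵐ x ∂(volume : Measure (Sp d)), heatE t (fun y => ‖f y‖ₑ) x < ⊤ :=
    fun f hf => h.ae_heatE_lt_top ht0 hf
  have hle : ∀ σ : ℝ, wNorm q σ (fun x => heat t f x - heat t g x) ≤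
      wNormE q σ (heatE t (fun y => ‖f y - g y‖ₑ)) := by
    intro σ
    rw [wNorm_eq_wNormE]
    refine wNormE_mono ?_
    filter_upwards [hfin f hf, hfin g hg] with x h1 h2
    rw [← heat_sub ht0 hf.1 hg.1 h1 h2]
    exact enorm_heat_le ht0 _ _
  have hK' := hK t ht0 (fun y => ‖f y - g y‖ₑ) (hf.1.sub hg.1).enorm
  have hmax : (K : ℝ≥0∞) ≤ (max K 1 : ℝ≥0) := by exact_mod_cast le_max_left K 1
  refine ⟨(hle s').trans (hK'.2.trans ?_), fun _ => (hle s).trans (hK'.1.trans ?_)⟩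
  · rw [wNorm_eq_wNormE]
    gcongr
  · rw [wNorm_eq_wNormE, mul_right_comm]
    gcongr

theorem exists_continuous_approx (h : Admissible d γ α s' s q) {f : Sp d → 𝕜}
    (hf : IsDatum q s' f) {ε : ℝ≥0∞} (hε : 0 < ε) :
    ∃ φ : Sp d → 𝕜, Continuous φ ∧ HasCompactSupport φ ∧ wNorm q s' (fun x => f x - φ x) ≤ ε := by
  rcases eq_or_ne q ⊤ with hq | hqt
  · obtain ⟨φ, h1, h2, h3⟩ := (hf.2 hq).2 ε hε
    exact ⟨φ, h1.continuous, h2, h3.le⟩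
  have hr := ENNReal.toReal_pos h.q_ne_zero hqt
  -- `L^q_{s̃}` is the Lebesgue space of the measure with density `|x|^{s̃q}`
  let w : Sp d → ℝ≥0∞ := fun x => ENNReal.ofReal (‖x‖ ^ s') ^ q.toReal
  have hw : Measurable w := (measurable_weight s').pow_const _
  let μ : Measure (Sp d) := volume.withDensity w
  have hμ : ∀ g : Sp d → 𝕜, AEStronglyMeasurable g volume →
      eLpNorm g q μ = wNorm q s' g := by
    intro g hg
    rw [wNorm_eq_wNormE, wNormE, eLpNorm_eq_lintegral_rpow_enorm_toReal h.q_ne_zero hqt,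
      eLpNorm_eq_lintegral_rpow_enorm_toReal h.q_ne_zero hqt,
      lintegral_withDensity_eq_lintegral_mul₀ hw.aemeasurable (hg.enorm.pow_const _)]
    congr 1
    refine lintegral_congr fun x => ?_
    simp only [Pi.mul_apply, enorm_eq_self, w]
    rw [ENNReal.mul_rpow_of_nonneg _ _ hr.le]
  have hfin : IsFiniteMeasureOnCompacts μ := by
    refine ⟨fun k hk => ?_⟩
    obtain ⟨R, hR⟩ := hk.isBounded.subset_closedBall (0 : Sp d)
    refine lt_of_le_of_lt (measure_mono hR) ?_
    have h1 := wNormE_indicator_closedBall_lt_top h.one_le_d h.q_ne_zero h.lower' (R := R)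
    have h2 := lintegral_rpow_enorm_lt_top_of_eLpNorm_lt_top h.q_ne_zero hqt h1
    rw [withDensity_apply _ measurableSet_closedBall, ← lintegral_indicator measurableSet_closedBall]
    refine lt_of_le_of_lt (lintegral_mono fun x => ?_) h2
    by_cases hx : x ∈ Metric.closedBall (0 : Sp d) R
    · simp [indicator_of_mem hx, w]
    · simp [indicator_of_notMem hx]
  have hmem : MemLp f q μ :=
    ⟨hf.1.1.mono_ac (withDensity_absolutelyContinuous _ _), by rw [hμ f hf.1.1]; exact hf.1.2⟩
  obtain ⟨φ, h1, h2, h3, -⟩ := hmem.exists_hasCompactSupport_eLpNorm_sub_le hqt hε.ne'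
  refine ⟨φ, h3, h1, ?_⟩
  rw [hμ _ (hf.1.1.sub h3.aestronglyMeasurable)] at h2
  exact h2

theorem memW_of_hasCompactSupport (h : Admissible d γ α s' s q) {φ : Sp d → 𝕜}
    (hc : Continuous φ) (hs : HasCompactSupport φ) : MemW q s' φ := by
  obtain ⟨R, C, -, -, hC, hR⟩ := exists_forall_norm_le_of_hasCompactSupport hc hs
  refine ⟨hc.aestronglyMeasurable, lt_of_le_of_lt
    (wNorm_le_of_bounded hC hR) ?_⟩
  have := wNormE_indicator_closedBall_lt_top h.one_le_d h.q_ne_zero h.lower' (R := R)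
  finiteness

/-- Strong continuity of the heat semigroup at `t = 0` on the space of data. -/
theorem tendsto_heat_zero (h : Admissible d γ α s' s q) {f : Sp d → 𝕜} (hf : IsDatum q s' f) :
    Tendsto (fun t => wNorm q s' (fun x => heat t f x - f x)) (𝓝[≥] 0) (𝓝 0) := by
  obtain ⟨K, hK⟩ := h.exists_wNorm_heat_sub_le 𝕜
  rw [ENNReal.tendsto_nhds_zero]
  intro δ hδ
  obtain ⟨ε, hε0, hε⟩ : ∃ ε : ℝ≥0∞, 0 < ε ∧ K * ε + ε ≤ δ / 2 := by
    have t1 : Tendsto (fun ε : ℝ≥0∞ => K * ε + ε) (𝓝[>] 0) (𝓝 0) := by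
      have : Tendsto (fun ε : ℝ≥0∞ => K * ε + ε) (𝓝 0) (𝓝 (K * 0 + 0)) :=
        (ENNReal.Tendsto.const_mul tendsto_id (.inr (by simp))).add tendsto_id
      rw [mul_zero, add_zero] at this
      exact this.mono_left nhdsWithin_le_nhds
    obtain ⟨ε, h1, h2⟩ := ((ENNReal.tendsto_nhds_zero.1 t1 (δ / 2)
      (ENNReal.div_pos hδ.ne' (by simp))).and self_mem_nhdsWithin).exists
    exact ⟨ε, h2, h1⟩
  obtain ⟨φ, hc, hs, hφ⟩ := h.exists_continuous_approx hf hε0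
  have hφm := h.memW_of_hasCompactSupport hc hs
  have t2 := ENNReal.tendsto_nhds_zero.1 (h.tendsto_heat_of_hasCompactSupport hc hs) (δ / 2)
    (ENNReal.div_pos hδ.ne' (by simp))
  rw [eventually_nhdsWithin_iff] at t2 ⊢
  filter_upwards [t2] with t h2 ht
  rcases (show (0 : ℝ) ≤ t from ht).eq_or_lt with rfl | ht0
  · simp [heat_zero, wNorm]
  have m1 : AEStronglyMeasurable (heat t f) volume := aestronglyMeasurable_heat hf.1.1
  have m2 : AEStronglyMeasurable (heat t φ) volume := aestronglyMeasurable_heat hφm.1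
  calc wNorm q s' (fun x => heat t f x - f x)
      ≤ wNorm q s' (fun x => heat t f x - heat t φ x) + (wNorm q s' (fun x => heat t φ x - φ x) +
          wNorm q s' (fun x => φ x - f x)) :=
        (wNorm_sub_le_add h.one_le_q m1 m2 hf.1.1).trans
          (add_le_add le_rfl (wNorm_sub_le_add h.one_le_q m2 hφm.1 hf.1.1))
    _ ≤ K * ε + (δ / 2 + ε) := by
        refine add_le_add ((hK t ht0.le f φ hf.1 hφm).1.trans (by gcongr)) (add_le_add (h2 ht0) ?_)
        rw [wNorm_sub_comm]
        exact hφ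
    _ = (K * ε + ε) + δ / 2 := by ring
    _ ≤ δ / 2 + δ / 2 := by gcongr
    _ = δ := ENNReal.add_halves δ

end Admissible

/-! ### The space of data for `q = ∞` -/

theorem wNorm_top_le {s C : ℝ} {f : Sp d → 𝕜}
    (h : ∀ᵐ x ∂(volume : Measure (Sp d)), ‖x‖ ^ s * ‖f x‖ ≤ C) :
    wNorm ⊤ s f ≤ ENNReal.ofReal C := by
  rw [wNorm, eLpNorm_exponent_top]
  refine eLpNormEssSup_le_of_ae_bound ?_
  filter_upwards [h] with x hx
  rwa [Real.norm_of_nonneg (by positivity)]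

theorem ae_le_of_wNorm_top {s : ℝ} {f : Sp d → 𝕜} (h : wNorm ⊤ s f < ⊤) :
    ∀ᵐ x ∂(volume : Measure (Sp d)), ‖x‖ ^ s * ‖f x‖ ≤ (wNorm ⊤ s f).toReal := by
  rw [wNorm, eLpNorm_exponent_top] at h
  filter_upwards [ae_le_eLpNormEssSup (f := fun x : Sp d => ‖x‖ ^ s * ‖f x‖)
    (μ := (volume : Measure (Sp d)))] with x hx
  have := ENNReal.toReal_mono h.ne hx
  rw [toReal_enorm, Real.norm_of_nonneg (by positivity)] at this
  rwa [wNorm, eLpNorm_exponent_top]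

/-- The closure of the test functions is closed. -/
theorem MemWClosure.of_approx {q : ℝ≥0∞} (hq : 1 ≤ q) {s : ℝ} {f : Sp d → 𝕜} (hf : MemW q s f)
    (h : ∀ ε : ℝ≥0∞, 0 < ε → ∃ g : Sp d → 𝕜, MemWClosure q s g ∧
      wNorm q s (fun x => f x - g x) ≤ ε) : MemWClosure q s f := by
  refine ⟨hf, fun ε hε => ?_⟩
  rcases eq_or_ne ε ⊤ with rfl | hεt
  · exact ⟨0, contDiff_const, HasCompactSupport.zero, by simpa using hf.2⟩
  have hε2 : 0 < ε / 2 := ENNReal.div_pos hε.ne' (by simp)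
  obtain ⟨g, hg, hfg⟩ := h (ε / 2) hε2
  obtain ⟨φ, h1, h2, h3⟩ := hg.2 (ε / 2) hε2
  refine ⟨φ, h1, h2, lt_of_le_of_lt
    (wNorm_sub_le_add hq hf.1 hg.1.1 h1.continuous.aestronglyMeasurable) ?_⟩
  calc _ < ε / 2 + ε / 2 := ENNReal.add_lt_add_of_le_of_lt
        (ne_top_of_le_ne_top (by finiteness) hfg) hfg h3
    _ = ε := ENNReal.add_halves ε

/-- A continuous function with a better decay at infinity than `|x|^{-s'}` is a limit of test
functions in `L^∞_{s'}`. -/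
theorem memWClosure_top_of_continuous (hd : 1 ≤ d) {s' σ : ℝ} (hs' : 0 < s') (hσ : s' < σ)
    {G : Sp d → 𝕜} (hG : Continuous G) (hGσ : wNorm ⊤ σ G < ⊤) : MemWClosure ⊤ s' G := by
  have hae := ae_le_of_wNorm_top hGσ
  set C := (wNorm ⊤ σ G).toReal
  have hC0 : 0 ≤ C := ENNReal.toReal_nonneg
  have key : ∀ ε : ℝ, 0 < ε → ∃ φ : Sp d → 𝕜, ContDiff ℝ ∞ φ ∧ HasCompactSupport φ ∧
      wNorm ⊤ s' (fun x => G x - φ x) ≤ ENNReal.ofReal ε := by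
    intro ε hε
    obtain ⟨R, hR1, hR⟩ : ∃ R : ℝ, 1 ≤ R ∧ R ^ (-(σ - s')) * C ≤ ε / 2 := by
      have t1 : Tendsto (fun R : ℝ => R ^ (-(σ - s')) * C) atTop (𝓝 (0 * C)) :=
        (tendsto_rpow_neg_atTop (by linarith)).mul_const C
      rw [zero_mul] at t1
      obtain ⟨R, h1, h2⟩ := ((t1.eventually (ge_mem_nhds (half_pos hε))).and
        (eventually_ge_atTop (1 : ℝ))).exists
      exact ⟨R, h2, h1⟩
    let χ : ContDiffBump (0 : Sp d) := ⟨R, R + 1, by linarith, by linarith⟩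
    have hw : Continuous fun x : Sp d => ‖x‖ ^ s' :=
      continuous_norm.rpow_const fun x => .inr hs'.le
    have hcs : HasCompactSupport fun x => χ x • G x := χ.hasCompactSupport.smul_right
    obtain ⟨φ, h1, h2, h3⟩ := (χ.continuous.smul hG).exists_contDiff_approx ⊤
      (ε := fun x => ε / 2 / (1 + ‖x‖ ^ s'))
      (continuous_const.div (continuous_const.add hw) fun x => by positivity)
      (fun x => by positivity)
    refine ⟨φ, h1, hcs.mono h3, wNorm_top_le ?_⟩
    filter_upwards [hae] with x hx
    have e1 : ‖x‖ ^ s' * ‖χ x • G x - φ x‖ ≤ ε / 2 := by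
      have := (h2 x).le
      rw [dist_comm, dist_eq_norm, le_div_iff₀ (by positivity)] at this
      have h0 : ‖χ x • G x - φ x‖ * 1 ≥ 0 := by positivity
      simp only [Pi.smul_apply'] at this
      nlinarith
    have e2 : ‖x‖ ^ s' * ‖G x - χ x • G x‖ ≤ ε / 2 := by
      by_cases hxR : ‖x‖ ≤ R
      · rw [χ.one_of_mem_closedBall (by simpa using hxR), one_smul, sub_self, norm_zero, mul_zero]
        exact (half_pos hε).le
      · push Not at hxR
        have hx0 : 0 < ‖x‖ := by linarith
        have e3 : ‖G x - χ x • G x‖ ≤ ‖G x‖ := by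
          have : G x - χ x • G x = (1 - χ x) • G x := by rw [sub_smul, one_smul]
          rw [this, norm_smul]
          refine mul_le_of_le_one_left (norm_nonneg _) ?_
          rw [Real.norm_of_nonneg (by linarith [χ.le_one (x := x)])]
          linarith [χ.nonneg (x := x)]
        calc ‖x‖ ^ s' * ‖G x - χ x • G x‖ ≤ ‖x‖ ^ s' * ‖G x‖ := by gcongr
          _ = ‖x‖ ^ (-(σ - s')) * (‖x‖ ^ σ * ‖G x‖) := by
              rw [← mul_assoc, ← Real.rpow_add hx0]; congr 2; ring
          _ ≤ R ^ (-(σ - s')) * C := by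
              gcongr ?_ * ?_
              · exact Real.rpow_le_rpow_of_nonpos (by linarith) hxR.le (by linarith)
          _ ≤ ε / 2 := hR
    calc ‖x‖ ^ s' * ‖G x - φ x‖
        ≤ ‖x‖ ^ s' * (‖G x - χ x • G x‖ + ‖χ x • G x - φ x‖) := by
          gcongr
          exact norm_sub_le_norm_sub_add_norm_sub _ _ _
      _ ≤ ε := by rw [mul_add]; linarith
  have hlow : -(d : ℝ) * invExp ⊤ < s' := by simpa [invExp] using hs'
  refine ⟨⟨hG.aestronglyMeasurable, ?_⟩, fun ε hε => ?_⟩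
  · obtain ⟨φ, h1, h2, h3⟩ := key 1 one_pos
    obtain ⟨R, C', -, -, hC', hR⟩ := exists_forall_norm_le_of_hasCompactSupport h1.continuous h2
    have h4 := wNorm_le_of_bounded (q := ⊤) (s := s') hC' hR
    have h5 := wNormE_indicator_closedBall_lt_top hd (q := ⊤) (by simp) hlow (R := R)
    have h6 : wNorm ⊤ s' G ≤ wNorm ⊤ s' (fun x => G x - φ x) + wNorm ⊤ s' φ := by
      have := wNorm_add_le (q := ⊤) (by simp) (s := s') (f := fun x => G x - φ x) (g := φ)
        (hG.sub h1.continuous).aestronglyMeasurable h1.continuous.aestronglyMeasurable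
      simpa only [sub_add_cancel] using this
    refine lt_of_le_of_lt (h6.trans (add_le_add h3 h4)) ?_
    finiteness
  · obtain ⟨ε', h0, h1⟩ : ∃ ε' : ℝ, 0 < ε' ∧ ENNReal.ofReal ε' < ε := by
      obtain ⟨r, hr0, hr⟩ := ENNReal.lt_iff_exists_nnreal_btwn.1 hε
      exact ⟨r, by simpa using hr0, by simpa using hr⟩
    obtain ⟨φ, h2, h3, h4⟩ := key ε' h0
    exact ⟨φ, h2, h3, lt_of_le_of_lt h4 h1⟩

/-- For positive times the heat flow is continuous in space as soon as it converges somewhere for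
the doubled time. -/
theorem continuous_heat {t : ℝ} (ht : 0 < t) {f : Sp d → 𝕜} (hf : AEStronglyMeasurable f volume)
    (hfin : ∀ᵐ x ∂(volume : Measure (Sp d)), heatE (2 * t) (fun y => ‖f y‖ₑ) x < ⊤) :
    Continuous (heat t f) := by
  obtain ⟨z, hz⟩ := hfin.exists
  have ht2 : 0 < 2 * t := by positivity
  refine continuous_iff_continuousAt.2 fun x₀ => ?_
  have e : heat t f = fun x => ∫ y, heatKernel d t (x - y) • f y := by
    ext x; simp only [heat, if_neg ht.ne']
  rw [e]
  have hi := (integrable_heatKernel_smul ht2 hf hz).norm.const_mul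
    (Real.exp ((‖x₀ - z‖ + 1) ^ 2 / (4 * t)) * 2 ^ ((d : ℝ) / 2))
  refine continuousAt_of_dominated (.of_forall fun x => ?_) ?_ hi (.of_forall fun y => ?_)
  · exact (measurable_heatKernel_const_sub t x).aestronglyMeasurable.smul hf
  · filter_upwards [Metric.ball_mem_nhds x₀ one_pos] with x hx
    refine .of_forall fun y => ?_
    have hx' : ‖x - z‖ ≤ ‖x₀ - z‖ + 1 := by
      rw [Metric.mem_ball, dist_eq_norm] at hx
      have := norm_sub_le_norm_sub_add_norm_sub x x₀ z
      linarith
    rw [norm_smul, norm_smul, ← mul_assoc, Real.norm_of_nonneg (heatKernel_nonneg ht.le _),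
      Real.norm_of_nonneg (heatKernel_nonneg ht2.le _)]
    gcongr
    exact heatKernel_le_of_norm_sub_le ht hx' y
  · have : Continuous fun x : Sp d => heatKernel d t (x - y) := by unfold heatKernel; fun_prop
    exact (this.smul continuous_const).continuousAt

theorem memWClosure_top_heat (hd : 1 ≤ d) {s' σ : ℝ} (hs' : 0 < s') (hσ : s' < σ) (hσd : σ < d)
    {t : ℝ} (ht : 0 < t) {f : Sp d → 𝕜} (hf : MemW ⊤ σ f) : MemWClosure ⊤ s' (heat t f) := by
  obtain ⟨K, hK⟩ := exists_wNormE_heatE_le hd (p := ⊤) (r := ⊤) (by simp) le_rfl (le_refl σ)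
    (by simp [invExp]; linarith) (by simpa [invExp] using hσd)
  have hfin : ∀ t : ℝ, 0 < t → wNormE ⊤ σ (heatE t fun y => ‖f y‖ₑ) < ⊤ := by
    intro t ht
    refine lt_of_le_of_lt (hK t ht _ hf.1.enorm) ?_
    rw [← wNorm_eq_wNormE]
    have := hf.2
    finiteness
  refine memWClosure_top_of_continuous hd hs' hσ (continuous_heat ht hf.1 ?_) ?_
  · have hm : AEMeasurable (heatE (2 * t) (fun y => ‖f y‖ₑ)) := by
      rw [heatE_congr hf.1.enorm.ae_eq_mk]
      exact (measurable_heatE (θ := fun _ => 2 * t) measurable_const measurable_id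
        (f := fun _ => hf.1.enorm.mk _)
        (hf.1.enorm.measurable_mk.comp measurable_snd)).aemeasurable
    exact ae_lt_top_of_wNormE hd (by simp) hm (hfin _ (by positivity))
  · rw [wNorm_eq_wNormE]
    exact lt_of_le_of_lt (wNormE_mono (.of_forall fun x => enorm_heat_le ht f x)) (hfin t ht)

theorem IsDatum.of_approx {q : ℝ≥0∞} (hq : 1 ≤ q) {s : ℝ} {f : Sp d → 𝕜} (hf : MemW q s f)
    (h : q = ⊤ → ∀ ε : ℝ≥0∞, 0 < ε → ∃ g : Sp d → 𝕜, MemWClosure q s g ∧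
      wNorm q s (fun x => f x - g x) ≤ ε) : IsDatum q s f :=
  ⟨hf, fun ht => .of_approx hq hf (h ht)⟩

namespace Admissible

variable {γ α s' s : ℝ} {q : ℝ≥0∞}

theorem exists_wNorm_heat_le (𝕜 : Type*) [RCLike 𝕜] (h : Admissible d γ α s' s q) :
    ∃ K : ℝ≥0, ∀ t : ℝ, 0 ≤ t → ∀ f : Sp d → 𝕜, MemW q s' f →
      wNorm q s' (heat t f) ≤ K * wNorm q s' f ∧
      (0 < t → wNorm q s (heat t f) ≤
        K * wNorm q s' f * ENNReal.ofReal (t ^ (-((s' - s) / 2)))) := by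
  obtain ⟨K, hK⟩ := h.exists_wNorm_heat_sub_le 𝕜
  refine ⟨K, fun t ht f hf => ?_⟩
  have h1 := hK t ht f (fun _ => 0) hf ⟨aestronglyMeasurable_const, by simp [wNorm]⟩
  have e : ∀ x : Sp d, heat t (fun _ => (0 : 𝕜)) x = 0 := by intro x; simp [heat]
  simpa only [e, sub_zero] using h1

theorem memW_heat (h : Admissible d γ α s' s q) {t : ℝ} (ht : 0 ≤ t) {f : Sp d → 𝕜}
    (hf : MemW q s' f) : MemW q s' (heat t f) := by
  obtain ⟨K, hK⟩ := h.exists_wNorm_heat_le 𝕜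
  refine ⟨aestronglyMeasurable_heat hf.1, lt_of_le_of_lt (hK t ht f hf).1 ?_⟩
  have := hf.2
  finiteness

/-- The heat semigroup maps the space of data into itself. -/
theorem isDatum_heat (h : Admissible d γ α s' s q) {t : ℝ} (ht : 0 ≤ t) {f : Sp d → 𝕜}
    (hf : IsDatum q s' f) : IsDatum q s' (heat t f) := by
  rcases ht.eq_or_lt with rfl | ht0
  · rwa [heat_zero]
  refine .of_approx h.one_le_q (h.memW_heat ht hf.1) ?_
  rintro rfl ε hε
  obtain ⟨K, hK⟩ := h.exists_wNorm_heat_sub_le 𝕜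
  have hs : 0 < s := by simpa [invExp] using h.lower
  have hs'd : s' < d := by simpa [invExp] using h.lt_upper
  obtain ⟨φ, h1, h2, h3⟩ := h.exists_continuous_approx hf
    (ε := ε / (K + 1)) (ENNReal.div_pos hε.ne' (by finiteness))
  have hφ := h.memW_of_hasCompactSupport h1 h2
  have hφσ : MemW ⊤ ((s' + d) / 2) φ := by
    obtain ⟨R, C, -, -, hC, hR⟩ := exists_forall_norm_le_of_hasCompactSupport h1 h2
    refine ⟨h1.aestronglyMeasurable, lt_of_le_of_lt (wNorm_le_of_bounded hC hR) ?_⟩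
    have := wNormE_indicator_closedBall_lt_top h.one_le_d (q := ⊤) (by simp)
      (s := (s' + d) / 2) (by simp [invExp]; linarith [h.s_lt]) (R := R)
    finiteness
  refine ⟨heat t φ, memWClosure_top_heat h.one_le_d (by linarith [h.s_lt]) (by linarith)
    (by linarith) ht0 hφσ, ?_⟩
  refine (hK t ht f φ hf.1 hφ).1.trans ?_
  calc (K : ℝ≥0∞) * wNorm ⊤ s' (fun x => f x - φ x) ≤ (K + 1) * (ε / (K + 1)) := by
        gcongr
        exact le_self_add
    _ ≤ ε := ENNReal.mul_div_le

end Admissible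

/-! ### Restarting the integral equation -/

theorem duh_add {a r : ℝ} (ha : 0 ≤ a) (hr : 0 ≤ r) {F : ℝ → Sp d → 𝕜} (hF : SliceMeas (a + r) F)
    {x : Sp d} (hx : duhE (a + r) (a + r) F x < ⊤) :
    duh (a + r) (a + r) F x = duh a (a + r) F x + duh r r (fun τ => F (a + τ)) x := by
  have hi := intervalIntegrable_of_duhE (by linarith) le_rfl hF hx
  have h1 : IntervalIntegrable (fun τ => heat (a + r - τ) (F τ) x) volume 0 a :=
    hi.mono_set (by
      rw [uIcc_of_le ha, uIcc_of_le (by linarith)]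
      exact Icc_subset_Icc_right (by linarith))
  have h2 : IntervalIntegrable (fun τ => heat (a + r - τ) (F τ) x) volume a (a + r) :=
    hi.mono_set (by
      rw [uIcc_of_le (by linarith : a ≤ a + r), uIcc_of_le (by linarith)]
      exact Icc_subset_Icc_left ha)
  unfold duh
  rw [← intervalIntegral.integral_add_adjacent_intervals h1 h2]
  congr 1
  have := intervalIntegral.integral_comp_add_left (a := 0) (b := r)
    (fun τ => heat (a + r - τ) (F τ) x) a
  rw [add_zero] at this
  rw [← this]
  refine intervalIntegral.integral_congr fun τ _ => ?_
  simp only [add_sub_add_left_eq_sub]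

theorem KatoBdd.shift {q : ℝ≥0∞} {s c T : ℝ} {M : ℝ≥0∞} {u : ℝ → Sp d → 𝕜} (hc : 0 ≤ c)
    (h : KatoBdd q s c T M u) {a r : ℝ} (ha : 0 ≤ a) (hr : a + r ≤ T) :
    KatoBdd q s c r M (fun τ => u (a + τ)) := by
  refine ⟨h.meas.shift ha hr, fun τ hτ => ?_⟩
  refine (h.bound (a + τ) ⟨by linarith [hτ.1], by linarith [hτ.2]⟩).trans ?_
  gcongr 2
  exact Real.rpow_le_rpow_of_nonpos hτ.1 (by linarith) (by linarith)

theorem KatoBdd.congr {q : ℝ≥0∞} {s c T : ℝ} {M : ℝ≥0∞} {u v : ℝ → Sp d → 𝕜}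
    (h : KatoBdd q s c T M u) (huv : ∀ τ ∈ Ioo 0 T, u τ =ᵐ[volume] v τ) :
    KatoBdd q s c T M v := by
  obtain ⟨G, hG, hu⟩ := h.meas
  refine ⟨⟨G, hG, ?_⟩, fun τ hτ => by rw [← wNorm_congr (huv τ hτ)]; exact h.bound τ hτ⟩
  filter_upwards [hu, ae_restrict_mem measurableSet_Ioo] with τ h1 h2
  exact (huv τ h2).symm.trans h1

theorem aestronglyMeasurable_duh {t : ℝ} (ht : 0 ≤ t) {F : ℝ → Sp d → 𝕜} (hF : SliceMeas t F) :
    AEStronglyMeasurable (duh t t F) volume := by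
  obtain ⟨G, hG, hFG⟩ := hF
  rw [duh_congr ht le_rfl hFG]
  exact ((stronglyMeasurable_duh_joint hG).comp_measurable
    (measurable_const.prodMk measurable_id)).aestronglyMeasurable

theorem duh_zero (F : ℝ → Sp d → 𝕜) (r : ℝ) (x : Sp d) : duh 0 r F x = 0 := by simp [duh]

namespace Admissible

variable {γ α s' s : ℝ} {q : ℝ≥0∞}

theorem heat_heat_ae (h : Admissible d γ α s' s q) {r t : ℝ} (hr : 0 ≤ r) (ht : 0 ≤ t)
    {f : Sp d → 𝕜} (hf : MemW q s' f) : heat r (heat t f) =ᵐ[volume] heat (r + t) f := by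
  rcases hr.eq_or_lt with rfl | hr
  · rw [heat_zero, zero_add]
  rcases ht.eq_or_lt with rfl | ht
  · rw [heat_zero, add_zero]
  filter_upwards [h.ae_heatE_lt_top (add_pos hr ht) hf] with x hx
  exact heat_heat hr ht hf.1 hx

/-- The Duhamel term of a Kato bounded function has size `t^δ` in `L^q_{s̃}`. -/
theorem exists_wNorm_duh_le (𝕜 : Type*) [RCLike 𝕜] (h : Admissible d γ α s' s q) :
    ∃ K : ℝ≥0, ∀ t : ℝ, 0 ≤ t → ∀ M : ℝ≥0∞, ∀ u : ℝ → Sp d → 𝕜,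
      KatoBdd q s ((s' - s) / 2) t M u →
      wNorm q s' (duh t t (fun τ => nonlin γ α (u τ))) ≤
        K * (M ^ (α - 1) * M) * ENNReal.ofReal (t ^ gain d γ α s' q) := by
  obtain ⟨K, hK⟩ := h.exists_duhE_le 𝕜
  refine ⟨K * (2 * (1 + α).toNNReal), fun t ht M u hu => ?_⟩
  rcases ht.eq_or_lt with rfl | ht0
  · have : duh 0 0 (fun τ => nonlin γ α (u τ)) = fun _ => 0 := by ext x; exact duh_zero _ _ _
    rw [this]; simp [wNorm]
  have h1 := (hK t ht0 _ hu.meas.nonlin _ (h.ae_nonlin_le hu)).2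
  rw [wNorm_eq_wNormE]
  refine (wNormE_mono (.of_forall fun x => enorm_duh_le ht le_rfl _ x)).trans (h1.trans ?_)
  refine le_of_eq ?_
  push_cast
  rw [ENNReal.ofReal]
  ring

theorem memW_duh (h : Admissible d γ α s' s q) {t : ℝ} (ht : 0 ≤ t) {M : ℝ≥0∞} (hM : M ≠ ⊤)
    {u : ℝ → Sp d → 𝕜} (hu : KatoBdd q s ((s' - s) / 2) t M u) :
    MemW q s' (duh t t (fun τ => nonlin γ α (u τ))) := by
  obtain ⟨K, hK⟩ := h.exists_wNorm_duh_le 𝕜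
  refine ⟨aestronglyMeasurable_duh ht hu.meas.nonlin, lt_of_le_of_lt (hK t ht M u hu) ?_⟩
  have : M ^ (α - 1) ≠ ⊤ := ENNReal.rpow_ne_top_of_nonneg (by linarith [h.one_lt_alpha]) hM
  finiteness

theorem duh_split (h : Admissible d γ α s' s q) {a r : ℝ} (ha : 0 ≤ a) (hr : 0 ≤ r) {M : ℝ≥0∞}
    (hM : M ≠ ⊤) {u : ℝ → Sp d → 𝕜} (hu : KatoBdd q s ((s' - s) / 2) (a + r) M u) :
    ∀ᵐ x ∂(volume : Measure (Sp d)), duh (a + r) (a + r) (fun τ => nonlin γ α (u τ)) x =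
      heat r (duh a a (fun τ => nonlin γ α (u τ))) x +
        duh r r (fun τ => nonlin γ α (u (a + τ))) x := by
  filter_upwards [h.duhE_nonlin_lt_top (by linarith) le_rfl hM hu,
    h.duhE_nonlin_lt_top ha (by linarith : a ≤ a + r) hM (hu.mono (by linarith))] with x h1 h2
  rw [duh_add ha hr hu.meas.nonlin h1]
  congr 1
  rcases hr.eq_or_lt with rfl | hr
  · rw [heat_zero, add_zero]
  rw [heat_duh ha hr le_rfl (hu.meas.nonlin.mono (by linarith)) (by rwa [add_comm r a]),
    add_comm r a]

/-- The integral equation can be restarted at any time `a`. -/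
theorem restart (h : Admissible d γ α s' s q) {a r : ℝ} (ha : 0 ≤ a) (hr : 0 ≤ r) {M : ℝ≥0∞}
    (hM : M ≠ ⊤) {u₀ : Sp d → 𝕜} (hu₀ : MemW q s' u₀) {u : ℝ → Sp d → 𝕜}
    (hu : KatoBdd q s ((s' - s) / 2) (a + r) M u)
    (ha' : u a =ᵐ[volume] fun x => heat a u₀ x + duh a a (fun τ => nonlin γ α (u τ)) x) :
    ∀ᵐ x ∂(volume : Measure (Sp d)),
      heat (a + r) u₀ x + duh (a + r) (a + r) (fun τ => nonlin γ α (u τ)) x =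
      heat r (u a) x + duh r r (fun τ => nonlin γ α (u (a + τ))) x := by
  have hD := h.memW_duh ha hM (hu.mono (by linarith : a ≤ a + r))
  have hH := h.memW_heat ha hu₀
  have hsum : ∀ᵐ x ∂(volume : Measure (Sp d)), heat r (u a) x =
      heat r (heat a u₀) x + heat r (duh a a (fun τ => nonlin γ α (u τ))) x := by
    rcases hr.eq_or_lt with rfl | hr
    · simp only [heat_zero]
      exact ha'
    have hua : MemW q s' (u a) := by
      refine ⟨(hH.1.add hD.1).congr ha'.symm, ?_⟩
      rw [wNorm_congr ha']
      exact lt_of_le_of_lt (wNorm_add_le h.one_le_q hH.1 hD.1) (ENNReal.add_lt_top.2 ⟨hH.2, hD.2⟩)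
    filter_upwards [h.ae_heatE_lt_top hr hua, h.ae_heatE_lt_top hr hD] with x h1 h2
    have e := heat_sub hr hua.1 hD.1 h1 h2
    have e' : heat r (fun y => u a y - duh a a (fun τ => nonlin γ α (u τ)) y) = heat r (heat a u₀) := by
      refine heat_congr hr.ne' ?_
      filter_upwards [ha'] with y hy
      rw [hy, add_sub_cancel_right]
    rw [← e', e, sub_add_cancel]
  filter_upwards [h.duh_split ha hr hM hu, h.heat_heat_ae hr ha hu₀, hsum] with x h1 h2 h3
  rw [h1, h3, h2, add_comm r a, add_assoc]

end Admissible

/-! ### Kato solutions and their regularity -/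

/-- Solutions of the integral equation on `[0,T]` with the bound `‖u(t)‖_{L^q_s} ≤ M t^{-(s̃-s)/2}`,
without any continuity in time. -/
structure IsKatoSol (γ α : ℝ) (q : ℝ≥0∞) (s' s T : ℝ) (M : ℝ≥0∞) (u₀ : Sp d → 𝕜)
    (u : ℝ → Sp d → 𝕜) : Prop where
  bdd : KatoBdd q s ((s' - s) / 2) T M u
  eqn : ∀ t ∈ Icc 0 T, u t =ᵐ[volume] fun x =>
    heat t u₀ x + duh t t (fun τ => nonlin γ α (u τ)) x

theorem IsKatoSol.congr {γ α s' s T : ℝ} {q M : ℝ≥0∞} {u₀ : Sp d → 𝕜} {u v : ℝ → Sp d → 𝕜}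
    (hu : IsKatoSol γ α q s' s T M u₀ u) (huv : ∀ t ∈ Icc 0 T, u t =ᵐ[volume] v t) :
    IsKatoSol γ α q s' s T M u₀ v := by
  refine ⟨hu.bdd.congr fun τ hτ => huv τ (Ioo_subset_Icc_self hτ), fun t ht => ?_⟩
  have e : duh t t (fun τ => nonlin γ α (u τ)) = duh t t (fun τ => nonlin γ α (v τ)) := by
    refine duh_congr ht.1 le_rfl ?_
    filter_upwards [ae_restrict_mem measurableSet_Ioo] with τ hτ
    exact nonlin_congr (huv τ ⟨hτ.1.le, hτ.2.le.trans ht.2⟩)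
  rw [← e]
  exact (huv t ht).symm.trans (hu.eqn t ht)

theorem IsKatoSol.mono {γ α s' s T T' : ℝ} {q M : ℝ≥0∞} {u₀ : Sp d → 𝕜} {u : ℝ → Sp d → 𝕜}
    (hu : IsKatoSol γ α q s' s T M u₀ u) (hT : T' ≤ T) : IsKatoSol γ α q s' s T' M u₀ u :=
  ⟨hu.bdd.mono hT, fun t ht => hu.eqn t ⟨ht.1, ht.2.trans hT⟩⟩

theorem IsKatoSol.zero_ae {γ α s' s T : ℝ} {q M : ℝ≥0∞} {u₀ : Sp d → 𝕜} {u : ℝ → Sp d → 𝕜}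
    (hu : IsKatoSol γ α q s' s T M u₀ u) (hT : 0 ≤ T) : u 0 =ᵐ[volume] u₀ := by
  simpa only [heat_zero, duh_zero, add_zero] using hu.eqn 0 ⟨le_rfl, hT⟩

theorem MemW.congr {q : ℝ≥0∞} {s : ℝ} {f g : Sp d → 𝕜} (hf : MemW q s f) (h : f =ᵐ[volume] g) :
    MemW q s g := ⟨hf.1.congr h, by rw [← wNorm_congr h]; exact hf.2⟩

theorem IsDatum.congr {q : ℝ≥0∞} {s : ℝ} {f g : Sp d → 𝕜} (hf : IsDatum q s f)
    (h : f =ᵐ[volume] g) : IsDatum q s g := by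
  refine ⟨hf.1.congr h, fun hq => ⟨hf.1.congr h, fun ε hε => ?_⟩⟩
  obtain ⟨φ, h1, h2, h3⟩ := (hf.2 hq).2 ε hε
  refine ⟨φ, h1, h2, ?_⟩
  rwa [← wNorm_congr (h.sub (.refl _ φ))]

theorem MemWClosure.add {q : ℝ≥0∞} (hq : 1 ≤ q) {s : ℝ} {f g : Sp d → 𝕜}
    (hf : MemWClosure q s f) (hg : MemWClosure q s g) : MemWClosure q s (fun x => f x + g x) := by
  refine ⟨⟨hf.1.1.add hg.1.1, lt_of_le_of_lt (wNorm_add_le hq hf.1.1 hg.1.1)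
    (ENNReal.add_lt_top.2 ⟨hf.1.2, hg.1.2⟩)⟩, fun ε hε => ?_⟩
  have hε2 : 0 < ε / 2 := ENNReal.div_pos hε.ne' (by simp)
  obtain ⟨φ, h1, h2, h3⟩ := hf.2 (ε / 2) hε2
  obtain ⟨ψ, h4, h5, h6⟩ := hg.2 (ε / 2) hε2
  refine ⟨φ + ψ, h1.add h4, h2.add h5, ?_⟩
  have e : ((fun x => f x + g x) - (φ + ψ)) = fun x => (f - φ) x + (g - ψ) x := by
    ext x; simp only [Pi.sub_apply, Pi.add_apply]; ring
  rw [e]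
  calc _ ≤ _ := wNorm_add_le hq (hf.1.1.sub h1.continuous.aestronglyMeasurable)
        (hg.1.1.sub h4.continuous.aestronglyMeasurable)
    _ < ε / 2 + ε / 2 := ENNReal.add_lt_add h3 h6
    _ = ε := ENNReal.add_halves ε

/-- Interpolation between the weights `s` and `s̃`. -/
theorem KatoBdd.interp (hd : 1 ≤ d) {q : ℝ≥0∞} (hq : 1 ≤ q) {s s₁ s' T : ℝ} {M M' : ℝ≥0∞}
    {u : ℝ → Sp d → 𝕜} (hu : KatoBdd q s ((s' - s) / 2) T M u)
    (hm : ∀ τ ∈ Ioo 0 T, AEStronglyMeasurable (u τ) volume)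
    (hM' : ∀ τ ∈ Ioo 0 T, wNorm q s' (u τ) ≤ M') (h1 : s < s₁) (h2 : s₁ < s') :
    KatoBdd q s₁ ((s' - s₁) / 2) T (M + M') u := by
  refine ⟨hu.meas, fun τ hτ => ?_⟩
  have hτ0 : 0 < τ := hτ.1
  have hs : 0 < s' - s := by linarith
  have pt : ∀ᵐ x ∂(volume : Measure (Sp d)), ENNReal.ofReal (‖x‖ ^ s₁) * ‖u τ x‖ₑ ≤
      ENNReal.ofReal (τ ^ (-((s' - s₁) / 2))) * (ENNReal.ofReal (τ ^ ((s' - s) / 2)) *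
        (ENNReal.ofReal (‖x‖ ^ s) * ‖u τ x‖ₑ) + ENNReal.ofReal (‖x‖ ^ s') * ‖u τ x‖ₑ) := by
    filter_upwards [ae_ne_zero hd] with x hx
    have hx0 : 0 < ‖x‖ := norm_pos_iff.2 hx
    rw [← mul_assoc (ENNReal.ofReal (τ ^ ((s' - s) / 2))), ← add_mul, ← mul_assoc,
      ← ENNReal.ofReal_mul (by positivity), ← ENNReal.ofReal_add (by positivity) (by positivity),
      ← ENNReal.ofReal_mul (by positivity)]
    gcongr
    set θ := (s₁ - s) / (s' - s) with hθ
    have hθ0 : 0 ≤ θ := by rw [hθ]; exact div_nonneg (by linarith) hs.le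
    have hθ1 : θ ≤ 1 := by rw [hθ, div_le_one hs]; linarith
    have eθ : θ * (s' - s) = s₁ - s := div_mul_cancel₀ _ hs.ne'
    have e : ‖x‖ ^ s₁ = τ ^ (-((s' - s₁) / 2)) *
        ((τ ^ ((s' - s) / 2) * ‖x‖ ^ s) ^ (1 - θ) * (‖x‖ ^ s') ^ θ) := by
      rw [Real.mul_rpow (by positivity) (by positivity), ← Real.rpow_mul hτ0.le,
        ← Real.rpow_mul hx0.le, ← Real.rpow_mul hx0.le, mul_assoc, ← Real.rpow_add hx0,
        ← mul_assoc, ← Real.rpow_add hτ0]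
      have e1 : -((s' - s₁) / 2) + (s' - s) / 2 * (1 - θ) = 0 := by linear_combination (-1/2) * eθ
      have e2 : s * (1 - θ) + s' * θ = s₁ := by linear_combination eθ
      rw [e1, e2, Real.rpow_zero, one_mul]
    rw [e]
    gcongr
    have a0 : 0 ≤ τ ^ ((s' - s) / 2) * ‖x‖ ^ s := by positivity
    have b0 : 0 ≤ ‖x‖ ^ s' := by positivity
    refine (Real.geom_mean_le_arith_mean2_weighted (by linarith) hθ0 a0 b0 (by ring)).trans ?_
    nlinarith
  have m : ∀ σ : ℝ, AEMeasurable (fun x => ENNReal.ofReal (‖x‖ ^ σ) * ‖u τ x‖ₑ) volume :=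
    fun σ => (measurable_weight σ).aemeasurable.mul (hm τ hτ).enorm
  calc wNorm q s₁ (u τ)
      ≤ eLpNorm (fun x => ENNReal.ofReal (τ ^ (-((s' - s₁) / 2))) *
          (ENNReal.ofReal (τ ^ ((s' - s) / 2)) * (ENNReal.ofReal (‖x‖ ^ s) * ‖u τ x‖ₑ) +
            ENNReal.ofReal (‖x‖ ^ s') * ‖u τ x‖ₑ)) q volume := by
        rw [wNorm_eq_wNormE, wNormE]
        exact eLpNorm_mono_enorm_ae (by simpa only [enorm_eq_self] using pt)
    _ ≤ ENNReal.ofReal (τ ^ (-((s' - s₁) / 2))) *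
          (ENNReal.ofReal (τ ^ ((s' - s) / 2)) * wNorm q s (u τ) + wNorm q s' (u τ)) := by
        refine (eLpNorm_const_mul_le (by simp)).trans (mul_le_mul_right ?_ _)
        refine (eLpNorm_add_le ((m s).const_mul _).aestronglyMeasurable
          (m s').aestronglyMeasurable hq).trans (add_le_add ?_ ?_)
        · rw [wNorm_eq_wNormE]
          exact eLpNorm_const_mul_le (by simp)
        · rw [wNorm_eq_wNormE]
          rfl
    _ ≤ ENNReal.ofReal (τ ^ (-((s' - s₁) / 2))) *
          (ENNReal.ofReal (τ ^ ((s' - s) / 2)) * (M * ENNReal.ofReal (τ ^ (-((s' - s) / 2))))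
            + M') := by
        gcongr
        · exact hu.bound τ hτ
        · exact hM' τ hτ
    _ = (M + M') * ENNReal.ofReal (τ ^ (-((s' - s₁) / 2))) := by
        have := ofReal_rpow_mul_cancel (c := (s' - s) / 2) hτ0
        rw [ENNReal.ofReal_rpow_of_pos hτ0] at this
        calc _ = (M * (ENNReal.ofReal (τ ^ (-((s' - s) / 2))) *
            ENNReal.ofReal (τ ^ ((s' - s) / 2))) + M') *
              ENNReal.ofReal (τ ^ (-((s' - s₁) / 2))) := by ring
          _ = _ := by rw [this, mul_one]

namespace Admissible

variable {γ α s' s : ℝ} {q : ℝ≥0∞}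

/-- For `q = ∞` the weight `s` can be raised so that the source, and with it the Duhamel term,
decays strictly better than `|x|^{-s̃}`. -/
theorem exists_duhE_top_lt_top (𝕜 : Type*) [RCLike 𝕜] (h : Admissible d γ α s' s ⊤) :
    ∃ σ : ℝ, s' < σ ∧ σ < d ∧ ∀ t : ℝ, 0 < t → ∀ M M' : ℝ≥0∞, M ≠ ⊤ → M' ≠ ⊤ →
      ∀ u : ℝ → Sp d → 𝕜, KatoBdd ⊤ s ((s' - s) / 2) t M u →
      (∀ τ ∈ Ioo 0 t, AEStronglyMeasurable (u τ) volume) →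
      (∀ τ ∈ Ioo 0 t, wNorm ⊤ s' (u τ) ≤ M') →
      wNormE ⊤ σ (duhE t t (fun τ => nonlin γ α (u τ))) < ⊤ := by
  have hα := h.one_lt_alpha
  have hsrc : α * s - γ < d := by simpa [invExp] using h.source_lt
  have hs0 : 0 < s := by simpa [invExp] using h.lower
  obtain ⟨s₁, h1, h2⟩ : ∃ s₁, s < s₁ ∧ s₁ < min s' ((d + γ) / α) := by
    refine exists_between (lt_min h.s_lt ?_)
    rw [lt_div_iff₀ (by linarith)]
    linarith
  have h3 : s₁ < s' := h2.trans_le (min_le_left _ _)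
  have h4 : α * s₁ - γ < d := by
    have := h2.trans_le (min_le_right _ _)
    rw [lt_div_iff₀ (by linarith)] at this
    linarith
  have h5 : s' < α * s₁ - γ := lt_of_le_of_lt h.le_source (by nlinarith)
  have h' : Admissible d γ α s' s₁ ⊤ :=
    { h with
      lower := h.lower.trans h1
      s_lt := h3
      le_source := h5.le
      source_lt := by simpa [invExp] using h4 }
  obtain ⟨K, hK⟩ := exists_wNormE_heatE_le h.one_le_d (p := ⊤) (r := ⊤) (by simp) le_rfl
    (le_refl (α * s₁ - γ)) (by simp only [invExp, ENNReal.inv_top, ENNReal.toReal_zero, mul_zero]; linarith [h.s_lt])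
    (by simpa [invExp] using h4)
  obtain ⟨B, hB⟩ := exists_wNormE_duhE_le (𝕜 := 𝕜) (p := ⊤) (q := ⊤) (by simp) le_rfl one_pos
    h'.weight_nonneg h'.weight_lt_one (s₁ := α * s₁ - γ) (s₂ := α * s₁ - γ) (K := K)
    (by simpa using hK)
  refine ⟨α * s₁ - γ, h5, h4, fun t ht M M' hM hM' u hu hm hu' => ?_⟩
  have hu₁ := hu.interp h.one_le_d (by simp) hm hu' h1 h3
  have hN := h'.ae_nonlin_le hu₁
  rw [ENNReal.top_div_of_ne_top (by simp)] at hN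
  refine lt_of_le_of_lt (hB t ht _ hu.meas.nonlin _ hN) ?_
  have : (M + M') ^ (α - 1) ≠ ⊤ := ENNReal.rpow_ne_top_of_nonneg (by linarith) (by finiteness)
  finiteness

end Admissible

namespace IsKatoSol

variable {γ α s' s T : ℝ} {q M : ℝ≥0∞} {u₀ : Sp d → 𝕜} {u : ℝ → Sp d → 𝕜}

theorem memW (hu : IsKatoSol γ α q s' s T M u₀ u) (h : Admissible d γ α s' s q) (hM : M ≠ ⊤)
    (hu₀ : MemW q s' u₀) {t : ℝ} (ht : t ∈ Icc 0 T) : MemW q s' (u t) := by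
  have h1 := h.memW_heat ht.1 hu₀
  have h2 := h.memW_duh ht.1 hM (hu.bdd.mono ht.2)
  exact MemW.congr ⟨h1.1.add h2.1, lt_of_le_of_lt (wNorm_add_le h.one_le_q h1.1 h2.1)
    (ENNReal.add_lt_top.2 ⟨h1.2, h2.2⟩)⟩ (hu.eqn t ht).symm

theorem exists_wNorm_le (hu : IsKatoSol γ α q s' s T M u₀ u) (h : Admissible d γ α s' s q)
    (hM : M ≠ ⊤) (hu₀ : MemW q s' u₀) :
    ∃ M' : ℝ≥0∞, M' ≠ ⊤ ∧ ∀ t ∈ Icc 0 T, wNorm q s' (u t) ≤ M' := by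
  obtain ⟨K, hK⟩ := h.exists_wNorm_heat_le 𝕜
  obtain ⟨K', hK'⟩ := h.exists_wNorm_duh_le 𝕜
  refine ⟨K * wNorm q s' u₀ + K' * (M ^ (α - 1) * M) * ENNReal.ofReal (T ^ gain d γ α s' q),
    ?_, fun t ht => ?_⟩
  · have : M ^ (α - 1) ≠ ⊤ := ENNReal.rpow_ne_top_of_nonneg (by linarith [h.one_lt_alpha]) hM
    have := hu₀.2
    finiteness
  · rw [wNorm_congr (hu.eqn t ht)]
    refine (wNorm_add_le h.one_le_q (h.memW_heat ht.1 hu₀).1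
      (h.memW_duh ht.1 hM (hu.bdd.mono ht.2)).1).trans (add_le_add (hK t ht.1 u₀ hu₀).1 ?_)
    refine (hK' t ht.1 M u (hu.bdd.mono ht.2)).trans ?_
    gcongr
    · exact ht.1
    · exact h.gain_pos.le
    · exact ht.2

/-- The size of the Duhamel term of the equation restarted at time `a`, uniformly in `a`. -/
theorem exists_restart_le (hu : IsKatoSol γ α q s' s T M u₀ u) (h : Admissible d γ α s' s q)
    (hM : M ≠ ⊤) :
    ∃ B : ℝ → ℝ≥0∞, Tendsto B (𝓝 0) (𝓝 0) ∧ ∀ a r : ℝ, 0 ≤ a → 0 ≤ r → a + r ≤ T →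
      wNorm q s' (duh r r (fun τ => nonlin γ α (u (a + τ)))) ≤ B r := by
  obtain ⟨K, hK⟩ := h.exists_wNorm_duh_le 𝕜
  refine ⟨fun r => K * (M ^ (α - 1) * M) * ENNReal.ofReal (r ^ gain d γ α s' q), ?_,
    fun a r ha hr har => hK r hr M _ (hu.bdd.shift h.weight_pos.le ha har)⟩
  have hMα : M ^ (α - 1) ≠ ⊤ := ENNReal.rpow_ne_top_of_nonneg (by linarith [h.one_lt_alpha]) hM
  have h1 : Tendsto (fun r : ℝ => r ^ gain d γ α s' q) (𝓝 0) (𝓝 0) := by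
    have := (Real.continuousAt_rpow_const 0 (gain d γ α s' q) (.inr h.gain_pos.le)).tendsto
    rwa [Real.zero_rpow h.gain_pos.ne'] at this
  have h2 := ENNReal.Tendsto.const_mul (a := K * (M ^ (α - 1) * M)) (ENNReal.tendsto_ofReal h1)
    (.inr (by finiteness))
  simpa using h2

theorem restart_ae (hu : IsKatoSol γ α q s' s T M u₀ u) (h : Admissible d γ α s' s q) (hM : M ≠ ⊤)
    (hu₀ : MemW q s' u₀) {a r : ℝ} (ha : 0 ≤ a) (hr : 0 ≤ r) (har : a + r ≤ T) :
    u (a + r) =ᵐ[volume] fun x =>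
      heat r (u a) x + duh r r (fun τ => nonlin γ α (u (a + τ))) x := by
  filter_upwards [hu.eqn (a + r) ⟨by linarith, har⟩, h.restart ha hr hM hu₀ (hu.bdd.mono har)
    (hu.eqn a ⟨ha, by linarith⟩)] with x h1 h2
  rw [h1, h2]

/-- The solution stays in the space of data. -/
theorem isDatum (hu : IsKatoSol γ α q s' s T M u₀ u) (h : Admissible d γ α s' s q) (hM : M ≠ ⊤)
    (hu₀ : IsDatum q s' u₀) {t : ℝ} (ht : t ∈ Icc 0 T) : IsDatum q s' (u t) := by
  rcases ht.1.eq_or_lt with rfl | ht0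
  · exact hu₀.congr (hu.zero_ae ht.2).symm
  refine .of_approx h.one_le_q (hu.memW h hM hu₀.1 ht) ?_
  rintro rfl ε hε
  obtain ⟨σ, hσ, hσd, hD⟩ := h.exists_duhE_top_lt_top 𝕜
  obtain ⟨B, hB, hBu⟩ := hu.exists_restart_le h hM
  obtain ⟨M', hM', huM'⟩ := hu.exists_wNorm_le h hM hu₀.1
  obtain ⟨r, ⟨hr0, hrt⟩, hr⟩ : ∃ r, r ∈ Ioo 0 t ∧ B r ≤ ε :=
    ((show ∀ᶠ r in 𝓝[>] (0 : ℝ), r ∈ Ioo 0 t from Ioo_mem_nhdsGT ht0).and (ENNReal.tendsto_nhds_zero.1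
      (hB.mono_left nhdsWithin_le_nhds) ε hε : ∀ᶠ r in 𝓝[>] 0, B r ≤ ε)).exists
  have hs : 0 < s := by simpa [invExp] using h.lower
  set a := t - r with ha
  have ha0 : 0 < a := by linarith
  have hat : a + r = t := by linarith
  have hua : KatoBdd ⊤ s ((s' - s) / 2) a M u := hu.bdd.mono (by linarith [ht.2])
  have hDσ : MemW ⊤ σ (duh a a (fun τ => nonlin γ α (u τ))) := by
    refine ⟨aestronglyMeasurable_duh ha0.le hua.meas.nonlin, ?_⟩
    rw [wNorm_eq_wNormE]
    refine lt_of_le_of_lt (wNormE_mono (.of_forall fun x => enorm_duh_le ha0.le le_rfl _ x))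
      (hD a ha0 M M' hM hM' u hua (fun τ hτ => ?_) fun τ hτ => ?_)
    · exact (hu.memW h hM hu₀.1 ⟨hτ.1.le, by linarith [hτ.2, ht.2]⟩).1
    · exact huM' τ ⟨hτ.1.le, by linarith [hτ.2, ht.2]⟩
  refine ⟨fun x => heat t u₀ x + heat r (duh a a (fun τ => nonlin γ α (u τ))) x,
    ((h.isDatum_heat ht0.le hu₀).2 rfl).add (by simp)
      (memWClosure_top_heat h.one_le_d (by linarith [h.s_lt]) hσ hσd hr0 hDσ), ?_⟩
  refine le_trans (le_of_eq (wNorm_congr ?_))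
    ((hBu a r ha0.le hr0.le (by linarith [ht.2])).trans hr)
  have hsplit := h.duh_split ha0.le hr0.le hM (hu.bdd.mono (by linarith [ht.2] : a + r ≤ T))
  rw [hat] at hsplit
  filter_upwards [hu.eqn t ht, hsplit] with x h1 h2
  rw [h1, h2]
  ring

/-- **Continuity in time** of Kato solutions. -/
theorem isContW (hu : IsKatoSol γ α q s' s T M u₀ u) (h : Admissible d γ α s' s q) (hM : M ≠ ⊤)
    (hu₀ : IsDatum q s' u₀) : IsContW q s' T u := by
  refine ⟨fun t ht => hu.memW h hM hu₀.1 ht, fun t ht => ?_⟩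
  obtain ⟨B, hB, hBu⟩ := hu.exists_restart_le h hM
  obtain ⟨K, hK⟩ := h.exists_wNorm_heat_le 𝕜
  have hm : ∀ r ∈ Icc 0 T, AEStronglyMeasurable (u r) volume :=
    fun r hr => (hu.memW h hM hu₀.1 hr).1
  have mD : ∀ a r : ℝ, 0 ≤ a → 0 ≤ r → a + r ≤ T →
      AEStronglyMeasurable (duh r r (fun τ => nonlin γ α (u (a + τ)))) volume :=
    fun a r ha hr har =>
      (h.memW_duh hr hM (hu.bdd.shift h.weight_pos.le ha har)).1
  rw [ENNReal.tendsto_nhds_zero]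
  intro ε hε
  have hε2 : 0 < ε / 2 := ENNReal.div_pos hε.ne' (by simp)
  have hε4 : 0 < ε / 2 / 2 := ENNReal.div_pos hε2.ne' (by simp)
  have right : ∀ᶠ r in 𝓝[Icc 0 T] t, t ≤ r → wNorm q s' (u r - u t) ≤ ε := by
    have t0 : Tendsto (fun r : ℝ => r - t) (𝓝 t) (𝓝 0) := by
      have : Tendsto (fun r : ℝ => r - t) (𝓝 t) (𝓝 (t - t)) := tendsto_id.sub_const t
      rwa [sub_self] at this
    have t1 := ENNReal.tendsto_nhds_zero.1 (hB.comp t0) (ε / 2) hε2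
    have t2 := ENNReal.tendsto_nhds_zero.1 (h.tendsto_heat_zero (hu.isDatum h hM hu₀ ht))
      (ε / 2) hε2
    rw [eventually_nhdsWithin_iff] at t2
    have t3 := t0.eventually t2
    filter_upwards [mem_nhdsWithin_of_mem_nhds t1, mem_nhdsWithin_of_mem_nhds t3,
      self_mem_nhdsWithin] with r h1 h2 hr htr
    have hr0 : 0 ≤ r - t := by linarith
    have e := hu.restart_ae h hM hu₀.1 ht.1 hr0 (by linarith [hr.2])
    rw [add_sub_cancel] at e
    have hmD := mD t (r - t) ht.1 hr0 (by linarith [hr.2])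
    calc wNorm q s' (u r - u t)
        = wNorm q s' (fun x => (heat (r - t) (u t) x - u t x) +
            duh (r - t) (r - t) (fun τ => nonlin γ α (u (t + τ))) x) := by
          refine wNorm_congr ?_
          filter_upwards [e] with x hx
          rw [Pi.sub_apply, hx]
          ring
      _ ≤ wNorm q s' (fun x => heat (r - t) (u t) x - u t x) +
            wNorm q s' (duh (r - t) (r - t) (fun τ => nonlin γ α (u (t + τ)))) :=
          wNorm_add_le h.one_le_q ((aestronglyMeasurable_heat (hm t ht)).sub (hm t ht)) hmD
      _ ≤ ε / 2 + ε / 2 := add_le_add (h2 hr0) ((hBu t (r - t) ht.1 hr0 (by linarith [hr.2])).trans h1)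
      _ = ε := ENNReal.add_halves ε
  have left : ∀ᶠ r in 𝓝[Icc 0 T] t, r ≤ t → wNorm q s' (u r - u t) ≤ ε := by
    rcases ht.1.eq_or_lt with rfl | ht0
    · filter_upwards [self_mem_nhdsWithin] with r hr hr0
      have : r = 0 := le_antisymm hr0 hr.1
      simp [this, wNorm]
    -- a time `a < t` such that the Duhamel terms on `[a,t]` are small
    obtain ⟨η, hη0, hη⟩ : ∃ η : ℝ, 0 < η ∧ ∀ r : ℝ, |r| < η → B r ≤ ε / 2 / 2 := by
      have := ENNReal.tendsto_nhds_zero.1 hB _ hε4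
      obtain ⟨η, hη, h2⟩ := Metric.eventually_nhds_iff.1 this
      exact ⟨η, hη, fun r hr => h2 (by simpa using hr)⟩
    obtain ⟨a, ha⟩ : ∃ a, a ∈ Ioo (max 0 (t - η)) t := nonempty_Ioo.2 (max_lt ht0 (by linarith))
    have ha0 : 0 < a := (le_max_left _ _).trans_lt ha.1
    have haη : t - η < a := (le_max_right _ _).trans_lt ha.1
    have hat := ha.2
    have haT : a ∈ Icc 0 T := ⟨ha0.le, by linarith [ht.2]⟩
    have hfa := hu.isDatum h hM hu₀ haT
    have t0 : Tendsto (fun r : ℝ => t - r) (𝓝 t) (𝓝 0) := by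
      have : Tendsto (fun r : ℝ => t - r) (𝓝 t) (𝓝 (t - t)) := tendsto_id.const_sub t
      rwa [sub_self] at this
    have t1 : Tendsto (fun r => K * wNorm q s' (fun x => heat r (u a) x - u a x)) (𝓝[≥] 0)
        (𝓝 0) := by
      have := ENNReal.Tendsto.const_mul (a := (K : ℝ≥0∞)) (h.tendsto_heat_zero hfa)
        (.inr (by simp))
      rwa [mul_zero] at this
    have t2 := ENNReal.tendsto_nhds_zero.1 t1 (ε / 2) hε2
    rw [eventually_nhdsWithin_iff] at t2
    filter_upwards [mem_nhdsWithin_of_mem_nhds (t0.eventually t2),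
      mem_nhdsWithin_of_mem_nhds (lt_mem_nhds hat), self_mem_nhdsWithin] with r h2 har hr hrt
    have h2' := h2 (show (0 : ℝ) ≤ t - r by linarith)
    have hra0 : 0 ≤ r - a := by linarith
    have hta0 : 0 ≤ t - a := by linarith
    have e1 := hu.restart_ae h hM hu₀.1 ha0.le hra0 (by linarith [hr.2])
    have e2 := hu.restart_ae h hM hu₀.1 ha0.le hta0 (by linarith [ht.2])
    rw [add_sub_cancel] at e1 e2
    have m1 := mD a (r - a) ha0.le hra0 (by linarith [hr.2])
    have m2 := mD a (t - a) ha0.le hta0 (by linarith [ht.2])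
    have b1 := (hBu a (r - a) ha0.le hra0 (by linarith [hr.2])).trans
      (hη _ (by rw [abs_of_nonneg hra0]; linarith))
    have b2 := (hBu a (t - a) ha0.le hta0 (by linarith [ht.2])).trans
      (hη _ (by rw [abs_of_nonneg hta0]; linarith))
    have hfd : MemW q s' (fun x => heat (t - r) (u a) x - u a x) := by
      have := h.memW_heat (by linarith : 0 ≤ t - r) hfa.1
      exact ⟨this.1.sub hfa.1.1, lt_of_le_of_lt (wNorm_sub_le h.one_le_q this.1 hfa.1.1)
        (ENNReal.add_lt_top.2 ⟨this.2, hfa.1.2⟩)⟩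
    have b3 : wNorm q s' (fun x => heat (t - a) (u a) x - heat (r - a) (u a) x) ≤ ε / 2 := by
      refine le_trans (le_of_eq ?_) (((hK (r - a) hra0 _ hfd).1).trans h2')
      refine wNorm_congr ?_
      have hp : 0 < r - a := by linarith
      have hmem := h.memW_heat (by linarith : 0 ≤ t - r) hfa.1
      have e3 := h.heat_heat_ae hra0 (by linarith : 0 ≤ t - r) hfa.1
      rw [show r - a + (t - r) = t - a by ring] at e3
      filter_upwards [e3, h.ae_heatE_lt_top hp hfa.1, h.ae_heatE_lt_top hp hmem] with x h3 h4 h5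
      rw [heat_sub hp hmem.1 hfa.1.1 h5 h4, h3]
    calc wNorm q s' (u r - u t) = wNorm q s' (fun x => u t x - u r x) := wNorm_sub_comm _ _
      _ = wNorm q s' (fun x => (heat (t - a) (u a) x - heat (r - a) (u a) x) +
            (duh (t - a) (t - a) (fun τ => nonlin γ α (u (a + τ))) x -
              duh (r - a) (r - a) (fun τ => nonlin γ α (u (a + τ))) x)) := by
          refine wNorm_congr ?_
          filter_upwards [e1, e2] with x h3 h4
          rw [h3, h4]
          ring
      _ ≤ ε / 2 + (ε / 2 / 2 + ε / 2 / 2) := by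
          refine (wNorm_add_le h.one_le_q ((aestronglyMeasurable_heat hfa.1.1).sub
            (aestronglyMeasurable_heat hfa.1.1)) (m2.sub m1)).trans (add_le_add b3 ?_)
          exact (wNorm_sub_le h.one_le_q m2 m1).trans (add_le_add b2 b1)
      _ = ε := by rw [ENNReal.add_halves, ENNReal.add_halves]
  filter_upwards [left, right] with r h1 h2
  exact (le_total r t).elim h1 h2

end IsKatoSol

/-! ### Mild solutions and Kato solutions -/

theorem heat_congr_ae {f g : Sp d → 𝕜} (h : f =ᵐ[volume] g) (t : ℝ) :
    heat t f =ᵐ[volume] heat t g := by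
  rcases eq_or_ne t 0 with rfl | ht
  · simpa only [heat_zero] using h
  · rw [heat_congr ht h]

theorem IsMildSol.isKatoSol {γ α s' s T : ℝ} {q : ℝ≥0∞} {u₀ : Sp d → 𝕜} {u : ℝ → Sp d → 𝕜}
    (hu : IsMildSol γ α q s' s T u₀ u) {T' : ℝ} (hT' : T' ≤ T) :
    IsKatoSol γ α q s' s T' (katoNorm q s' s T' u) u₀ u :=
  ⟨katoBdd_of_katoNorm (hu.kato.sliceMeas.mono hT') le_rfl, fun _ ht =>
    hu.eqn.ae_eq ⟨ht.1, ht.2.trans hT'⟩⟩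

theorem IsMildSol.mono {γ α s' s T T' : ℝ} {q : ℝ≥0∞} {u₀ : Sp d → 𝕜} {u : ℝ → Sp d → 𝕜}
    (hu : IsMildSol γ α q s' s T u₀ u) (hT' : T' ≤ T) : IsMildSol γ α q s' s T' u₀ u := by
  refine ⟨⟨fun t ht => hu.cont.1 t ⟨ht.1, ht.2.trans hT'⟩, fun t ht =>
    (hu.cont.2 t ⟨ht.1, ht.2.trans hT'⟩).mono_left
      (nhdsWithin_mono _ (Icc_subset_Icc_right hT'))⟩, ⟨?_, fun t ht =>
    hu.kato.2.1 t ⟨ht.1, ht.2.trans_le hT'⟩, fun t ht => hu.kato.2.2 t ⟨ht.1, ht.2.trans_le hT'⟩⟩,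
    fun t ht => hu.eqn t ⟨ht.1, ht.2.trans hT'⟩⟩
  exact hu.kato.1.mono_measure (Measure.prod_mono
    (Measure.restrict_mono (Ioo_subset_Ioo_right hT') le_rfl) le_rfl)

namespace IsKatoSol

variable {γ α s' s T : ℝ} {q M : ℝ≥0∞} {u₀ : Sp d → 𝕜} {u : ℝ → Sp d → 𝕜}

theorem isMildSol (hu : IsKatoSol γ α q s' s T M u₀ u) (h : Admissible d γ α s' s q) (hM : M ≠ ⊤)
    (hu₀ : IsDatum q s' u₀) (hm : AEStronglyMeasurable (fun p : ℝ × Sp d => u p.1 p.2)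
      ((volume.restrict (Ioo 0 T)).prod volume)) : IsMildSol γ α q s' s T u₀ u := by
  refine ⟨hu.isContW h hM hu₀, ⟨hm, fun t ht => (hu.memW h hM hu₀.1 (Ioo_subset_Icc_self ht)).1,
    fun T' hT' => ?_⟩, fun t ht => ?_⟩
  · refine lt_of_le_of_lt (katoNorm_le h.s_lt fun t ht0 ht => hu.bdd.bound t ⟨ht0, ?_⟩) hM.lt_top
    exact ht.trans_lt hT'.2
  · have hut := hu.bdd.mono ht.2
    filter_upwards [hu.eqn t ht, h.duhE_nonlin_lt_top ht.1 le_rfl hM hut] with x h1 h2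
    exact ⟨intervalIntegrable_of_duhE ht.1 le_rfl hut.meas.nonlin h2, h1⟩

/-- Every Kato solution has a jointly measurable version, which is a mild solution. -/
theorem exists_isMildSol (hu : IsKatoSol γ α q s' s T M u₀ u) (h : Admissible d γ α s' s q)
    (hM : M ≠ ⊤) (hu₀ : IsDatum q s' u₀) :
    ∃ v : ℝ → Sp d → 𝕜, StronglyMeasurable (Function.uncurry v) ∧
      (∀ t ∈ Icc 0 T, u t =ᵐ[volume] v t) ∧ IsMildSol γ α q s' s T u₀ v := by
  obtain ⟨G, hG, hFG⟩ := hu.bdd.meas.nonlin (γ := γ) (α := α)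
  have hm := hu₀.1.1
  have hsm : StronglyMeasurable (Function.uncurry fun (t : ℝ) (x : Sp d) =>
      heat t (hm.mk u₀) x + duh t t G x) := by
    refine StronglyMeasurable.add ?_ (stronglyMeasurable_duh_joint hG)
    exact stronglyMeasurable_heat (f := fun _ : ℝ × Sp d => hm.mk u₀) measurable_fst measurable_snd
      (hm.stronglyMeasurable_mk.comp_measurable measurable_snd)
  have hae : ∀ t ∈ Icc 0 T, u t =ᵐ[volume] fun x => heat t (hm.mk u₀) x + duh t t G x := by
    intro t ht
    have e : duh t t (fun τ => nonlin γ α (u τ)) = duh t t G :=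
      duh_congr ht.1 le_rfl
        (ae_restrict_of_ae_restrict_of_subset (Ioo_subset_Ioo_right ht.2) hFG)
    filter_upwards [hu.eqn t ht, heat_congr_ae hm.ae_eq_mk t] with x h1 h2
    rw [h1, h2, e]
  exact ⟨_, hsm, hae, (hu.congr hae).isMildSol h hM hu₀ hsm.aestronglyMeasurable⟩

end IsKatoSol

/-- Mild solutions are determined up to null sets in every slice. -/
theorem IsMildSol.congr {γ α s' s T : ℝ} {q : ℝ≥0∞} {u₀ : Sp d → 𝕜} {u v : ℝ → Sp d → 𝕜}
    (hu : IsMildSol γ α q s' s T u₀ u) (huv : ∀ t ∈ Icc 0 T, u t =ᵐ[volume] v t)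
    (hv : AEStronglyMeasurable (fun p : ℝ × Sp d => v p.1 p.2)
      ((volume.restrict (Ioo 0 T)).prod volume)) : IsMildSol γ α q s' s T u₀ v := by
  refine ⟨⟨fun t ht => (hu.cont.1 t ht).congr (huv t ht), fun t ht => ?_⟩,
    ⟨hv, fun t ht => (hu.kato.2.1 t ht).congr (huv t (Ioo_subset_Icc_self ht)), fun T' hT' => ?_⟩,
    fun t ht => ?_⟩
  · refine (hu.cont.2 t ht).congr' ?_
    filter_upwards [self_mem_nhdsWithin] with r hr
    exact wNorm_congr ((huv r hr).sub (huv t ht))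
  · rw [← katoNorm_congr fun t ht => huv t ⟨ht.1, ht.2.trans hT'.2.le⟩]
    exact hu.kato.2.2 T' hT'
  · have e : ∀ᵐ τ ∂(volume.restrict (Ioo 0 t)),
        heat (t - τ) (nonlin γ α (u τ)) = heat (t - τ) (nonlin γ α (v τ)) := by
      refine ae_heat_congr le_rfl ?_
      filter_upwards [ae_restrict_mem measurableSet_Ioo] with τ hτ
      exact nonlin_congr (huv τ ⟨hτ.1.le, hτ.2.le.trans ht.2⟩)
    filter_upwards [hu.eqn t ht, huv t ht] with x h1 h2
    have e' : ∀ᵐ τ ∂(volume.restrict (uIoc 0 t)),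
        heat (t - τ) (nonlin γ α (u τ)) x = heat (t - τ) (nonlin γ α (v τ)) x := by
      rw [uIoc_of_le ht.1, ← Measure.restrict_congr_set Ioo_ae_eq_Ioc]
      filter_upwards [e] with τ hτ
      rw [hτ]
    refine ⟨h1.1.congr_ae e', ?_⟩
    rw [← h2, h1.2]
    congr 1
    exact intervalIntegral.integral_congr_ae ((ae_restrict_iff' measurableSet_uIoc).1 e')

/-! ### Local existence -/

theorem SliceMeas.add {T : ℝ} {F G : ℝ → Sp d → 𝕜} (hF : SliceMeas T F) (hG : SliceMeas T G) :
    SliceMeas T (fun τ x => F τ x + G τ x) := by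
  obtain ⟨F', hF', hF⟩ := hF
  obtain ⟨G', hG', hG⟩ := hG
  refine ⟨fun τ x => F' τ x + G' τ x, hF'.add hG', ?_⟩
  filter_upwards [hF, hG] with τ h1 h2
  exact h1.add h2

theorem SliceMeas.duh {T : ℝ} {F : ℝ → Sp d → 𝕜} (hF : SliceMeas T F) :
    SliceMeas T (fun t => HardyHenon.duh t t F) := by
  obtain ⟨G, hG, hFG⟩ := hF
  refine ⟨fun t => HardyHenon.duh t t G, stronglyMeasurable_duh_joint hG, ?_⟩
  filter_upwards [ae_restrict_mem measurableSet_Ioo] with t ht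
  rw [duh_congr ht.1.le le_rfl
    (ae_restrict_of_ae_restrict_of_subset (Ioo_subset_Ioo_right ht.2.le) hFG)]

theorem sliceMeas_heat {T : ℝ} {f : Sp d → 𝕜} (hf : AEStronglyMeasurable f volume) :
    SliceMeas T (fun t => heat t f) := by
  refine ⟨fun t => heat t (hf.mk f), ?_, .of_forall fun t => heat_congr_ae hf.ae_eq_mk t⟩
  exact stronglyMeasurable_heat (f := fun _ : ℝ × Sp d => hf.mk f) measurable_fst measurable_snd
    (hf.stronglyMeasurable_mk.comp_measurable measurable_snd)

theorem SliceMeas.limUnder {T : ℝ} {F : ℕ → ℝ → Sp d → 𝕜} (hF : ∀ n, SliceMeas T (F n)) :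
    SliceMeas T (fun t x => limUnder atTop fun n => F n t x) := by
  choose G hG hFG using hF
  refine ⟨fun t x => Filter.limUnder atTop fun n => G n t x, ?_, ?_⟩
  · exact StronglyMeasurable.limUnder hG
  · filter_upwards [ae_all_iff.2 hFG] with t ht
    filter_upwards [ae_all_iff.2 ht] with x hx
    simp only [hx]

theorem eLpNorm_rpow_norm_smul (q : ℝ≥0∞) (s : ℝ) (f : Sp d → 𝕜) :
    eLpNorm (fun x => (‖x‖ ^ s : ℝ) • f x) q volume = wNorm q s f := by
  refine eLpNorm_congr_norm_ae (.of_forall fun x => ?_)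
  rw [norm_smul, norm_mul, norm_norm]

theorem aestronglyMeasurable_rpow_norm_smul (s : ℝ) {f : Sp d → 𝕜}
    (hf : AEStronglyMeasurable f volume) :
    AEStronglyMeasurable (fun x => (‖x‖ ^ s : ℝ) • f x) volume := by
  have h2 : Measurable (fun x : Sp d => ‖x‖ ^ s) := by fun_prop
  exact h2.aestronglyMeasurable.smul hf

/-- Fatou's lemma for the weighted norm. -/
theorem wNorm_le_of_tendsto {q : ℝ≥0∞} {s : ℝ} {f : ℕ → Sp d → 𝕜} {g : Sp d → 𝕜} {B : ℝ≥0∞}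
    (hf : ∀ n, AEStronglyMeasurable (f n) volume)
    (hlim : ∀ᵐ x ∂(volume : Measure (Sp d)), Tendsto (fun n => f n x) atTop (𝓝 (g x)))
    (hB : ∀ᶠ n in atTop, wNorm q s (f n) ≤ B) : wNorm q s g ≤ B := by
  rw [← eLpNorm_rpow_norm_smul]
  refine (Lp.eLpNorm_lim_le_liminf_eLpNorm
    (f := fun n x => (‖x‖ ^ s : ℝ) • f n x)
    (fun n => aestronglyMeasurable_rpow_norm_smul s (hf n)) _ ?_).trans ?_
  · filter_upwards [hlim] with x hx
    exact hx.const_smul _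
  · simp only [eLpNorm_rpow_norm_smul]
    exact liminf_le_of_frequently_le' hB.frequently

/-- A sequence which is Cauchy in the weighted norm with geometric rate converges almost
everywhere. -/
theorem ae_exists_tendsto_of_geometric (hd : 1 ≤ d) {q : ℝ≥0∞} (hq : 1 ≤ q) {s : ℝ}
    {f : ℕ → Sp d → 𝕜} (hf : ∀ n, AEStronglyMeasurable (f n) volume) {A : ℝ≥0∞} (hA : A ≠ ⊤)
    (h : ∀ N n m, N ≤ n → N ≤ m → wNorm q s (fun x => f n x - f m x) ≤ A * 2⁻¹ ^ N) :
    ∀ᵐ x ∂(volume : Measure (Sp d)), ∃ l, Tendsto (fun n => f n x) atTop (𝓝 l) := by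
  have h1 := Lp.ae_tendsto_of_cauchy_eLpNorm (μ := (volume : Measure (Sp d))) (p := q)
    (f := fun n x => (‖x‖ ^ s : ℝ) • f n x) (B := fun N => (A + 1) * 2⁻¹ ^ N)
    (fun n => aestronglyMeasurable_rpow_norm_smul s (hf n)) hq
    (by
      rw [ENNReal.tsum_mul_left, ENNReal.tsum_geometric]
      refine ENNReal.mul_ne_top (by finiteness) ?_
      simp)
    (fun N n m hn hm => by
      have e : ((fun x => (‖x‖ ^ s : ℝ) • f n x) - fun x => (‖x‖ ^ s : ℝ) • f m x) =
          fun x => (‖x‖ ^ s : ℝ) • (f n x - f m x) := by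
        ext x; simp only [Pi.sub_apply, smul_sub]
      rw [e, eLpNorm_rpow_norm_smul q s (fun x => f n x - f m x)]
      refine (h N n m hn hm).trans_lt ?_
      exact ENNReal.mul_lt_mul_left (by simp) (by finiteness)
        (ENNReal.lt_add_right hA one_ne_zero))
  filter_upwards [h1, ae_ne_zero hd] with x ⟨l, hl⟩ hx
  have hx1 : 0 < ‖x‖ := norm_pos_iff.2 hx
  refine ⟨(‖x‖ ^ s)⁻¹ • l, (hl.const_smul (‖x‖ ^ s)⁻¹).congr fun n => ?_⟩
  rw [smul_smul, inv_mul_cancel₀ (by positivity), one_smul]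

/-- The Picard iterates of the integral equation. -/
def picard (γ α : ℝ) (u₀ : Sp d → 𝕜) : ℕ → ℝ → Sp d → 𝕜
  | 0 => fun _ _ => 0
  | n + 1 => fun t x => heat t u₀ x + duh t t (fun τ => nonlin γ α (picard γ α u₀ n τ)) x

namespace Admissible

variable {γ α s' s : ℝ} {q : ℝ≥0∞}

/-- The Lipschitz estimate for the Duhamel term. -/
theorem exists_lipschitz (𝕜 : Type*) [RCLike 𝕜] (h : Admissible d γ α s' s q) :
    ∃ K : ℝ≥0, 1 ≤ K ∧ ∀ T : ℝ, ∀ M D : ℝ≥0∞, M ≠ ⊤ → ∀ u v : ℝ → Sp d → 𝕜,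
      KatoBdd q s ((s' - s) / 2) T M u → KatoBdd q s ((s' - s) / 2) T M v →
      (∀ τ ∈ Ioo 0 T, wNorm q s (fun x => u τ x - v τ x) ≤
        D * ENNReal.ofReal (τ ^ (-((s' - s) / 2)))) → ∀ t ∈ Ioc 0 T,
      wNorm q s (fun x => duh t t (fun τ => nonlin γ α (u τ)) x -
        duh t t (fun τ => nonlin γ α (v τ)) x) ≤
        (K * M ^ (α - 1) * ENNReal.ofReal (T ^ gain d γ α s' q)) * D *
          ENNReal.ofReal (t ^ (-((s' - s) / 2))) ∧
      wNorm q s' (fun x => duh t t (fun τ => nonlin γ α (u τ)) x -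
        duh t t (fun τ => nonlin γ α (v τ)) x) ≤
        (K * M ^ (α - 1) * ENNReal.ofReal (T ^ gain d γ α s' q)) * D := by
  obtain ⟨K, hK⟩ := h.exists_duhE_le 𝕜
  refine ⟨max (K * (2 * (1 + α).toNNReal)) 1, le_max_right _ _, fun T M D hM u v hu hv hD t ht => ?_⟩
  have ht0 : 0 < t := ht.1
  have hu' := hu.mono ht.2
  have hv' := hv.mono ht.2
  obtain ⟨h1, h2⟩ := hK t ht0 _ (hu'.meas.nonlin.sub hv'.meas.nonlin) _
    (h.ae_nonlin_sub_le hu' hv' fun τ hτ => hD τ ⟨hτ.1, hτ.2.trans_le ht.2⟩)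
  have hKmax : (K : ℝ≥0∞) * (2 * ENNReal.ofReal (1 + α)) ≤
      (max (K * (2 * (1 + α).toNNReal)) 1 : ℝ≥0) := by
    have : (K * (2 * (1 + α).toNNReal)) ≤ max (K * (2 * (1 + α).toNNReal)) 1 := le_max_left _ _
    rw [ENNReal.ofReal]
    exact_mod_cast this
  have htT : ENNReal.ofReal (t ^ gain d γ α s' q) ≤ ENNReal.ofReal (T ^ gain d γ α s' q) :=
    ENNReal.ofReal_le_ofReal (Real.rpow_le_rpow ht0.le ht.2 h.gain_pos.le)
  refine ⟨((h.wNorm_duh_sub_le ht0.le le_rfl hM hu' hv').trans h1).trans ?_,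
    ((h.wNorm_duh_sub_le ht0.le le_rfl hM hu' hv').trans h2).trans ?_⟩
  · rw [sub_eq_add_neg (gain d γ α s' q), Real.rpow_add ht0, ENNReal.ofReal_mul (by positivity)]
    calc _ = (K * (2 * ENNReal.ofReal (1 + α))) * M ^ (α - 1) *
          ENNReal.ofReal (t ^ gain d γ α s' q) * D *
          ENNReal.ofReal (t ^ (-((s' - s) / 2))) := by ring
      _ ≤ _ := by gcongr
  · calc _ = (K * (2 * ENNReal.ofReal (1 + α))) * M ^ (α - 1) *
          ENNReal.ofReal (t ^ gain d γ α s' q) * D := by ring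
      _ ≤ _ := by gcongr

/-- **Local existence** by Picard iteration in the ball of radius `2 ‖e^{tΔ}u₀‖` of the Kato space,
on which the Duhamel term is a contraction with factor `1/2`. -/
theorem exists_isKatoSol_of_small (h : Admissible d γ α s' s q) {K : ℝ≥0}
    (hK : ∀ T : ℝ, ∀ M D : ℝ≥0∞, M ≠ ⊤ → ∀ u v : ℝ → Sp d → 𝕜,
      KatoBdd q s ((s' - s) / 2) T M u → KatoBdd q s ((s' - s) / 2) T M v →
      (∀ τ ∈ Ioo 0 T, wNorm q s (fun x => u τ x - v τ x) ≤
        D * ENNReal.ofReal (τ ^ (-((s' - s) / 2)))) → ∀ t ∈ Ioc 0 T,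
      wNorm q s (fun x => duh t t (fun τ => nonlin γ α (u τ)) x -
        duh t t (fun τ => nonlin γ α (v τ)) x) ≤
        (K * M ^ (α - 1) * ENNReal.ofReal (T ^ gain d γ α s' q)) * D *
          ENNReal.ofReal (t ^ (-((s' - s) / 2))))
    {T : ℝ} {u₀ : Sp d → 𝕜} (hu₀ : MemW q s' u₀) {r : ℝ≥0∞} (hr : r ≠ ⊤)
    (hrH : ∀ t ∈ Ioc 0 T, wNorm q s (heat t u₀) ≤ r * ENNReal.ofReal (t ^ (-((s' - s) / 2))))
    (hsmall : K * (2 * r) ^ (α - 1) * ENNReal.ofReal (T ^ gain d γ α s' q) ≤ 2⁻¹) :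
    ∃ u : ℝ → Sp d → 𝕜, IsKatoSol γ α q s' s T (2 * r) u₀ u ∧
      katoNorm q s' s T u ≤ 2 * r := by
  set p := picard γ α u₀ with hp
  have hM : 2 * r ≠ ⊤ := by finiteness
  have hmeas : ∀ n, SliceMeas T (p n) := by
    intro n
    induction n with
    | zero => exact .of_stronglyMeasurable stronglyMeasurable_const
    | succ n ih => exact (sliceMeas_heat hu₀.1).add ih.nonlin.duh
  have hpm : ∀ n, ∀ t ∈ Ioc 0 T, AEStronglyMeasurable (p n t) volume := by
    intro n t ht
    cases n with
    | zero => exact aestronglyMeasurable_const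
    | succ n =>
      exact (aestronglyMeasurable_heat hu₀.1).add
        (aestronglyMeasurable_duh ht.1.le ((hmeas n).mono ht.2).nonlin)
  -- the Duhamel term of a function in the ball
  have hself : ∀ u : ℝ → Sp d → 𝕜, KatoBdd q s ((s' - s) / 2) T (2 * r) u → ∀ t ∈ Ioc 0 T,
      wNorm q s (duh t t (fun τ => nonlin γ α (u τ))) ≤
        r * ENNReal.ofReal (t ^ (-((s' - s) / 2))) := by
    intro u hu t ht
    have h1 := hK T (2 * r) (2 * r) hM u (fun _ _ => 0) hu katoBdd_zero
      (fun τ hτ => by simpa using hu.bound τ hτ) t ht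
    have e : ∀ x, duh t t (fun _ => nonlin γ α (fun _ : Sp d => (0 : 𝕜))) x = 0 := by
      intro x
      simp [duh, nonlin_zero, heat]
    simp only [e, sub_zero] at h1
    refine h1.trans ?_
    calc _ ≤ 2⁻¹ * (2 * r) * ENNReal.ofReal (t ^ (-((s' - s) / 2))) := by gcongr
      _ = _ := by rw [← mul_assoc, ENNReal.inv_mul_cancel (by simp) (by simp), one_mul]
  have hbd : ∀ n, ∀ t ∈ Ioc 0 T,
      wNorm q s (p n t) ≤ 2 * r * ENNReal.ofReal (t ^ (-((s' - s) / 2))) := by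
    intro n
    induction n with
    | zero => intro t ht; simp [hp, picard, wNorm]
    | succ n ih =>
      intro t ht
      refine (wNorm_add_le h.one_le_q (aestronglyMeasurable_heat hu₀.1)
        (aestronglyMeasurable_duh ht.1.le ((hmeas n).mono ht.2).nonlin)).trans ?_
      rw [two_mul, add_mul]
      exact add_le_add (hrH t ht) (hself _ ⟨hmeas n, fun τ hτ => ih τ ⟨hτ.1, hτ.2.le⟩⟩ t ht)
  have hKB : ∀ n, KatoBdd q s ((s' - s) / 2) T (2 * r) (p n) :=
    fun n => ⟨hmeas n, fun τ hτ => hbd n τ ⟨hτ.1, hτ.2.le⟩⟩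
  have hcau : ∀ N n m, N ≤ n → N ≤ m → ∀ t ∈ Ioc 0 T, wNorm q s (fun x => p n t x - p m t x) ≤
      (4 * r * 2⁻¹ ^ N) * ENNReal.ofReal (t ^ (-((s' - s) / 2))) := by
    intro N
    induction N with
    | zero =>
      intro n m _ _ t ht
      refine (wNorm_sub_le h.one_le_q (hpm n t ht) (hpm m t ht)).trans
        ((add_le_add (hbd n t ht) (hbd m t ht)).trans (le_of_eq ?_))
      rw [pow_zero]
      ring
    | succ N ih =>
      intro n m hn hm t ht
      obtain ⟨n, rfl⟩ := Nat.exists_eq_add_of_le' (show 1 ≤ n by omega)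
      obtain ⟨m, rfl⟩ := Nat.exists_eq_add_of_le' (show 1 ≤ m by omega)
      have h1 := hK T (2 * r) _ hM _ _ (hKB n) (hKB m)
        (fun τ hτ => ih n m (by omega) (by omega) τ ⟨hτ.1, hτ.2.le⟩) t ht
      have e : (fun x => p (n + 1) t x - p (m + 1) t x) = fun x =>
          duh t t (fun τ => nonlin γ α (p n τ)) x - duh t t (fun τ => nonlin γ α (p m τ)) x := by
        ext x
        simp only [hp, picard, add_sub_add_left_eq_sub]
      rw [e]
      refine h1.trans ?_
      calc _ ≤ 2⁻¹ * (4 * r * 2⁻¹ ^ N) * ENNReal.ofReal (t ^ (-((s' - s) / 2))) := by gcongr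
        _ = _ := by rw [pow_succ]; ring
  set u : ℝ → Sp d → 𝕜 := fun t x => limUnder atTop fun n => p n t x with hu
  have hlim : ∀ t ∈ Ioc 0 T, ∀ᵐ x ∂(volume : Measure (Sp d)),
      Tendsto (fun n => p n t x) atTop (𝓝 (u t x)) := by
    intro t ht
    filter_upwards [ae_exists_tendsto_of_geometric h.one_le_d h.one_le_q (s := s)
      (f := fun n => p n t) (fun n => hpm n t ht)
      (A := 4 * r * ENNReal.ofReal (t ^ (-((s' - s) / 2)))) (by finiteness)
      (fun N n m hn hm => (hcau N n m hn hm t ht).trans (le_of_eq (by ring)))] with x hx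
    exact tendsto_nhds_limUnder hx
  have hub : ∀ t ∈ Ioc 0 T,
      wNorm q s (u t) ≤ 2 * r * ENNReal.ofReal (t ^ (-((s' - s) / 2))) := fun t ht =>
    wNorm_le_of_tendsto (fun n => hpm n t ht) (hlim t ht) (.of_forall fun n => hbd n t ht)
  have hKu : KatoBdd q s ((s' - s) / 2) T (2 * r) u :=
    ⟨.limUnder hmeas, fun τ hτ => hub τ ⟨hτ.1, hτ.2.le⟩⟩
  have hum : ∀ t ∈ Ioc 0 T, AEStronglyMeasurable (u t) volume := fun t ht =>
    aestronglyMeasurable_of_tendsto_ae atTop (fun n => hpm n t ht) (hlim t ht)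
  have hdiff : ∀ n, ∀ t ∈ Ioc 0 T, wNorm q s (fun x => p n t x - u t x) ≤
      (4 * r * 2⁻¹ ^ n) * ENNReal.ofReal (t ^ (-((s' - s) / 2))) := by
    intro n t ht
    refine wNorm_le_of_tendsto (f := fun m x => p n t x - p m t x)
      (fun m => (hpm n t ht).sub (hpm m t ht)) ?_
      (eventually_atTop.2 ⟨n, fun m hm => hcau n n m le_rfl hm t ht⟩)
    filter_upwards [hlim t ht] with x hx
    exact hx.const_sub _
  refine ⟨u, ⟨hKu, fun t ht => ?_⟩, katoNorm_le h.s_lt fun t ht0 htT => hub t ⟨ht0, htT⟩⟩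
  rcases ht.1.eq_or_lt with rfl | ht0
  · refine .of_forall fun x => ?_
    have : Tendsto (fun n => p n 0 x) atTop (𝓝 (u₀ x)) := by
      refine tendsto_const_nhds.congr' ?_
      filter_upwards [eventually_ge_atTop 1] with n hn
      obtain ⟨n, rfl⟩ := Nat.exists_eq_add_of_le' hn
      simp only [hp, picard, heat_zero, duh_zero, add_zero]
    simp only [hu, this.limUnder_eq, heat_zero, duh_zero, add_zero]
  have htI : t ∈ Ioc 0 T := ⟨ht0, ht.2⟩
  have mΦ : AEStronglyMeasurable
      (fun x => heat t u₀ x + duh t t (fun τ => nonlin γ α (u τ)) x) volume :=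
    (aestronglyMeasurable_heat hu₀.1).add
      (aestronglyMeasurable_duh ht0.le (hKu.meas.mono ht.2).nonlin)
  have hle : ∀ n, wNorm q s
      (fun x => u t x - (heat t u₀ x + duh t t (fun τ => nonlin γ α (u τ)) x)) ≤
      (4 * r * ENNReal.ofReal (t ^ (-((s' - s) / 2)))) * 2⁻¹ ^ n := by
    intro n
    have h1 := hK T (2 * r) _ hM _ _ (hKB n) hKu
      (fun τ hτ => hdiff n τ ⟨hτ.1, hτ.2.le⟩) t htI
    have h2 := hdiff (n + 1) t htI
    rw [wNorm_sub_comm] at h2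
    have e : (fun x => p (n + 1) t x - (heat t u₀ x + duh t t (fun τ => nonlin γ α (u τ)) x)) =
        fun x => duh t t (fun τ => nonlin γ α (p n τ)) x -
          duh t t (fun τ => nonlin γ α (u τ)) x := by
      ext x
      simp only [hp, picard, add_sub_add_left_eq_sub]
    rw [← e] at h1
    refine (wNorm_sub_le_add h.one_le_q (hum t htI) (hpm (n + 1) t htI) mΦ).trans
      ((add_le_add h2 (h1.trans (mul_le_mul_left (mul_le_mul_left hsmall _) _))).trans
        (le_of_eq ?_))
    calc _ = (2⁻¹ + 2⁻¹) * (4 * r * ENNReal.ofReal (t ^ (-((s' - s) / 2)))) * 2⁻¹ ^ n := by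
          rw [pow_succ]; ring
      _ = _ := by rw [ENNReal.inv_two_add_inv_two, one_mul]
  have h0 : wNorm q s
      (fun x => u t x - (heat t u₀ x + duh t t (fun τ => nonlin γ α (u τ)) x)) = 0 := by
    have t1 : Tendsto (fun n : ℕ => (4 * r * ENNReal.ofReal (t ^ (-((s' - s) / 2)))) * 2⁻¹ ^ n)
        atTop (𝓝 0) := by
      have := ENNReal.Tendsto.const_mul (a := 4 * r * ENNReal.ofReal (t ^ (-((s' - s) / 2))))
        (ENNReal.tendsto_pow_atTop_nhds_zero_of_lt_one (r := 2⁻¹) (by simp))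
        (.inr (by finiteness))
      rwa [mul_zero] at this
    exact le_antisymm (ge_of_tendsto' t1 hle) zero_le
  filter_upwards [ae_eq_zero_of_wNorm h.one_le_d h.q_ne_zero ((hum t htI).sub mΦ) h0] with x hx
  exact sub_eq_zero.1 hx

end Admissible

/-! ### Uniqueness and concatenation of Kato solutions -/

namespace IsKatoSol

variable {γ α s' s T : ℝ} {q M : ℝ≥0∞} {u₀ : Sp d → 𝕜} {u : ℝ → Sp d → 𝕜}

theorem ae_eq (hu : IsKatoSol γ α q s' s T M u₀ u) (h : Admissible d γ α s' s q) (hM : M ≠ ⊤)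
    (hu₀ : IsDatum q s' u₀) {M' : ℝ≥0∞} (hM' : M' ≠ ⊤) {v : ℝ → Sp d → 𝕜}
    (hv : IsKatoSol γ α q s' s T M' u₀ v) {t : ℝ} (ht : t ∈ Icc 0 T) : u t =ᵐ[volume] v t := by
  obtain ⟨u', -, h1, h2⟩ := hu.exists_isMildSol h hM hu₀
  obtain ⟨v', -, h3, h4⟩ := hv.exists_isMildSol h hM' hu₀
  exact (h1 t ht).trans ((h.ae_eq_of_solves h2.kato h4.kato h2.eqn h4.eqn ht).trans (h3 t ht).symm)

theorem shift (hu : IsKatoSol γ α q s' s T M u₀ u) (h : Admissible d γ α s' s q) (hM : M ≠ ⊤)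
    (hu₀ : MemW q s' u₀) {a r : ℝ} (ha : 0 ≤ a) (har : a + r ≤ T) :
    IsKatoSol γ α q s' s r M (u a) (fun τ => u (a + τ)) :=
  ⟨hu.bdd.shift h.weight_pos.le ha har, fun _ ht =>
    hu.restart_ae h hM hu₀ ha ht.1 (by linarith [ht.2])⟩

/-- Two Kato solutions that agree on an overlap can be concatenated. The overlap keeps the second
one away from its initial time, where its Kato bound is singular. -/
theorem concat (hu : IsKatoSol γ α q s' s T M u₀ u) (h : Admissible d γ α s' s q) (hM : M ≠ ⊤)
    (hu₀ : MemW q s' u₀) {a T₂ : ℝ} {M₂ : ℝ≥0∞} (hM₂ : M₂ ≠ ⊤) {v : ℝ → Sp d → 𝕜} (ha : 0 < a)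
    (haT : a < T) (hTT : T ≤ a + T₂) (hv : IsKatoSol γ α q s' s T₂ M₂ (u a) v)
    (huv : ∀ τ ∈ Icc 0 (T - a), v τ =ᵐ[volume] u (a + τ)) :
    ∃ (M' : ℝ≥0∞) (w : ℝ → Sp d → 𝕜), M' ≠ ⊤ ∧ IsKatoSol γ α q s' s (a + T₂) M' u₀ w := by
  set w : ℝ → Sp d → 𝕜 := fun t => if t < T then u t else v (t - a) with hw
  have hT0 : 0 < T := ha.trans haT
  have hwu : ∀ t ∈ Icc 0 T, w t =ᵐ[volume] u t := by
    intro t ht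
    rcases ht.2.lt_or_eq with h1 | rfl
    · simp only [hw, if_pos h1]; rfl
    · simp only [hw, lt_irrefl, if_false]
      have := huv (t - a) ⟨by linarith, le_rfl⟩
      rwa [add_sub_cancel] at this
  have hwv : ∀ τ ∈ Icc 0 T₂, w (a + τ) =ᵐ[volume] v τ := by
    intro τ hτ
    by_cases h1 : a + τ < T
    · simp only [hw, if_pos h1]
      exact (huv τ ⟨hτ.1, by linarith⟩).symm
    · simp only [hw, if_neg h1, add_sub_cancel_left]; rfl
  have hmeas : SliceMeas (a + T₂) w := by
    obtain ⟨G₁, hG₁, h1⟩ := hu.bdd.meas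
    obtain ⟨G₂, hG₂, h2⟩ := hv.bdd.meas
    refine ⟨fun t x => if t < T then G₁ t x else G₂ (t - a) x, ?_, ?_⟩
    · refine StronglyMeasurable.ite (measurable_fst measurableSet_Iio) hG₁ ?_
      exact hG₂.comp_measurable ((measurable_fst.sub measurable_const).prodMk measurable_snd)
    · rw [ae_restrict_iff' measurableSet_Ioo] at h1 h2 ⊢
      have h3 := (measurePreserving_sub_right (volume : Measure ℝ) a).quasiMeasurePreserving.ae h2
      filter_upwards [h1, h3] with t h4 h5 ht
      by_cases htT : t < T
      · simp only [hw, if_pos htT]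
        exact h4 ⟨ht.1, htT⟩
      · simp only [hw, if_neg htT]
        exact h5 ⟨by linarith [not_lt.1 htT], by linarith [ht.2]⟩
  have hc := h.weight_pos
  set θ := 1 - a / T with hθ
  have hθ0 : 0 < θ := by
    have : a / T < 1 := (div_lt_one hT0).2 haT
    linarith
  set M' : ℝ≥0∞ := M + M₂ * ENNReal.ofReal (θ ^ (-((s' - s) / 2))) with hM'
  have hM't : M' ≠ ⊤ := by finiteness
  have hbdd : KatoBdd q s ((s' - s) / 2) (a + T₂) M' w := by
    refine ⟨hmeas, fun τ hτ => ?_⟩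
    have hτ0 : 0 < τ := hτ.1
    by_cases hτT : τ < T
    · simp only [hw, if_pos hτT]
      refine (hu.bdd.bound τ ⟨hτ.1, hτT⟩).trans ?_
      gcongr
      exact le_self_add
    · simp only [hw, if_neg hτT]
      have hτT' : T ≤ τ := not_lt.1 hτT
      refine (hv.bdd.bound (τ - a) ⟨by linarith, by linarith [hτ.2]⟩).trans ?_
      calc M₂ * ENNReal.ofReal ((τ - a) ^ (-((s' - s) / 2)))
          ≤ M₂ * ENNReal.ofReal ((θ * τ) ^ (-((s' - s) / 2))) := by
            gcongr 2
            refine Real.rpow_le_rpow_of_nonpos (by positivity) ?_ (by linarith)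
            have : a ≤ a / T * τ := by
              rw [div_mul_eq_mul_div, le_div_iff₀ hT0]
              gcongr
            rw [hθ, sub_mul, one_mul]
            linarith
        _ = M₂ * ENNReal.ofReal (θ ^ (-((s' - s) / 2))) * ENNReal.ofReal (τ ^ (-((s' - s) / 2))) := by
            rw [Real.mul_rpow hθ0.le hτ0.le, ENNReal.ofReal_mul (by positivity), mul_assoc]
        _ ≤ _ := by
            gcongr
            exact le_add_self
  have hwT : ∀ t ∈ Icc 0 T, w t =ᵐ[volume] fun x =>
      heat t u₀ x + duh t t (fun τ => nonlin γ α (w τ)) x := by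
    intro t ht
    have e : duh t t (fun τ => nonlin γ α (w τ)) = duh t t (fun τ => nonlin γ α (u τ)) := by
      refine duh_congr ht.1 le_rfl ?_
      filter_upwards [ae_restrict_mem measurableSet_Ioo] with τ hτ
      exact nonlin_congr (hwu τ ⟨hτ.1.le, hτ.2.le.trans ht.2⟩)
    rw [e]
    exact (hwu t ht).trans (hu.eqn t ht)
  refine ⟨M', w, hM't, hbdd, fun t ht => ?_⟩
  by_cases htT : t ≤ T
  · exact hwT t ⟨ht.1, htT⟩
  obtain ⟨r, rfl⟩ : ∃ r, t = a + r := ⟨t - a, by ring⟩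
  have hr : r ∈ Icc 0 T₂ := ⟨by linarith [not_le.1 htT], by linarith [ht.2]⟩
  have hwa : w a = u a := by simp only [hw, if_pos haT]
  have e : duh r r (fun τ => nonlin γ α (w (a + τ))) = duh r r (fun τ => nonlin γ α (v τ)) := by
    refine duh_congr hr.1 le_rfl ?_
    filter_upwards [ae_restrict_mem measurableSet_Ioo] with τ hτ
    exact nonlin_congr (hwv τ ⟨hτ.1.le, hτ.2.le.trans hr.2⟩)
  have h1 := h.restart ha.le hr.1 hM't hu₀ (hbdd.mono ht.2) (hwT a ⟨ha.le, haT.le⟩)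
  filter_upwards [h1, hwv r hr, hv.eqn r hr] with x h2 h3 h4
  rw [h2, h3, h4, hwa, e]

end IsKatoSol

/-! ### Existence and Lipschitz dependence for small `T^δ ‖u₀‖^{α-1}` -/

namespace Admissible

variable {γ α s' s : ℝ} {q : ℝ≥0∞}

/-- **Local theory.** Existence on `[0,T]` and Lipschitz dependence on the data, under a smallness
condition on `T^δ ‖u₀‖^{α-1}`. -/
theorem exists_local (𝕜 : Type*) [RCLike 𝕜] (h : Admissible d γ α s' s q) :
    ∃ (κ : ℝ) (C : ℝ≥0), 0 < κ ∧
      (∀ T : ℝ, 0 < T → ∀ u₀ : Sp d → 𝕜, IsDatum q s' u₀ →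
        wNorm q s' u₀ ^ (α - 1) * ENNReal.ofReal (T ^ gain d γ α s' q) ≤ ENNReal.ofReal κ →
        katoNorm q s' s T (fun t => heat t u₀) ≤ C * wNorm q s' u₀ ∧
        ∃ u : ℝ → Sp d → 𝕜, IsMildSol γ α q s' s T u₀ u ∧
          katoNorm q s' s T u ≤ 2 * katoNorm q s' s T (fun t => heat t u₀)) ∧
      ∀ T : ℝ, 0 < T → ∀ R : ℝ≥0,
        (R : ℝ≥0∞) ^ (α - 1) * ENNReal.ofReal (T ^ gain d γ α s' q) ≤ ENNReal.ofReal κ →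
        ∀ u₀ v₀ : Sp d → 𝕜, IsDatum q s' u₀ → IsDatum q s' v₀ →
        wNorm q s' u₀ ≤ R → wNorm q s' v₀ ≤ R → ∀ u v : ℝ → Sp d → 𝕜,
        IsMildSol γ α q s' s T u₀ u → IsMildSol γ α q s' s T v₀ v →
        (∀ t ∈ Icc (0 : ℝ) T, wNorm q s' (u t - v t) ≤ C * wNorm q s' (u₀ - v₀)) ∧
          katoNorm q s' s T (u - v) ≤ C * wNorm q s' (u₀ - v₀) := by
  obtain ⟨K, hK1, hK⟩ := h.exists_lipschitz 𝕜
  obtain ⟨C₁, hC₁⟩ := h.exists_wNorm_heat_le 𝕜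
  obtain ⟨C₂, hC₂⟩ := h.exists_wNorm_heat_sub_le 𝕜
  have hα := h.one_lt_alpha
  set C : ℝ≥0 := max (max C₁ C₂) 1 with hC
  have hC1 : (C₁ : ℝ≥0∞) ≤ C := by exact_mod_cast (le_max_left _ _).trans (le_max_left _ _)
  have hC2 : (C₂ : ℝ≥0∞) ≤ C := by exact_mod_cast (le_max_right _ _).trans (le_max_left _ _)
  have hC3 : 1 ≤ C := le_max_right _ _
  have hC0 : 0 < C := lt_of_lt_of_le one_pos hC3
  have hK0 : 0 < K := lt_of_lt_of_le one_pos hK1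
  -- the smallness condition makes the Duhamel term a contraction with factor `1/2`
  set κ : ℝ≥0 := (2 * (K * (2 * C) ^ (α - 1)))⁻¹ with hκ
  have hκ0 : 0 < κ := by positivity
  have hsmall : ∀ (T : ℝ) (R r : ℝ≥0∞), r ≤ C * R →
      R ^ (α - 1) * ENNReal.ofReal (T ^ gain d γ α s' q) ≤ ENNReal.ofReal κ →
      K * (2 * r) ^ (α - 1) * ENNReal.ofReal (T ^ gain d γ α s' q) ≤ 2⁻¹ := by
    intro T R r hr hR
    have hα1 : 0 ≤ α - 1 := by linarith
    calc K * (2 * r) ^ (α - 1) * ENNReal.ofReal (T ^ gain d γ α s' q)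
        ≤ K * (2 * (C * R)) ^ (α - 1) * ENNReal.ofReal (T ^ gain d γ α s' q) := by gcongr
      _ = (K * (2 * C) ^ (α - 1)) * (R ^ (α - 1) * ENNReal.ofReal (T ^ gain d γ α s' q)) := by
          rw [← mul_assoc 2, ENNReal.mul_rpow_of_nonneg _ _ hα1]; ring
      _ ≤ (K * (2 * C) ^ (α - 1)) * ENNReal.ofReal κ := by gcongr
      _ = ((K * (2 * C) ^ (α - 1) * κ : ℝ≥0) : ℝ≥0∞) := by
          rw [ENNReal.ofReal_coe_nnreal]
          push_cast
          rw [ENNReal.coe_rpow_of_nonneg _ hα1]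
          push_cast
          rfl
      _ = ((2⁻¹ : ℝ≥0) : ℝ≥0∞) := by
          congr 1
          rw [hκ, mul_inv]
          have : K * (2 * C) ^ (α - 1) ≠ 0 := by positivity
          field_simp
      _ = 2⁻¹ := by simp
  have hheat : ∀ (T : ℝ) (u₀ : Sp d → 𝕜), IsDatum q s' u₀ →
      katoNorm q s' s T (fun t => heat t u₀) ≤ C * wNorm q s' u₀ := by
    intro T u₀ hu₀
    refine katoNorm_le h.s_lt fun t ht _ => ((hC₁ t ht.le u₀ hu₀.1).2 ht).trans ?_
    gcongr
  have hexist : ∀ T : ℝ, 0 < T → ∀ u₀ : Sp d → 𝕜, IsDatum q s' u₀ →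
      wNorm q s' u₀ ^ (α - 1) * ENNReal.ofReal (T ^ gain d γ α s' q) ≤ ENNReal.ofReal κ →
      ∃ u : ℝ → Sp d → 𝕜, IsMildSol γ α q s' s T u₀ u ∧
        katoNorm q s' s T u ≤ 2 * katoNorm q s' s T (fun t => heat t u₀) := by
    intro T hT u₀ hu₀ hs
    have hr : katoNorm q s' s T (fun t => heat t u₀) ≠ ⊤ := by
      refine ne_top_of_le_ne_top ?_ (hheat T u₀ hu₀)
      have := hu₀.1.2
      finiteness
    obtain ⟨u, h1, h2⟩ := h.exists_isKatoSol_of_small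
      (fun T M D hM u v hu hv hD t ht => (hK T M D hM u v hu hv hD t ht).1) hu₀.1 hr
      (fun t ht => wNorm_le_katoNorm (fun t => heat t u₀) ht.1 ht.2)
      (hsmall T _ _ (hheat T u₀ hu₀) hs)
    obtain ⟨v, -, h3, h4⟩ := h1.exists_isMildSol h (by finiteness) hu₀
    exact ⟨v, h4, by rwa [← katoNorm_congr h3]⟩
  refine ⟨κ, 2 * C, by exact_mod_cast hκ0, fun T hT u₀ hu₀ hs => ⟨(hheat T u₀ hu₀).trans ?_,
    hexist T hT u₀ hu₀ hs⟩, fun T hT R hR u₀ v₀ hu₀ hv₀ hu₀R hv₀R u v hu hv => ?_⟩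
  · gcongr
    exact le_mul_of_one_le_left zero_le one_le_two
  have hα1 : 0 ≤ α - 1 := by linarith
  have hbound : ∀ (u₀ : Sp d → 𝕜) (u : ℝ → Sp d → 𝕜), IsDatum q s' u₀ → wNorm q s' u₀ ≤ R →
      IsMildSol γ α q s' s T u₀ u → katoNorm q s' s T u ≤ 2 * (C * R) := by
    intro u₀ u hu₀ hu₀R hu
    obtain ⟨w, h1, h2⟩ := hexist T hT u₀ hu₀ (le_trans (by gcongr) hR)
    rw [katoNorm_congr fun t ht => h.ae_eq_of_solves hu.kato h1.kato hu.eqn h1.eqn ht]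
    refine h2.trans ?_
    gcongr
    exact (hheat T u₀ hu₀).trans (by gcongr)
  have hMt : (2 * (C * R) : ℝ≥0∞) ≠ ⊤ := by finiteness
  have hku := hbound u₀ u hu₀ hu₀R hu
  have hkv := hbound v₀ v hv₀ hv₀R hv
  have hu' := hu.isKatoSol le_rfl
  have hv' := hv.isKatoSol le_rfl
  have hmu : ∀ t ∈ Icc 0 T, AEStronglyMeasurable (u t) volume := fun t ht => (hu.cont.1 t ht).1
  have hmv : ∀ t ∈ Icc 0 T, AEStronglyMeasurable (v t) volume := fun t ht => (hv.cont.1 t ht).1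
  set E := katoNorm q s' s T (u - v) with hE
  have hEt : E ≠ ⊤ := by
    refine ne_top_of_le_ne_top (ENNReal.add_ne_top.2 ⟨ne_top_of_le_ne_top hMt hku,
      ne_top_of_le_ne_top hMt hkv⟩) (katoNorm_le h.s_lt fun t ht0 htT => ?_)
    refine (wNorm_sub_le h.one_le_q (hmu t ⟨ht0.le, htT⟩) (hmv t ⟨ht0.le, htT⟩)).trans ?_
    rw [add_mul]
    exact add_le_add (wNorm_le_katoNorm u ht0 htT) (wNorm_le_katoNorm v ht0 htT)
  have hlip := hK T _ E hMt u v (hu'.bdd.mono_right hku) (hv'.bdd.mono_right hkv)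
    (fun τ hτ => wNorm_le_katoNorm (u - v) hτ.1 hτ.2.le)
  have hsm := hsmall T R (C * R) le_rfl hR
  have mH : AEStronglyMeasurable u₀ volume := hu₀.1.1
  have hdec : ∀ t ∈ Icc 0 T, ∀ σ, wNorm q σ (u t - v t) ≤
      wNorm q σ (fun x => heat t u₀ x - heat t v₀ x) +
        wNorm q σ (fun x => duh t t (fun τ => nonlin γ α (u τ)) x -
          duh t t (fun τ => nonlin γ α (v τ)) x) := by
    intro t ht σ
    refine le_trans (le_of_eq (wNorm_congr ?_)) (wNorm_add_le h.one_le_q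
      ((aestronglyMeasurable_heat mH).sub (aestronglyMeasurable_heat hv₀.1.1))
      ((aestronglyMeasurable_duh ht.1 (hu'.bdd.meas.mono ht.2).nonlin).sub
        (aestronglyMeasurable_duh ht.1 (hv'.bdd.meas.mono ht.2).nonlin)))
    filter_upwards [hu'.eqn t ht, hv'.eqn t ht] with x h1 h2
    rw [Pi.sub_apply, h1, h2]
    ring
  set D := wNorm q s' (u₀ - v₀) with hD
  have hE2 : E ≤ C * D + 2⁻¹ * E := by
    refine katoNorm_le h.s_lt fun t ht0 htT => ?_
    refine (hdec t ⟨ht0.le, htT⟩ s).trans ?_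
    rw [add_mul]
    refine add_le_add (((hC₂ t ht0.le u₀ v₀ hu₀.1 hv₀.1).2 ht0).trans ?_)
      ((hlip t ⟨ht0, htT⟩).1.trans ?_)
    · change C₂ * D * _ ≤ _
      gcongr
    · gcongr
  have hE3 : 2⁻¹ * E ≤ C * D := by
    have e : 2⁻¹ * E + 2⁻¹ * E = E := by rw [← add_mul, ENNReal.inv_two_add_inv_two, one_mul]
    have h3 : 2⁻¹ * E + 2⁻¹ * E ≤ C * D + 2⁻¹ * E := e.le.trans hE2
    exact ENNReal.le_of_add_le_add_right (by finiteness) h3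
  refine ⟨fun t ht => ?_, hE2.trans ((add_le_add le_rfl hE3).trans (le_of_eq ?_))⟩
  · rcases ht.1.eq_or_lt with rfl | ht0
    · have e : wNorm q s' (u 0 - v 0) = D := wNorm_congr
        ((hu'.zero_ae hT.le).sub (hv'.zero_ae hT.le))
      rw [e]
      refine le_mul_of_one_le_left zero_le ?_
      have : (1 : ℝ≥0) ≤ 2 * C := by
        calc (1 : ℝ≥0) = 1 * 1 := (one_mul 1).symm
          _ ≤ 2 * C := by gcongr; exact one_le_two
      exact_mod_cast this
    refine (hdec t ht s').trans ((add_le_add ((hC₂ t ht.1 u₀ v₀ hu₀.1 hv₀.1).1)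
      (hlip t ⟨ht0, ht.2⟩).2).trans ?_)
    calc _ ≤ C * D + 2⁻¹ * E := by
          refine add_le_add ?_ (by gcongr)
          change C₂ * D ≤ _
          gcongr
      _ ≤ C * D + C * D := by gcongr
      _ = _ := by push_cast; ring
  · push_cast; ring

end Admissible

/-! ### The maximal solution -/

section Maximal

variable {γ α s' s : ℝ} {q : ℝ≥0∞} {u₀ : Sp d → 𝕜}

theorem IsMildSol.le_maxTime (h : Admissible d γ α s' s q) {T : ℝ} (hT : 0 < T)
    {u : ℝ → Sp d → 𝕜} (hu : IsMildSol γ α q s' s T u₀ u) :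
    ENNReal.ofReal T ≤ maxTime γ α q s' s u₀ :=
  le_sSup ⟨T, hT, rfl, u, hu, fun _ hv _ ht =>
    h.ae_eq_of_solves hv.kato hu.kato hv.eqn hu.eqn ht⟩

theorem exists_isMildSol_of_lt_maxTime (h : Admissible d γ α s' s q) (hu₀ : IsDatum q s' u₀)
    {T : ℝ} (hT : 0 < T) (hTm : ENNReal.ofReal T < maxTime γ α q s' s u₀) :
    ∃ u : ℝ → Sp d → 𝕜, StronglyMeasurable (Function.uncurry u) ∧ IsMildSol γ α q s' s T u₀ u := by
  obtain ⟨_, ⟨T', hT', rfl, v, hv, -⟩, hlt⟩ := lt_sSup_iff.1 hTm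
  have hTT' : T < T' := (ENNReal.ofReal_lt_ofReal_iff hT').1 hlt
  obtain ⟨u, h1, -, h2⟩ :=
    (hv.isKatoSol hTT'.le).exists_isMildSol h (hv.kato.2.2 T ⟨hT, hTT'⟩).ne hu₀
  exact ⟨u, h1, h2⟩

/-- The solutions on the intervals `[0,r]`, with `r < T_m` rational, are glued by choosing for each
time the first interval that contains it. -/
theorem exists_isMaximalSol (h : Admissible d γ α s' s q) (hu₀ : IsDatum q s' u₀) :
    ∃ u : ℝ → Sp d → 𝕜, IsMaximalSol γ α q s' s u₀ u := by
  classical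
  obtain ⟨e, he⟩ := exists_surjective_nat ℚ
  let good : ℕ → Prop := fun n => 0 < (e n : ℝ) ∧
    ENNReal.ofReal (e n) < maxTime γ α q s' s u₀
  have hV : ∀ n, ∃ v : ℝ → Sp d → 𝕜, StronglyMeasurable (Function.uncurry v) ∧
      (good n → IsMildSol γ α q s' s (e n) u₀ v) := by
    intro n
    by_cases hn : good n
    · obtain ⟨v, h1, h2⟩ := exists_isMildSol_of_lt_maxTime h hu₀ hn.1 hn.2
      exact ⟨v, h1, fun _ => h2⟩
    · exact ⟨fun _ _ => 0, stronglyMeasurable_const, fun hg => absurd hg hn⟩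
  choose V hVm hVs using hV
  let P : ℕ → ℝ × Sp d → Prop := fun n p =>
    (good n ∧ p.1 ≤ e n) ∨ ∀ m, ¬(good m ∧ p.1 ≤ e m)
  have hP : ∀ p, ∃ n, P n p := by
    intro p
    by_cases hp : ∃ m, good m ∧ p.1 ≤ e m
    · exact hp.imp fun m hm => .inl hm
    · exact ⟨0, .inr (not_exists.1 hp)⟩
  have hPm : ∀ n, MeasurableSet {p : ℝ × Sp d | P n p} := by
    have h1 : ∀ n, MeasurableSet {p : ℝ × Sp d | good n ∧ p.1 ≤ e n} := fun n =>
      (MeasurableSet.const _).inter (measurable_fst measurableSet_Iic)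
    intro n
    refine (h1 n).union ?_
    have : {p : ℝ × Sp d | ∀ m, ¬(good m ∧ p.1 ≤ e m)} =
        ⋂ m, {p : ℝ × Sp d | good m ∧ p.1 ≤ e m}ᶜ := by
      ext p; simp
    change MeasurableSet {p : ℝ × Sp d | ∀ m, ¬(good m ∧ p.1 ≤ e m)}
    rw [this]
    exact MeasurableSet.iInter fun m => (h1 m).compl
  have hum : Measurable fun p : ℝ × Sp d => Function.uncurry (V (Nat.find (hP p))) p :=
    Measurable.find (f := fun n => Function.uncurry (V n)) (fun n => (hVm n).measurable) hPm hP
  refine ⟨fun t x => V (Nat.find (hP (t, x))) t x, fun T hT hTm => ?_⟩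
  -- a rational time after `T`
  obtain ⟨r, hr1, hr2⟩ : ∃ r : ℚ, T < r ∧ ENNReal.ofReal r < maxTime γ α q s' s u₀ := by
    obtain ⟨_, ⟨T', hT', rfl, hv⟩, hlt⟩ := lt_sSup_iff.1 hTm
    have hTT' : T < T' := (ENNReal.ofReal_lt_ofReal_iff hT').1 hlt
    obtain ⟨r, h1, h2⟩ := exists_rat_btwn hTT'
    refine ⟨r, h1, lt_of_lt_of_le ((ENNReal.ofReal_lt_ofReal_iff hT').2 h2) ?_⟩
    exact le_sSup ⟨T', hT', rfl, hv⟩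
  obtain ⟨m, rfl⟩ := he r
  have hm : good m := ⟨hT.trans hr1, hr2⟩
  refine ((hVs m hm).mono hr1.le).congr (fun t ht => ?_) hum.stronglyMeasurable.aestronglyMeasurable
  have hall : ∀ᵐ x ∂(volume : Measure (Sp d)), ∀ n, good n ∧ t ≤ e n → V m t x = V n t x := by
    refine ae_all_iff.2 fun n => ?_
    by_cases hn : good n ∧ t ≤ e n
    · have h1 := hVs m hm
      have h2 := hVs n hn.1
      set τ : ℝ := min (e m) (e n) with hτ
      have h1' := h1.mono (min_le_left (e m : ℝ) (e n))
      have h2' := h2.mono (min_le_right (e m : ℝ) (e n))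
      filter_upwards [h.ae_eq_of_solves h1'.kato h2'.kato h1'.eqn h2'.eqn
        (t := t) ⟨ht.1, le_min (ht.2.trans hr1.le) hn.2⟩] with x hx _
      exact hx
    · exact .of_forall fun x hx => absurd hx hn
  filter_upwards [hall] with x hx
  refine hx _ ?_
  have hspec : P (Nat.find (hP (t, x))) (t, x) := Nat.find_spec (hP (t, x))
  rcases hspec with h1 | h1
  · exact h1
  · exact absurd ⟨hm, ht.2.trans hr1.le⟩ (h1 m)

end Maximal

/-! ### Continuation and the time of existence -/

section Continuation

variable {γ α s' s : ℝ} {q : ℝ≥0∞} {u₀ : Sp d → 𝕜}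

/-- A mild solution extends beyond time `a` as long as a solution with datum `u(a)` exists. -/
theorem IsMildSol.add_le_maxTime (h : Admissible d γ α s' s q) (hu₀ : IsDatum q s' u₀)
    {T₁ a T₂ : ℝ} {u v : ℝ → Sp d → 𝕜} (hu : IsMildSol γ α q s' s T₁ u₀ u) (ha : 0 < a)
    (haT : a < T₁) (hT₂ : 0 < T₂) (hv : IsMildSol γ α q s' s T₂ (u a) v)
    (hvt : katoNorm q s' s T₂ v ≠ ⊤) : ENNReal.ofReal (a + T₂) ≤ maxTime γ α q s' s u₀ := by
  rcases le_or_gt (a + T₂) T₁ with hle | hlt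
  · exact (hu.mono hle).le_maxTime h (by linarith)
  obtain ⟨T, haT', hTT⟩ := exists_between haT
  have hMt : katoNorm q s' s T u ≠ ⊤ := (hu.kato.2.2 T ⟨ha.trans haT', hTT⟩).ne
  have hu' := hu.isKatoSol hTT.le
  have hua : IsDatum q s' (u a) := hu'.isDatum h hMt hu₀ ⟨ha.le, haT'.le⟩
  have hv' := hv.isKatoSol le_rfl
  have hsh := hu'.shift h hMt hu₀.1 ha.le (by linarith : a + (T - a) ≤ T)
  obtain ⟨M', w, hM', hw⟩ := hu'.concat h hMt hu₀.1 hvt ha haT' (by linarith) hv'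
    fun τ hτ => ((hsh.ae_eq h hMt hua hvt (hv'.mono (by linarith)) hτ).symm)
  obtain ⟨w', -, -, hw'⟩ := hw.exists_isMildSol h hM' hu₀
  exact hw'.le_maxTime h (by linarith)

end Continuation

theorem gain_div_eq {γ α s' : ℝ} {q : ℝ≥0∞} (hα : 1 < α) :
    gain d γ α s' q / (α - 1) = (critWeight d γ α q - s') / 2 := by
  have : α - 1 ≠ 0 := by linarith
  unfold gain critWeight
  field_simp
  ring

/-- The exponent conditions of the theorem imply those used in the estimates. -/
theorem Admissible.of_conditions {γ α s' s : ℝ} {q : ℝ≥0∞} (hd : 1 ≤ d)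
    (hγ : -min (2 : ℝ) d < γ) (hα : fujitaExp d γ < α) (hq : ENNReal.ofReal α ≤ q)
    (hq_upper : invExp q < 1 / d * ((2 + γ) / (α - 1) - s'))
    (hs_lower : (s' + γ) / α ≤ s) (hs_lower' : -d * invExp q < s)
    (hs_upper : s < min ((d + γ) / α - d * invExp q) s') : Admissible d γ α s' s q := by
  have hd0 : (0 : ℝ) < d := by exact_mod_cast hd
  have hγ2 : 0 < 2 + γ := by
    have := min_le_left (2 : ℝ) d
    linarith
  have hα1 : 1 < α := by
    refine lt_trans ?_ hα
    unfold fujitaExp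
    have : 0 < (2 + γ) / d := by positivity
    linarith
  have hα0 : 0 < α := by linarith
  have hα2 : 0 < α - 1 := by linarith
  refine ⟨hd, hα1, hq, hs_lower', hs_upper.trans_le (min_le_right _ _), ?_, ?_, ?_⟩
  · rw [div_le_iff₀ hα0] at hs_lower
    linarith
  · have h1 := hs_upper.trans_le (min_le_left _ _)
    have h2 : s + d * invExp q < (d + γ) / α := by linarith
    rw [lt_div_iff₀ hα0] at h2
    linarith
  · have h1 : d * invExp q < (2 + γ) / (α - 1) - s' := by
      have := mul_lt_mul_of_pos_left hq_upper hd0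
      rwa [← mul_assoc, mul_one_div_cancel hd0.ne', one_mul] at this
    have h2 : s' + d * invExp q < (2 + γ) / (α - 1) := by linarith
    rw [lt_div_iff₀ hα2] at h2
    linarith

/-- The time of existence `(κ^{1/δ}/2) (1 + r)^{-(α-1)/δ}` as a function of the norm of the datum.
The factor `1/2` keeps it strictly below the maximal time. -/
def existTime (κ δ α : ℝ) (r : ℝ≥0∞) : ℝ :=
  κ ^ δ⁻¹ / 2 * (1 + r.toReal) ^ (-((α - 1) / δ))

theorem existTime_pos {κ : ℝ} (hκ : 0 < κ) (δ α : ℝ) (r : ℝ≥0∞) : 0 < existTime κ δ α r := by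
  have : 0 ≤ r.toReal := ENNReal.toReal_nonneg
  unfold existTime
  positivity

theorem existTime_anti {κ δ α : ℝ} (hκ : 0 < κ) (hδ : 0 < δ) (hα : 1 < α) {r R : ℝ≥0∞} (hR : R ≠ ⊤)
    (h : r ≤ R) : existTime κ δ α R ≤ existTime κ δ α r := by
  have h0 : 0 ≤ r.toReal := ENNReal.toReal_nonneg
  have h1 : r.toReal ≤ R.toReal := ENNReal.toReal_mono hR h
  unfold existTime
  gcongr ?_ * ?_
  refine Real.rpow_le_rpow_of_nonpos (by linarith) (by linarith) ?_
  have : 0 ≤ (α - 1) / δ := div_nonneg (by linarith) hδ.le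
  linarith

theorem rpow_mul_existTime_le {κ δ α : ℝ} (hκ : 0 < κ) (hδ : 0 < δ) (hα : 1 < α) {r : ℝ≥0∞}
    (hr : r ≠ ⊤) :
    r ^ (α - 1) * ENNReal.ofReal ((2 * existTime κ δ α r) ^ δ) ≤ ENNReal.ofReal κ := by
  have h0 : 0 ≤ r.toReal := ENNReal.toReal_nonneg
  have hα1 : 0 < α - 1 := by linarith
  have e : (2 * existTime κ δ α r) ^ δ = κ * (1 + r.toReal) ^ (-(α - 1)) := by
    have h2 : 2 * existTime κ δ α r = κ ^ δ⁻¹ * (1 + r.toReal) ^ (-((α - 1) / δ)) := by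
      unfold existTime; ring
    rw [h2, Real.mul_rpow (by positivity) (by positivity), ← Real.rpow_mul hκ.le,
      ← Real.rpow_mul (by positivity), inv_mul_cancel₀ hδ.ne', Real.rpow_one, neg_mul,
      div_mul_cancel₀ _ hδ.ne']
  conv_lhs => rw [e, ← ENNReal.ofReal_toReal hr]
  rw [ENNReal.ofReal_rpow_of_nonneg h0 hα1.le, ← ENNReal.ofReal_mul (by positivity)]
  refine ENNReal.ofReal_le_ofReal ?_
  rw [ENNReal.toReal_ofReal h0, Real.rpow_neg (by positivity)]
  have h3 : r.toReal ^ (α - 1) ≤ (1 + r.toReal) ^ (α - 1) :=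
    Real.rpow_le_rpow h0 (by linarith) hα1.le
  have h4 : 0 < (1 + r.toReal) ^ (α - 1) := by positivity
  calc _ = κ * (r.toReal ^ (α - 1) * ((1 + r.toReal) ^ (α - 1))⁻¹) := by ring
    _ ≤ κ * 1 := by
        gcongr
        rw [← div_eq_mul_inv]
        exact (div_le_one h4).2 h3
    _ = κ := mul_one κ

/-- The blow-up rate as a consequence of the continuation criterion. -/
theorem le_of_lt_rpow_mul {κ δ α θ : ℝ} (hκ : 0 < κ) (hα : 1 < α) (hθ : 0 < θ)
    {N : ℝ≥0∞} (hN : ENNReal.ofReal κ < N ^ (α - 1) * ENNReal.ofReal ((2 * θ) ^ δ)) :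
    ENNReal.ofReal ((κ / 2 ^ δ) ^ (α - 1)⁻¹ / θ ^ (δ / (α - 1))) ≤ N := by
  have hα1 : 0 < α - 1 := by linarith
  rw [← ENNReal.rpow_le_rpow_iff hα1, ENNReal.ofReal_rpow_of_pos (by positivity),
    Real.div_rpow (by positivity) (by positivity), ← Real.rpow_mul (by positivity),
    ← Real.rpow_mul hθ.le, inv_mul_cancel₀ hα1.ne', Real.rpow_one, div_mul_cancel₀ _ hα1.ne']
  have h1 : κ / 2 ^ δ / θ ^ δ = κ / (2 * θ) ^ δ := by
    rw [Real.mul_rpow (by norm_num) hθ.le, div_div]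
  rw [h1, ENNReal.ofReal_div_of_pos (by positivity)]
  exact ENNReal.div_le_of_le_mul hN.le

theorem tendsto_ofReal_div_rpow {C ρ T : ℝ} (hC : 0 < C) (hρ : 0 < ρ) :
    Tendsto (fun t => ENNReal.ofReal (C / (T - t) ^ ρ)) (𝓝[<] T) (𝓝 ⊤) := by
  refine ENNReal.tendsto_ofReal_nhds_top.2 ?_
  have t1 : Tendsto (fun t : ℝ => T - t) (𝓝[<] T) (𝓝[>] 0) := by
    refine tendsto_nhdsWithin_iff.2 ⟨?_, ?_⟩
    · have : Tendsto (fun t : ℝ => T - t) (𝓝 T) (𝓝 (T - T)) := tendsto_id.const_sub T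
      rw [sub_self] at this
      exact this.mono_left nhdsWithin_le_nhds
    · filter_upwards [self_mem_nhdsWithin] with t ht
      exact sub_pos.2 (mem_Iio.1 ht)
  have t2 := ((tendsto_rpow_neg_nhdsGT_zero (y := -ρ) (by linarith)).comp t1).const_mul_atTop hC
  refine t2.congr' ?_
  filter_upwards [self_mem_nhdsWithin] with t ht
  have : 0 < T - t := sub_pos.2 (mem_Iio.1 ht)
  rw [Function.comp_apply, Real.rpow_neg this.le, div_eq_mul_inv]

end HardyHenon

end

open HardyHenon in
/-- Here `s'` stands for `s̃`. -/
theorem theorem1p3 {𝕜 : Type*} [RCLike 𝕜] (d : ℕ) (hd : 1 ≤ d) (γ α s' s : ℝ) (q : ℝ≥0∞)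
    (hγ : -min (2 : ℝ) d < γ) (hα : fujitaExp d γ < α)
    (hs'_lower : max (-(d : ℝ) / α) (γ / (α - 1)) < s')
    (hs'_upper : s' < (2 + γ) / (α - 1))
    (hq_one : 1 ≤ q) (hq : ENNReal.ofReal α ≤ q)
    (hq_lower : -s' / d < invExp q)
    (hq_upper : invExp q < min (2 / (d * (α - 1)))
      (min (1 / α * (1 - s' / d)) (1 / d * ((2 + γ) / (α - 1) - s'))))
    (hs_lower : (s' + γ) / α ≤ s) (hs_lower' : -d * invExp q < s)
    (hs_upper : s < min ((d + γ) / α - d * invExp q) s') :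
    ∃ 𝒯 : ℝ≥0∞ → ℝ, (∀ r, 0 < 𝒯 r) ∧
      -- (i) existence on an interval depending only on the norm of the datum, maximal extension
      (∀ u₀ : Sp d → 𝕜, IsDatum q s' u₀ → ∃ u : ℝ → Sp d → 𝕜,
        IsMildSol γ α q s' s (𝒯 (wNorm q s' u₀)) u₀ u ∧
        katoNorm q s' s (𝒯 (wNorm q s' u₀)) (fun t => heat t u₀) < ⊤ ∧
        katoNorm q s' s (𝒯 (wNorm q s' u₀)) u
          ≤ 2 * katoNorm q s' s (𝒯 (wNorm q s' u₀)) (fun t => heat t u₀) ∧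
        IsMaximalSol γ α q s' s u₀ u) ∧
      -- (ii) uniqueness in the Kato space
      (∀ T : ℝ, 0 < T → ∀ u₀ : Sp d → 𝕜, MemW q s' u₀ → ∀ u v : ℝ → Sp d → 𝕜,
        IsKato q s' s T u → IsKato q s' s T v →
        SolvesIntegralEq γ α T u₀ u → SolvesIntegralEq γ α T u₀ v →
        ∀ t ∈ Icc (0 : ℝ) T, u t =ᵐ[volume] v t) ∧
      -- (iii) Lipschitz dependence on the data, with constants uniform on bounded sets of data
      (∀ R : ℝ≥0, ∃ C : ℝ≥0, ∃ T : ℝ, 0 < T ∧ ∀ u₀ v₀ : Sp d → 𝕜,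
        IsDatum q s' u₀ → IsDatum q s' v₀ → wNorm q s' u₀ ≤ R → wNorm q s' v₀ ≤ R →
        T ≤ min (𝒯 (wNorm q s' u₀)) (𝒯 (wNorm q s' v₀)) ∧
        ∀ u v : ℝ → Sp d → 𝕜,
          IsMildSol γ α q s' s (𝒯 (wNorm q s' u₀)) u₀ u →
          IsMildSol γ α q s' s (𝒯 (wNorm q s' v₀)) v₀ v →
          (∀ t ∈ Icc (0 : ℝ) T, wNorm q s' (u t - v t) ≤ C * wNorm q s' (u₀ - v₀)) ∧
          katoNorm q s' s T (u - v) ≤ C * wNorm q s' (u₀ - v₀)) ∧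
      -- (iv) blow-up criterion and lower bound of the blow-up rate
      (∀ u₀ : Sp d → 𝕜, IsDatum q s' u₀ → maxTime γ α q s' s u₀ < ⊤ →
        ∀ u : ℝ → Sp d → 𝕜, IsMaximalSol γ α q s' s u₀ u →
        Tendsto (fun t => wNorm q s' (u t)) (𝓝[<] (maxTime γ α q s' s u₀).toReal) (𝓝 ⊤) ∧
        ∃ C : ℝ, 0 < C ∧ ∀ t ∈ Ioo (0 : ℝ) (maxTime γ α q s' s u₀).toReal,
          ENNReal.ofReal
              (C / ((maxTime γ α q s' s u₀).toReal - t) ^ ((critWeight d γ α q - s') / 2))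
            ≤ wNorm q s' (u t)) := by
  have h : Admissible d γ α s' s q := .of_conditions hd hγ hα hq
    (hq_upper.trans_le ((min_le_right _ _).trans (min_le_right _ _))) hs_lower hs_lower' hs_upper
  have hα1 := h.one_lt_alpha
  have hδ := h.gain_pos
  set δ := gain d γ α s' q with hδdef
  obtain ⟨κ, C, hκ, hloc, hlip⟩ := h.exists_local 𝕜
  set 𝒯 : ℝ≥0∞ → ℝ := existTime κ δ α with h𝒯
  have h𝒯0 : ∀ r, 0 < 𝒯 r := existTime_pos hκ δ α
  have hsm : ∀ r : ℝ≥0∞, r ≠ ⊤ →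
      r ^ (α - 1) * ENNReal.ofReal ((2 * 𝒯 r) ^ δ) ≤ ENNReal.ofReal κ :=
    fun r hr => rpow_mul_existTime_le hκ hδ hα1 hr
  have hsm' : ∀ r : ℝ≥0∞, r ≠ ⊤ →
      r ^ (α - 1) * ENNReal.ofReal (𝒯 r ^ δ) ≤ ENNReal.ofReal κ := by
    intro r hr
    refine le_trans ?_ (hsm r hr)
    have := h𝒯0 r
    gcongr
    linarith
  have hlt : ∀ u₀ : Sp d → 𝕜, IsDatum q s' u₀ →
      ENNReal.ofReal (𝒯 (wNorm q s' u₀)) < maxTime γ α q s' s u₀ := by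
    intro u₀ hu₀
    have h0 := h𝒯0 (wNorm q s' u₀)
    obtain ⟨-, u, hu, -⟩ := hloc _ (by linarith) u₀ hu₀ (hsm _ hu₀.1.2.ne)
    refine lt_of_lt_of_le ?_ (hu.le_maxTime h (by linarith))
    exact (ENNReal.ofReal_lt_ofReal_iff (by linarith)).2 (by linarith)
  refine ⟨𝒯, h𝒯0, fun u₀ hu₀ => ?_, fun T _ u₀ _ u v hu hv hue hve t ht =>
    h.ae_eq_of_solves hu hv hue hve ht, fun R => ⟨C, 𝒯 R, h𝒯0 _, fun u₀ v₀ hu₀ hv₀ hu₀R hv₀R => ?_⟩,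
    fun u₀ hu₀ hTm u hu => ?_⟩
  · obtain ⟨u, hu⟩ := exists_isMaximalSol h hu₀
    have hu1 := hu _ (h𝒯0 _) (hlt u₀ hu₀)
    obtain ⟨hH, v, hv, hvK⟩ := hloc _ (h𝒯0 _) u₀ hu₀ (hsm' _ hu₀.1.2.ne)
    refine ⟨u, hu1, lt_of_le_of_lt hH ?_, ?_, hu⟩
    · have := hu₀.1.2
      finiteness
    · rwa [katoNorm_congr fun t ht => h.ae_eq_of_solves hu1.kato hv.kato hu1.eqn hv.eqn ht]
  · have hu𝒯 := existTime_anti hκ hδ hα1 ENNReal.coe_ne_top hu₀R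
    have hv𝒯 := existTime_anti hκ hδ hα1 ENNReal.coe_ne_top hv₀R
    exact ⟨le_min hu𝒯 hv𝒯, fun u v hu hv => hlip _ (h𝒯0 _) R (hsm' _ ENNReal.coe_ne_top) u₀ v₀ hu₀ hv₀
      hu₀R hv₀R u v (hu.mono hu𝒯) (hv.mono hv𝒯)⟩
  · set Tm := (maxTime γ α q s' s u₀).toReal with hTmdef
    have hTm0 : 0 < Tm := ENNReal.toReal_pos ((zero_le.trans_lt (hlt u₀ hu₀)).ne') hTm.ne
    have hof : ENNReal.ofReal Tm = maxTime γ α q s' s u₀ := ENNReal.ofReal_toReal hTm.ne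
    have hC : 0 < (κ / 2 ^ δ) ^ (α - 1)⁻¹ := by positivity
    have key : ∀ t ∈ Ioo 0 Tm, ENNReal.ofReal ((κ / 2 ^ δ) ^ (α - 1)⁻¹ /
        (Tm - t) ^ ((critWeight d γ α q - s') / 2)) ≤ wNorm q s' (u t) := by
      intro t ht
      have hθ : 0 < Tm - t := by linarith [ht.2]
      rw [← gain_div_eq hα1]
      refine le_of_lt_rpow_mul hκ hα1 hθ (not_le.1 fun hle => ?_)
      -- otherwise the solution extends to the time `t + 2 (T_m - t)`
      obtain ⟨T₁, h1, h2⟩ := exists_between ht.2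
      have hu1 : IsMildSol γ α q s' s T₁ u₀ u := hu T₁ (ht.1.trans h1) (by
        rw [← hof]
        exact (ENNReal.ofReal_lt_ofReal_iff hTm0).2 h2)
      have hut : IsDatum q s' (u t) := (hu1.isKatoSol h1.le).isDatum h
        (hu1.kato.2.2 t ⟨ht.1, h1⟩).ne hu₀ ⟨ht.1.le, le_rfl⟩
      obtain ⟨hH, v, hv, hvK⟩ := hloc (2 * (Tm - t)) (by linarith) (u t) hut hle
      have hvt : katoNorm q s' s (2 * (Tm - t)) v ≠ ⊤ := by
        refine ne_top_of_le_ne_top ?_ hvK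
        have h3 := hut.1.2
        have h4 := ne_top_of_le_ne_top (by finiteness) hH
        finiteness
      have h5 := hu1.add_le_maxTime h hu₀ ht.1 h1 (by linarith) hv hvt
      rw [← hof, ENNReal.ofReal_le_ofReal_iff hTm0.le] at h5
      linarith
    refine ⟨tendsto_nhds_top_mono (tendsto_ofReal_div_rpow hC
      (ρ := (critWeight d γ α q - s') / 2) ?_) ?_, _, hC, key⟩
    · rw [← gain_div_eq hα1]
      exact div_pos hδ (by linarith)
    · filter_upwards [Ioo_mem_nhdsLT hTm0] with t ht
      exact key t ht
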